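/- **Definitions.** Graphs are finite, simple and undirected. A tree decomposition of a graph $G$ is a tree $T$ with bags $\chi(i)\subseteq V(G)$, $i\in V(T)$, such that the bags cover $V(G)$, every edge of $G$ has both ends in some bag, and for each $v\in V(G)$ the nodes $i$ with $v\in\chi(i)$ induce a connected subtree of $T$. The treewidth $\mathrm{tw}(G)$ is the minimum over all tree decompositions of the maximum bag size minus one. A *modulator* of $G$ is a set $X\subseteq V(G)$ with $\mathrm{tw}(G-X)\le 2$, and $\mathrm{TW2D}(G)$ is the minimum size of a modulator of $G$. A *problem instance* is a pair $(G,t)$ with $t\in\mathbb N$. It is *trivial* if $|V(G)|\le 4$, or $\mathrm{tw}(G)\le 2$, or $t=0$, or $G$ has a non-empty connected subgraph $H$ for which the graph obtained from $G[N_G[H]]$ by making all pairs of vertices of $N_G(H)$ adjacent has treewidth at most $2$; here $N_G(H)$ is the set of vertices outside $H$ with a neighbour in $H$, and $N_G[H]=N_G(H)\cup V(H)$. A modulator $X$ of $G$ is *tidy* if $X\setminus\{x\}$ is a modulator of $G$ for every $x\in X$. A set $X\subseteq V(G)$ is *linked for $(G,t)$* if for any two distinct non-adjacent $x,y\in X$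 there are at most $t+2$ pairwise internally vertex-disjoint paths between $x$ and $y$ in $G$. For real $\varepsilon\ge 1$, an *$\varepsilon$-approximation algorithm* (for Treewidth-2 Vertex Deletion) computes for every graph $G$ a modulator $X$ of $G$ with $\mathrm{TW2D}(G)\le|X|\le\varepsilon\cdot\mathrm{TW2D}(G)$. Algorithms are deterministic, and polynomial time means time bounded by a polynomial in $|V(G)|$, where additions, subtractions and comparisons of natural numbers are unit-cost operations. **Theorem.** Let $\mathcal A$ be a polynomial time $\varepsilon$-approximation algorithm for Treewidth-2 Vertex Deletion. Then there is an algorithm that, given any non-trivial problem instance $(G,t)$, computes in time polynomial in $|V(G)|$ one of the following (and tells which one): 1. a problem instance $(G',t')$ with $\mathrm{TW2D}(G)\le t\iff\mathrm{TW2D}(G')\le t'$, $|V(G')|<|V(G)|$ and $t'\le t$; 2. a problem instance $(G',t)$ with $V(G')=V(G)$ and $\mathrm{TW2D}(G)\le t\iff\mathrm{TW2D}(G')\le t$, together with a tidy modulator $X$ of $G'$ that is linked for $(G',t)$ and satisfies $|X|\le\varepsilon t(3t+4)$. -/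

import Mathlib

namespace TW2D

/-! ### Treewidth and modulators (all graphs below are finite) -/

section Graphs

variable {V : Type}

/-- A tree decomposition of `G` whose nodes are indexed by `ι`. -/
structure TreeDecomposition (G : SimpleGraph V) (ι : Type) where
  tree : SimpleGraph ι
  isTree : tree.IsTree
  bag : ι → Finset V
  vertex_mem : ∀ v : V, ∃ i, v ∈ bag i
  edge_mem : ∀ u v : V, G.Adj u v → ∃ i, u ∈ bag i ∧ v ∈ bag i
  connected : ∀ v : V, (tree.induce {i | v ∈ bag i}).Connected

/-- The treewidth of a finite graph: the least `w` such that some tree decomposition with finitely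
many nodes has all its bags of size at most `w + 1`. (The graph without vertices gets the value
`0`.) -/
noncomputable def treewidth (G : SimpleGraph V) : ℕ :=
  sInf {w | ∃ (m : ℕ) (D : TreeDecomposition G (Fin m)), ∀ i, (D.bag i).card ≤ w + 1}

/-- `X` is a modulator of `G`: the graph `G - X` has treewidth at most two. -/
def IsModulator (G : SimpleGraph V) (X : Set V) : Prop :=
  treewidth (G.induce Xᶜ) ≤ 2

/-- The size of a minimum modulator of the finite graph `G`. -/
noncomputable def minModulator (G : SimpleGraph V) : ℕ :=
  sInf {k | ∃ X : Finset V, IsModulator G (X : Set V) ∧ X.card = k}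

/-- A modulator from which any one vertex can be removed such that a modulator remains. -/
def IsTidyModulator (G : SimpleGraph V) (X : Set V) : Prop :=
  IsModulator G X ∧ ∀ x ∈ X, IsModulator G (X \ {x})

/-- There are `k` pairwise internally vertex-disjoint (simple) paths between `x` and `y`. (For
distinct non-adjacent `x`, `y` such paths have interior vertices, so they are distinct.) -/
def HasDisjointPaths (G : SimpleGraph V) (k : ℕ) (x y : V) : Prop :=
  ∃ P : Fin k → G.Path x y, ∀ i j, i ≠ j →
    ∀ v, v ∈ (P i : G.Walk x y).support → v ∈ (P j : G.Walk x y).support → v = x ∨ v = y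

/-- `X` is linked for `(G, t)`: two distinct non-adjacent vertices of `X` never have more than
`t + 2` internally vertex-disjoint paths between them. -/
def IsLinked (G : SimpleGraph V) (t : ℕ) (X : Set V) : Prop :=
  ∀ x ∈ X, ∀ y ∈ X, x ≠ y → ¬ G.Adj x y → ∀ k, HasDisjointPaths G k x y → k ≤ t + 2

/-- The open neighbourhood of a vertex set. -/
def nbhd (G : SimpleGraph V) (U : Set V) : Set V :=
  {v | v ∉ U ∧ ∃ u ∈ U, G.Adj u v}

/-- The graph on `V` in which exactly the pairs of distinct elements of `S` are adjacent. -/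
def cliqueOn (S : Set V) : SimpleGraph V where
  Adj a b := a ≠ b ∧ a ∈ S ∧ b ∈ S
  symm := ⟨fun _ _ h => ⟨h.1.symm, h.2.2, h.2.1⟩⟩
  loopless := ⟨fun _ h => h.1 rfl⟩

/-- Some component contraction applies to `G`: there is a connected subgraph `H` such that the
graph induced by the closed neighbourhood of `H`, with the open neighbourhood of `H` turned into
a clique, has treewidth at most two. (`Connected` includes that `H` has a vertex.) -/
def ContractionApplies (G : SimpleGraph V) : Prop :=
  ∃ H : G.Subgraph, H.Connected ∧
    treewidth ((G ⊔ cliqueOn (nbhd G H.verts)).induce (nbhd G H.verts ∪ H.verts)) ≤ 2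

/-- The instance `(G, t)` is trivial. -/
def IsTrivial (G : SimpleGraph V) (t : ℕ) : Prop :=
  Nat.card V ≤ 4 ∨ treewidth G ≤ 2 ∨ t = 0 ∨ ContractionApplies G

end Graphs

/-! ### A machine model with running times

Programs manipulate binary trees with natural numbers at the leaves. Elementary operations take
apart a pair, test for a pair, write a constant, and add or subtract two numbers. As for random
access machines with addition and subtraction (and no multiplication), a number counts as one
unit. Each elementary operation and each test costs the number of nodes of the value at hand, so
that the cost of a run bounds the size of all values that occur in it. -/

/-- Binary trees with natural numbers at the leaves. -/
inductive Data : Type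
  | num (n : ℕ)
  | pair (a b : Data)

/-- The number of nodes. -/
def Data.size : Data → ℕ
  | .num _ => 1
  | .pair a b => a.size + b.size + 1

/-- Elementary operations. -/
inductive Op : Type
  | id
  | const (n : ℕ)
  | fst
  | snd
  | isPair
  | add
  | sub

/-- The effect of an elementary operation; an operation that does not fit its argument
yields `0`. Subtraction is truncated. -/
def Op.run : Op → Data → Data
  | .id, x => x
  | .const n, _ => .num n
  | .fst, .pair a _ => a
  | .snd, .pair _ b => b
  | .isPair, .pair _ _ => .num 1
  | .add, .pair (.num a) (.num b) => .num (a + b)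
  | .sub, .pair (.num a) (.num b) => .num (a - b)
  | _, _ => .num 0

/-- Programs. -/
inductive Prog : Type
  | op (o : Op)
  | seq (f g : Prog)
  | pair (f g : Prog)
  | cond (c f g : Prog)
  | loop (c f : Prog)

/-- `Runs P x y n`: started on the input `x`, the program `P` halts with the output `y` after a
run of cost `n`. The program `seq f g` applies `f` and then `g`; `pair f g` applies both to the
same input; `cond c f g` applies `g` if the test `c` gives `0` and `f` otherwise; `loop c f`
applies `f` repeatedly until the test `c` gives `0`. -/
inductive Runs : Prog → Data → Data → ℕ → Prop
  | op (o : Op) (x : Data) : Runs (.op o) x (o.run x) x.size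
  | seq {f g : Prog} {x y z : Data} {m n : ℕ} :
      Runs f x y m → Runs g y z n → Runs (.seq f g) x z (m + n)
  | pair {f g : Prog} {x a b : Data} {m n : ℕ} :
      Runs f x a m → Runs g x b n → Runs (.pair f g) x (.pair a b) (x.size + m + n)
  | cond_true {c f g : Prog} {x v y : Data} {m n : ℕ} :
      Runs c x v m → v ≠ .num 0 → Runs f x y n → Runs (.cond c f g) x y (x.size + m + n)
  | cond_false {c f g : Prog} {x y : Data} {m n : ℕ} :
      Runs c x (.num 0) m → Runs g x y n → Runs (.cond c f g) x y (x.size + m + n)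
  | loop_step {c f : Prog} {x v y z : Data} {k m n : ℕ} :
      Runs c x v k → v ≠ .num 0 → Runs f x y m → Runs (.loop c f) y z n →
      Runs (.loop c f) x z (x.size + k + m + n)
  | loop_stop {c f : Prog} {x : Data} {k : ℕ} :
      Runs c x (.num 0) k → Runs (.loop c f) x x (x.size + k)

/-! ### Encodings -/

/-- Lists as nested pairs, terminated by the number `0`. -/
def encList (l : List Data) : Data :=
  l.foldr Data.pair (.num 0)

open Classical in
/-- A subset of `Fin n` as its list of `n` indicator bits. -/
noncomputable def encPred {n : ℕ} (p : Fin n → Prop) : Data :=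
  encList (List.ofFn fun j => .num (if p j then 1 else 0))

/-- A set of vertices as its list of indicator bits. -/
noncomputable def encSet {n : ℕ} (X : Finset (Fin n)) : Data :=
  encPred fun j => j ∈ X

/-- A graph as the list of the rows of its adjacency matrix. -/
noncomputable def encGraph {n : ℕ} (G : SimpleGraph (Fin n)) : Data :=
  encList (List.ofFn fun i => encPred fun j => G.Adj i j)

/-- A problem instance. -/
noncomputable def encInstance {n : ℕ} (G : SimpleGraph (Fin n)) (t : ℕ) : Data :=
  .pair (encGraph G) (.num t)

/-- `A` is a polynomial time `ε`-approximation algorithm for Treewidth-2 Vertex Deletion, viewed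
as the problem of finding a minimum modulator of a graph. -/
def IsPolyApprox (ε : ℝ) (A : Prog) : Prop :=
  1 ≤ ε ∧ ∃ p : Polynomial ℕ, ∀ (n : ℕ) (G : SimpleGraph (Fin n)),
    ∃ (X : Finset (Fin n)) (c : ℕ), Runs A (encGraph G) (encSet X) c ∧ c ≤ p.eval n ∧
      IsModulator G X ∧ minModulator G ≤ X.card ∧ (X.card : ℝ) ≤ ε * minModulator G

end TW2D

namespace TW2D

/-! Treewidth at most two means that the vertices can be eliminated one by one, each with at most
two neighbours at its turn. Elimination is expressed without changing the graph: after the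
elimination of `Q`, two vertices count as adjacent if a walk with interior in `Q` joins them
(`Touch`, `bd`, `Elim`). Eliminating a vertex of degree at most two never hurts
(`Elim.insert_of_encard_le`), so a greedy procedure decides treewidth two. One vertex may be kept to
the end (`treewidth_le_two_iff_elim`), so graphs that share only the vertex `x` can be treated
separately (`Good.union`).

Let `Y` be the modulator found by the approximation algorithm and `R` the ceiling of `ε`. If `Y` has
more than `R * t` elements, the answer is no, and the complete graph on four vertices with budget 0
is returned. Otherwise `G - Y` is eliminated greedily. When the part `C` of the eliminated graph
hanging at the current vertex `v` has treewidth above two together with some `x ∈ Y`, it is recorded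
as an obstruction, `v` and its at most two neighbours go to a set `T`, and `C` is discarded. The
obstructions are disjoint, `T` has at most three vertices for each of them, and what survives has
treewidth at most two together with any single `x ∈ Y` (`greedy_spec`). Hence `Y ∪ T` is tidy.

A modulator that avoids `x` meets every obstruction for `x`. A vertex `x` with more than `t`
obstructions is thus in every modulator of size at most `t`; it is deleted and `t` decreases. If
there is no such `x`, a modulator of size at most `t` allows at most `t * t` obstructions
(`length_obstructions_le`): either the answer is no, or `Y ∪ T` has at most `R * t + 3 * t * t`
elements.

To link `Y ∪ T`, two of its vertices are joined when the flow between them is at least `t + 3`.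
Deleting at most `t` vertices then leaves them inseparable by two further vertices, so every
elimination ordering of width two creates this edge anyway (`Elim.add_edge`, `touch_of_flow`). New
edges lie inside `Y ∪ T`, so tidiness survives.

For the running time, each routine is a fold whose state grows by a bounded amount per round
(`PT.foldl`); each search for a fixed point runs as often as some list is long, which suffices by a
decreasing potential (`iter_stationary`). -/

/-! ### Polynomial time functions -/

/-- Types whose elements are represented by binary trees. -/
class Enc (α : Type) where
  enc : α → Data

open Enc

instance : Enc ℕ := ⟨Data.num⟩
instance : Enc Data := ⟨fun d => d⟩
instance : Enc Bool := ⟨fun b => .num (if b then 1 else 0)⟩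
instance {α β : Type} [Enc α] [Enc β] : Enc (α × β) := ⟨fun p => .pair (enc p.1) (enc p.2)⟩
instance {α : Type} [Enc α] : Enc (List α) := ⟨fun l => encList (l.map enc)⟩

/-- The size of the representation. -/
def sz {α : Type} [Enc α] (a : α) : ℕ := (enc a).size

section Basic

set_option linter.unusedSectionVars false

variable {α β γ δ σ : Type} [Enc α] [Enc β] [Enc γ] [Enc δ] [Enc σ]

theorem eval_le_eval (p : Polynomial ℕ) {a b : ℕ} (h : a ≤ b) : p.eval a ≤ p.eval b := by
  rw [Polynomial.eval_eq_sum, Polynomial.eval_eq_sum]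
  exact Finset.sum_le_sum fun i _ => Nat.mul_le_mul_left _ (Nat.pow_le_pow_left h i)

theorem Data.size_pos (d : Data) : 1 ≤ d.size := by
  cases d <;> simp [Data.size]

theorem Op.size_run_le (o : Op) (x : Data) : (o.run x).size ≤ x.size := by
  have := x.size_pos
  cases o <;> rcases x with n | ⟨a, b⟩ <;> try (simp [Op.run, Data.size] at *; try omega)
  all_goals
    rcases a with _ | _ <;> rcases b with _ | _ <;> simp [Data.size]

/-- Every operation is charged the size of its argument and cannot enlarge it, so a time bound is
also a bound on the output. Composition of polynomial time functions rests on this. -/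
theorem Runs.size_le {P : Prog} {x y : Data} {n : ℕ} (h : Runs P x y n) : y.size ≤ n := by
  induction h with
  | op o x => exact o.size_run_le x
  | pair _ _ _ _ => have := Data.size_pos; simp only [Data.size]; rename_i x _ _ _ _ _ _ _ _; have := x.size_pos; omega
  | _ => omega

/-- A loop whose test fails at once has no effect. -/
theorem Runs.loop_done {c f : Prog} {x : Data} {k : ℕ} (h : Runs c x (.num 0) k) :
    Runs (.loop c f) x x (x.size + k) := by
  constructor
  exact h

theorem sz_pos (a : α) : 1 ≤ sz a := Data.size_pos _

@[simp] theorem sz_pair (a : α) (b : β) : sz (a, b) = sz a + sz b + 1 := rfl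
@[simp] theorem sz_nat (a : ℕ) : sz a = 1 := rfl
@[simp] theorem sz_nil : sz ([] : List α) = 1 := rfl
@[simp] theorem sz_cons (a : α) (l : List α) : sz (a :: l) = sz a + sz l + 1 := rfl

/-- Polynomially bounded functions. -/
def PB (g : α → ℕ) : Prop := ∃ p : Polynomial ℕ, ∀ a, g a ≤ p.eval (sz a)

theorem PB.sz : PB (fun a : α => sz a) := ⟨Polynomial.X, fun a => by simp⟩

theorem PB.const (n : ℕ) : PB (fun _ : α => n) := ⟨Polynomial.C n, fun a => by simp⟩

theorem PB.add {g h : α → ℕ} (hg : PB g) (hh : PB h) : PB (fun a => g a + h a) := by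
  obtain ⟨p, hp⟩ := hg
  obtain ⟨q, hq⟩ := hh
  exact ⟨p + q, fun a => by simpa using Nat.add_le_add (hp a) (hq a)⟩

theorem PB.mul {g h : α → ℕ} (hg : PB g) (hh : PB h) : PB (fun a => g a * h a) := by
  obtain ⟨p, hp⟩ := hg
  obtain ⟨q, hq⟩ := hh
  exact ⟨p * q, fun a => by simpa using Nat.mul_le_mul (hp a) (hq a)⟩

theorem PB.eval (p : Polynomial ℕ) {g : α → ℕ} (hg : PB g) : PB (fun a => p.eval (g a)) := by
  obtain ⟨q, hq⟩ := hg
  exact ⟨p.comp q, fun a => by simpa using eval_le_eval p (hq a)⟩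

/-- Functions computable in polynomial time. -/
@[fun_prop]
def PT (f : α → β) : Prop :=
  ∃ (P : Prog) (p : Polynomial ℕ), ∀ a, ∃ c, Runs P (enc a) (enc (f a)) c ∧ c ≤ p.eval (sz a)

theorem PT.of_cost {f : α → β} (P : Prog) {g : α → ℕ} (hg : PB g)
    (h : ∀ a, ∃ c, Runs P (enc a) (enc (f a)) c ∧ c ≤ g a) : PT f := by
  obtain ⟨p, hp⟩ := hg
  refine ⟨P, p, fun a => ?_⟩
  obtain ⟨c, hc, hle⟩ := h a
  exact ⟨c, hc, hle.trans (hp a)⟩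

theorem PT.of_op {f : α → β} (o : Op) (h : ∀ a, o.run (enc a) = enc (f a)) : PT f :=
  PT.of_cost (.op o) PB.sz fun a => ⟨_, h a ▸ Runs.op o _, le_rfl⟩

theorem PT.sz_le {f : α → β} (hf : PT f) : PB (fun a => TW2D.sz (f a)) := by
  obtain ⟨P, p, h⟩ := hf
  refine ⟨p, fun a => ?_⟩
  obtain ⟨c, hc, hle⟩ := h a
  exact hc.size_le.trans hle

@[fun_prop]
theorem PT.id' : PT (fun a : α => a) := PT.of_op .id fun _ => rfl

@[fun_prop]
theorem PT.comp {f : β → γ} {g : α → β} (hf : PT f) (hg : PT g) : PT (fun a => f (g a)) := by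
  have hs := hg.sz_le
  obtain ⟨P, p, hP⟩ := hf
  obtain ⟨Q, q, hQ⟩ := hg
  refine PT.of_cost (.seq Q P) (PB.add (PB.eval q PB.sz) (PB.eval p hs)) fun a => ?_
  obtain ⟨m, hm, hm'⟩ := hQ a
  obtain ⟨n, hn, hn'⟩ := hP (g a)
  exact ⟨_, .seq hm hn, Nat.add_le_add hm' hn'⟩

/-- Writing a constant is charged the size of the ignored input once per node of `d`, hence the
linear bound. -/
theorem exists_prog_const (d : Data) : ∃ (P : Prog) (k : ℕ), ∀ x, ∃ c, Runs P x d c ∧ c ≤ k * x.size := by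
  induction d with
  | num n => exact ⟨.op (.const n), 1, fun x => ⟨_, .op _ x, by simp⟩⟩
  | pair a b iha ihb =>
    obtain ⟨P, k, hP⟩ := iha
    obtain ⟨Q, l, hQ⟩ := ihb
    refine ⟨.pair P Q, 1 + k + l, fun x => ?_⟩
    obtain ⟨c, hc, hc'⟩ := hP x
    obtain ⟨d, hd, hd'⟩ := hQ x
    refine ⟨_, .pair hc hd, ?_⟩
    rw [add_mul, add_mul]
    omega

@[fun_prop]
theorem PT.const (b : β) : PT (fun _ : α => b) := by
  obtain ⟨P, k, hP⟩ := exists_prog_const (enc b)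
  exact PT.of_cost P (PB.mul (PB.const k) PB.sz) fun a => hP (enc a)

@[fun_prop]
theorem PT.prodMk {f : α → β} {g : α → γ} (hf : PT f) (hg : PT g) : PT (fun a => (f a, g a)) := by
  obtain ⟨P, p, hP⟩ := hf
  obtain ⟨Q, q, hQ⟩ := hg
  refine PT.of_cost (.pair P Q) (PB.add (PB.add PB.sz (PB.eval p PB.sz)) (PB.eval q PB.sz))
    fun a => ?_
  obtain ⟨m, hm, hm'⟩ := hP a
  obtain ⟨n, hn, hn'⟩ := hQ a
  exact ⟨_, .pair hm hn, Nat.add_le_add (Nat.add_le_add_left hm' _) hn'⟩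

theorem PT.fst' : PT (fun p : α × β => p.1) := PT.of_op .fst fun _ => rfl
theorem PT.snd' : PT (fun p : α × β => p.2) := PT.of_op .snd fun _ => rfl

@[fun_prop]
theorem PT.fst {f : α → β × γ} (hf : PT f) : PT (fun a => (f a).1) := PT.comp PT.fst' hf
@[fun_prop]
theorem PT.snd {f : α → β × γ} (hf : PT f) : PT (fun a => (f a).2) := PT.comp PT.snd' hf

@[fun_prop]
theorem PT.add {f g : α → ℕ} (hf : PT f) (hg : PT g) : PT (fun a => f a + g a) :=
  PT.comp (f := fun p : ℕ × ℕ => p.1 + p.2) (PT.of_op .add fun _ => rfl) (PT.prodMk hf hg)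

@[fun_prop]
theorem PT.sub {f g : α → ℕ} (hf : PT f) (hg : PT g) : PT (fun a => f a - g a) :=
  PT.comp (f := fun p : ℕ × ℕ => p.1 - p.2) (PT.of_op .sub fun _ => rfl) (PT.prodMk hf hg)

@[fun_prop]
theorem PT.cond {c : α → Bool} {f g : α → β} (hc : PT c) (hf : PT f) (hg : PT g) :
    PT (fun a => bif c a then f a else g a) := by
  obtain ⟨C, r, hC⟩ := hc
  obtain ⟨P, p, hP⟩ := hf
  obtain ⟨Q, q, hQ⟩ := hg
  refine PT.of_cost (.cond C P Q) (PB.add (PB.add (PB.add PB.sz (PB.eval r PB.sz))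
    (PB.eval p PB.sz)) (PB.eval q PB.sz)) fun a => ?_
  obtain ⟨k, hk, hk'⟩ := hC a
  obtain ⟨m, hm, hm'⟩ := hP a
  obtain ⟨n, hn, hn'⟩ := hQ a
  cases h : c a with
  | true =>
    rw [h] at hk
    exact ⟨_, .cond_true hk (by simp [enc]) hm, by simp only [sz] at *; omega⟩
  | false =>
    rw [h] at hk
    exact ⟨_, .cond_false hk hn, by simp only [sz] at *; omega⟩

@[fun_prop]
theorem PT.not {f : α → Bool} (hf : PT f) : PT (fun a => !f a) := by
  have : (fun a => !f a) = fun a => bif f a then false else true := by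
    funext a; cases f a <;> rfl
  rw [this]; fun_prop

@[fun_prop]
theorem PT.and {f g : α → Bool} (hf : PT f) (hg : PT g) : PT (fun a => f a && g a) := by
  have : (fun a => f a && g a) = fun a => bif f a then g a else false := by
    funext a; cases f a <;> rfl
  rw [this]; fun_prop

@[fun_prop]
theorem PT.or {f g : α → Bool} (hf : PT f) (hg : PT g) : PT (fun a => f a || g a) := by
  have : (fun a => f a || g a) = fun a => bif f a then true else g a := by
    funext a; cases f a <;> rfl
  rw [this]; fun_prop

theorem PT.isZero : PT (fun n : ℕ => decide (n = 0)) := by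
  refine PT.of_cost (.cond (.op .id) (.op (.const 0)) (.op (.const 1)))
    (PB.mul (PB.const 3) PB.sz) fun n => ?_
  by_cases h : n = 0
  · subst h
    exact ⟨_, .cond_false (.op .id _) (.op _ _), by simp [enc, sz, Data.size]⟩
  · exact ⟨_, .cond_true (.op .id _) (by simpa [enc, Op.run] using h)
      (by simpa [enc, Op.run, h] using Runs.op (.const 0) (enc n)), by simp [enc, sz, Data.size]⟩

@[fun_prop]
theorem PT.decide_le {f g : α → ℕ} (hf : PT f) (hg : PT g) : PT (fun a => decide (f a ≤ g a)) := by
  have : (fun a => decide (f a ≤ g a)) = fun a => decide (f a - g a = 0) := by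
    funext a; simp [Nat.sub_eq_zero_iff_le]
  rw [this]; exact PT.comp PT.isZero (PT.sub hf hg)

@[fun_prop]
theorem PT.decide_lt {f g : α → ℕ} (hf : PT f) (hg : PT g) : PT (fun a => decide (f a < g a)) := by
  have : (fun a => decide (f a < g a)) = fun a => !decide (g a ≤ f a) := by
    funext a; rw [Bool.eq_iff_iff]; simp
  rw [this]; fun_prop

@[fun_prop]
theorem PT.decide_eq {f g : α → ℕ} (hf : PT f) (hg : PT g) : PT (fun a => decide (f a = g a)) := by
  have : (fun a => decide (f a = g a)) = fun a => decide (f a ≤ g a) && decide (g a ≤ f a) := by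
    funext a; simp [le_antisymm_iff]
  rw [this]; fun_prop

/-! #### Lists -/

@[fun_prop]
theorem PT.cons {f : α → β} {l : α → List β} (hf : PT f) (hl : PT l) :
    PT (fun a => f a :: l a) := PT.prodMk hf hl

/-- A nonempty list has the same encoding as the pair of its head and its tail, and the empty list
is a number, so `isPair` separates the cases and no decoding is needed. -/
theorem PT.list_cases {l : α → List β} {g : α → γ} {h : α → β → List β → γ} (hl : PT l)
    (hg : PT g) (hh : PT (fun p : α × (β × List β) => h p.1 p.2.1 p.2.2)) :
    PT (fun a => match l a with | [] => g a | b :: t => h a b t) := by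
  obtain ⟨Q, q, hQ⟩ := hg
  obtain ⟨L, ql, hL⟩ := hl
  have hs : PB (fun a => sz (l a)) := PT.sz_le ⟨L, ql, hL⟩
  obtain ⟨P, p, hP⟩ := hh
  refine PT.of_cost (.cond (.seq L (.op .isPair)) (.seq (.pair (.op .id) L) P) Q)
    (PB.add (PB.add (PB.add (PB.add PB.sz (PB.eval ql PB.sz)) hs)
      (PB.add (PB.add PB.sz (PB.add PB.sz (PB.eval ql PB.sz)))
        (PB.eval p (PB.add (PB.add PB.sz hs) (PB.const 1)))))
      (PB.eval q PB.sz)) fun a => ?_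
  obtain ⟨k, hk, hk'⟩ := hL a
  obtain ⟨n, hn, hn'⟩ := hQ a
  have hpos := sz_pos (l a)
  cases hla : l a with
  | nil =>
    rw [hla] at hk
    refine ⟨_, .cond_false (.seq hk (.op _ _)) hn, ?_⟩
    simp only [sz, hla, enc, List.map_nil, encList, List.foldr, Data.size] at *
    omega
  | cons b t =>
    obtain ⟨m, hm, hm'⟩ := hP (a, (b, t))
    have e : sz (a, b, t) = sz a + sz (l a) + 1 := by rw [hla]; rfl
    rw [e] at hm'
    rw [hla] at hk
    refine ⟨_, .cond_true (.seq hk (.op _ _))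
      (by simp [enc, encList, Op.run]) (.seq (.pair (.op .id _) hk) hm), ?_⟩
    rw [← hla] at *
    simp only [sz] at *
    omega

theorem sz_le_of_mem {b : β} {l : List β} (h : b ∈ l) : sz b ≤ sz l := by
  induction l with
  | nil => simp at h
  | cons a t ih =>
    rcases List.mem_cons.1 h with rfl | h
    · simp; omega
    · have := ih h; simp; omega

theorem length_le_sz (l : List β) : l.length ≤ sz l := by
  induction l with
  | nil => simp
  | cons a t ih => simp; omega

/-- The loop works on the triple of remaining list, parameter and state. `M` bounds the state
throughout, as each remaining entry can add at most `k`. A round costs the body and three times the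
size of the triple: the charge of the loop itself and the two operations of its test. -/
theorem runs_foldl_loop {f : α → σ → β → σ} {Bd : Prog} {pb : Polynomial ℕ}
    (hB : ∀ q : (β × List β) × (α × σ), ∃ c, Runs Bd (enc q)
      (enc (q.1.2, q.2.1, f q.2.1 q.2.2 q.1.1)) c ∧ c ≤ pb.eval (sz q))
    (x : α) (k M N : ℕ) (rest : List β) (s : σ)
    (hk : ∀ s, ∀ b ∈ rest, sz (f x s b) ≤ sz s + k)
    (hM : sz s + rest.length * k ≤ M) (hN : sz rest ≤ N) :
    ∃ c, Runs (.loop (.seq (.op .fst) (.op .isPair)) Bd) (enc (rest, x, s))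
        (enc (([] : List β), x, rest.foldl (f x) s)) c ∧
      c ≤ (rest.length + 1) *
        (3 * (N + (sz x + M + 1) + 1) + pb.eval (N + (sz x + M + 1) + 1)) := by
  induction rest generalizing s with
  | nil =>
    refine ⟨_, .loop_done (.seq (.op .fst _) (.op .isPair _)), ?_⟩
    have h1 : sz (([] : List β), x, s) ≤ N + (sz x + M + 1) + 1 := by simp at *; omega
    have h2 : sz ([] : List β) ≤ sz (([] : List β), x, s) := by simp
    simp only [sz, enc, Op.run] at *
    simp only [List.length_nil]
    omega
  | cons b t ih =>
    obtain ⟨c, hc, hcle⟩ := hB ((b, t), (x, s))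
    have hs := hk s b (by simp)
    have hexp : (t.length + 1) * k = t.length * k + k := by ring
    simp only [List.length_cons, hexp] at hM
    obtain ⟨d, hd, hdle⟩ := ih (f x s b) (fun s b hb => hk s b (by simp [hb])) (by omega)
      (by simp at hN; omega)
    refine ⟨_, .loop_step (.seq (.op .fst _) (.op .isPair _))
      (by simp [enc, encList, Op.run]) hc hd, ?_⟩
    have h1 : sz (b :: t, x, s) ≤ N + (sz x + M + 1) + 1 := by simp at *; omega
    have h2 : sz (b :: t) ≤ sz (b :: t, x, s) := by simp; omega
    have h3 : sz ((b, t), (x, s)) = sz (b :: t, x, s) := rfl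
    rw [h3] at hcle
    have h4 := hcle.trans (eval_le_eval pb h1)
    simp only [List.length_cons]
    rw [add_mul (t.length + 1) 1, one_mul]
    simp only [sz, enc, Op.run] at *
    simp only [List.map_cons, encList, List.foldr_cons] at *
    omega

/-- The growth of the state must be additive, by an amount that does not depend on the state. If one
round could double the state, the sizes could become exponential. -/
theorem PT.foldl {l : α → List β} {i : α → σ} {f : α → σ → β → σ} (hl : PT l) (hi : PT i)
    (hf : PT (fun p : α × (σ × β) => f p.1 p.2.1 p.2.2))
    (hsize : ∃ k : α → ℕ, PB k ∧ ∀ x s, ∀ b ∈ l x, sz (f x s b) ≤ sz s + k x) :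
    PT (fun x => (l x).foldl (f x) (i x)) := by
  obtain ⟨k, hk, hks⟩ := hsize
  have hB : PT (fun q : (β × List β) × (α × σ) => (q.1.2, q.2.1, f q.2.1 q.2.2 q.1.1)) := by
    refine PT.prodMk (by fun_prop) (PT.prodMk (by fun_prop) ?_)
    exact PT.comp (f := fun p : α × (σ × β) => f p.1 p.2.1 p.2.2)
      (g := fun q : (β × List β) × (α × σ) => (q.2.1, q.2.2, q.1.1)) hf (by fun_prop)
  have hI : PT (fun x => (l x, x, i x)) := by fun_prop
  have hls := hl.sz_le
  have his := hi.sz_le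
  have hIs := hI.sz_le
  obtain ⟨Bd, pb, hBd⟩ := hB
  obtain ⟨I, pi, hI⟩ := hI
  have hM : PB (fun x => sz (i x) + sz (l x) * k x) := PB.add his (PB.mul hls hk)
  have hS : PB (fun x => sz (l x) + (sz x + (sz (i x) + sz (l x) * k x) + 1) + 1) :=
    PB.add (PB.add hls (PB.add (PB.add PB.sz hM) (PB.const 1))) (PB.const 1)
  have hK := PB.mul (PB.add hls (PB.const 1))
    (PB.add (PB.mul (PB.const 3) hS) (PB.eval pb hS))
  refine PT.of_cost (.seq I (.seq (.loop (.seq (.op .fst) (.op .isPair)) Bd)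
    (.seq (.op .snd) (.op .snd)))) (PB.add (PB.add (PB.eval pi PB.sz) hK) (PB.add hK hK))
    fun x => ?_
  obtain ⟨c, hc, hcle⟩ := hI x
  have hmul : (l x).length * k x ≤ sz (l x) * k x :=
    Nat.mul_le_mul_right _ (length_le_sz _)
  obtain ⟨d, hd, hdle⟩ := runs_foldl_loop hBd x (k x) (sz (i x) + sz (l x) * k x)
    (sz (l x)) (l x) (i x) (hks x) (by omega) le_rfl
  refine ⟨_, .seq hc (.seq hd (.seq (.op .snd _) (.op .snd _))), ?_⟩
  have h1 := hd.size_le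
  have h2 := Op.size_run_le .snd (enc (([] : List β), x, (l x).foldl (f x) (i x)))
  have h3 : ((l x).length + 1) * (3 * (sz (l x) + (sz x + (sz (i x) + sz (l x) * k x) + 1) + 1) +
      pb.eval (sz (l x) + (sz x + (sz (i x) + sz (l x) * k x) + 1) + 1)) ≤
      (sz (l x) + 1) * (3 * (sz (l x) + (sz x + (sz (i x) + sz (l x) * k x) + 1) + 1) +
      pb.eval (sz (l x) + (sz x + (sz (i x) + sz (l x) * k x) + 1) + 1)) :=
    Nat.mul_le_mul_right _ (Nat.add_le_add_right (length_le_sz _) 1)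
  have h4 := hdle.trans h3
  omega

theorem PT.foldl_of_sz {l : α → List β} {i : α → σ} {f : α → σ → β → σ} (hl : PT l) (hi : PT i)
    (hf : PT (fun p : α × (σ × β) => f p.1 p.2.1 p.2.2)) {k : α × β → ℕ} (hk : PB k)
    (hsize : ∀ x s b, sz (f x s b) ≤ sz s + k (x, b)) :
    PT (fun x => (l x).foldl (f x) (i x)) := by
  obtain ⟨p, hp⟩ := hk
  refine PT.foldl hl hi hf ⟨fun x => p.eval (sz x + sz (l x) + 1),
    PB.eval p (PB.add (PB.add PB.sz hl.sz_le) (PB.const 1)), fun x s b hb => ?_⟩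
  refine (hsize x s b).trans (Nat.add_le_add_left ((hp _).trans (eval_le_eval p ?_)) _)
  have := sz_le_of_mem hb
  simp; omega

theorem PT.reverse {l : α → List β} (hl : PT l) : PT (fun x => (l x).reverse) := by
  have : (fun x => (l x).reverse) = fun x => (l x).foldl (fun s b => b :: s) [] := by
    funext x; simp
  rw [this]
  exact PT.foldl_of_sz (k := fun p => sz p) (f := fun _ s b => b :: s) hl (by fun_prop)
    (by fun_prop) PB.sz (fun x s b => by simp; omega)

@[fun_prop]
theorem PT.map {l : α → List β} {f : α → β → γ} (hf : PT (fun p : α × β => f p.1 p.2))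
    (hl : PT l) : PT (fun x => (l x).map (f x)) := by
  have : (fun x => (l x).map (f x)) =
      fun x => ((l x).foldl (fun s b => f x b :: s) []).reverse := by
    funext x; simp
  rw [this]
  refine PT.reverse (PT.foldl_of_sz (f := fun x s b => f x b :: s) hl (by fun_prop)
    (PT.cons ?_ (by fun_prop)) (PB.add hf.sz_le (PB.const 1)) (fun x s b => by simp; omega))
  exact PT.comp (f := fun p : α × β => f p.1 p.2)
    (g := fun p : α × (List γ × β) => (p.1, p.2.2)) hf (by fun_prop)

theorem foldl_filter_eq (p : β → Bool) (l s : List β) :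
    l.foldl (fun s b => bif p b then b :: s else s) s = (l.filter p).reverse ++ s := by
  induction l generalizing s with
  | nil => rfl
  | cons a t ih => cases h : p a <;> simp [h, ih]

@[fun_prop]
theorem PT.filter {l : α → List β} {f : α → β → Bool} (hf : PT (fun p : α × β => f p.1 p.2))
    (hl : PT l) : PT (fun x => (l x).filter (f x)) := by
  have : (fun x => (l x).filter (f x)) =
      fun x => ((l x).foldl (fun s b => bif f x b then b :: s else s) []).reverse := by
    funext x; simp [foldl_filter_eq]
  rw [this]
  refine PT.reverse (PT.foldl_of_sz (f := fun x s b => bif f x b then b :: s else s) hl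
    (by fun_prop) (PT.cond ?_ (by fun_prop) (by fun_prop)) (k := fun p => sz p) PB.sz
    (fun x s b => by cases f x b <;> simp; omega))
  exact PT.comp (f := fun p : α × β => f p.1 p.2)
    (g := fun p : α × (List β × β) => (p.1, p.2.2)) hf (by fun_prop)

@[fun_prop]
theorem PT.any {l : α → List β} {f : α → β → Bool} (hf : PT (fun p : α × β => f p.1 p.2))
    (hl : PT l) : PT (fun x => (l x).any (f x)) := by
  have : (fun x => (l x).any (f x)) =
      fun x => match (l x).filter (f x) with | [] => false | _ :: _ => true := by
    funext x
    cases h : (l x).filter (f x) with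
    | nil => simpa [List.filter_eq_nil_iff] using h
    | cons b t =>
      have : b ∈ (l x).filter (f x) := by simp [h]
      simpa using ⟨b, List.mem_filter.1 this⟩
  rw [this]
  exact PT.list_cases (g := fun _ => false) (h := fun _ _ _ => true) (by fun_prop) (by fun_prop)
    (by fun_prop)

@[fun_prop]
theorem PT.all {l : α → List β} {f : α → β → Bool} (hf : PT (fun p : α × β => f p.1 p.2))
    (hl : PT l) : PT (fun x => (l x).all (f x)) := by
  have : (fun x => (l x).all (f x)) = fun x => !(l x).any (fun b => !f x b) := by
    funext x; rw [Bool.eq_iff_iff]; simp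
  rw [this]; fun_prop

@[fun_prop]
theorem PT.length {l : α → List β} (hl : PT l) : PT (fun x => (l x).length) := by
  have : (fun x => (l x).length) = fun x => (l x).foldl (fun s _ => s + 1) 0 := by
    have key : ∀ (l : List β) (n : ℕ), l.foldl (fun s _ => s + 1) n = n + l.length := by
      intro l
      induction l with
      | nil => intro n; rfl
      | cons a t ih => intro n; simp [ih]; omega
    funext x; rw [key, Nat.zero_add]
  rw [this]
  exact PT.foldl_of_sz (k := fun _ => 0) (f := fun _ s _ => s + 1) hl (by fun_prop)
    (by fun_prop) (PB.const 0) (fun x s b => by simp)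

@[fun_prop]
theorem PT.append {l m : α → List β} (hl : PT l) (hm : PT m) : PT (fun x => l x ++ m x) := by
  have : (fun x => l x ++ m x) = fun x => (l x).reverse.foldl (fun s b => b :: s) (m x) := by
    funext x; simp
  rw [this]
  exact PT.foldl_of_sz (k := fun p => sz p) (f := fun _ s b => b :: s) (PT.reverse hl)
    (by fun_prop) (by fun_prop) PB.sz (fun x s b => by simp; omega)

theorem sz_append (l m : List β) : sz (l ++ m) + 1 = sz l + sz m := by
  induction l with
  | nil => simp; omega
  | cons a t ih => simp; omega

@[fun_prop]
theorem PT.flatMap {l : α → List β} {f : α → β → List γ} (hf : PT (fun p : α × β => f p.1 p.2))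
    (hl : PT l) : PT (fun x => (l x).flatMap (f x)) := by
  have : (fun x => (l x).flatMap (f x)) = fun x => (l x).foldl (fun s b => s ++ f x b) [] := by
    funext x; simp [List.flatMap_eq_foldl]
  rw [this]
  refine PT.foldl_of_sz (f := fun x s b => s ++ f x b) hl (by fun_prop)
    (PT.append (by fun_prop) ?_)
    (k := fun p => sz (f p.1 p.2)) hf.sz_le (fun x s b => by have := sz_append s (f x b); dsimp only; omega)
  exact PT.comp (f := fun p : α × β => f p.1 p.2)
    (g := fun p : α × (List γ × β) => (p.1, p.2.2)) hf (by fun_prop)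

@[fun_prop]
theorem PT.decide_mem {f : α → ℕ} {l : α → List ℕ} (hf : PT f) (hl : PT l) :
    PT (fun x => decide (f x ∈ l x)) := by
  have : (fun x => decide (f x ∈ l x)) = fun x => (l x).any fun b => decide (f x = b) := by
    funext x; simp [List.any_eq]
  rw [this]; fun_prop

@[fun_prop]
theorem PT.decide_mem_prod {f : α → ℕ × ℕ} {l : α → List (ℕ × ℕ)} (hf : PT f) (hl : PT l) :
    PT (fun x => decide (f x ∈ l x)) := by
  have : (fun x => decide (f x ∈ l x)) =
      fun x => (l x).any fun b => decide ((f x).1 = b.1) && decide ((f x).2 = b.2) := by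
    funext x; simp [List.any_eq]
  rw [this]; fun_prop

theorem PT.zipIdx {l : α → List β} (hl : PT l) : PT (fun x => (l x).zipIdx) := by
  have key : ∀ (l : List β) (s : List (β × ℕ)) (n : ℕ),
      l.foldl (fun (s : ℕ × List (β × ℕ)) b => (s.1 + 1, (b, s.1) :: s.2)) (n, s) =
        (n + l.length, (l.zipIdx n).reverse ++ s) := by
    intro l
    induction l with
    | nil => intro s n; rfl
    | cons a t ih => intro s n; simp [ih]; omega
  have : (fun x => (l x).zipIdx) = fun x => ((l x).foldl
      (fun (s : ℕ × List (β × ℕ)) b => (s.1 + 1, (b, s.1) :: s.2)) (0, [])).2.reverse := by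
    funext x; simp [key]
  rw [this]
  exact PT.reverse (PT.snd (PT.foldl_of_sz (k := fun p => sz p + 2)
    (f := fun _ (s : ℕ × List (β × ℕ)) b => (s.1 + 1, (b, s.1) :: s.2)) hl (by fun_prop)
    (by fun_prop) (PB.add PB.sz (PB.const 2)) (fun x s b => by rcases s with ⟨a, s⟩; simp; omega)))

/-- The machine cannot multiply, so a fixed factor is a repeated addition. -/
theorem PT.const_mul (k : ℕ) {f : α → ℕ} (hf : PT f) : PT (fun x => k * f x) := by
  induction k with
  | zero => simpa using PT.const 0
  | succ k ih => simpa [add_mul] using PT.add ih hf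

end Basic

open Enc

/-! ### The algorithm -/

section Control

variable {α β γ σ : Type} [Enc α] [Enc β] [Enc γ] [Enc σ]

/-- Apply `f` to the first entry of a list, if there is one. -/
def headCase (l : List β) (d : γ) (f : β → γ) : γ :=
  match l with
  | [] => d
  | b :: _ => f b

@[fun_prop]
theorem PT.headCase {l : α → List β} {d : α → γ} {f : α → β → γ} (hl : PT l) (hd : PT d)
    (hf : PT (fun p : α × β => f p.1 p.2)) : PT (fun x => headCase (l x) (d x) (f x)) :=
  PT.list_cases (h := fun a b _ => f a b) hl hd
    (PT.comp (f := fun p : α × β => f p.1 p.2) (g := fun p : α × (β × List β) => (p.1, p.2.1))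
      hf (by fun_prop))

/-- Apply `f` as often as the list `l` is long. -/
def iter (l : List β) (f : σ → σ) (s : σ) : σ := l.foldl (fun s _ => f s) s

theorem PT.iter {l : α → List β} {f : α → σ → σ} {s : α → σ} (hl : PT l) (hs : PT s)
    (hf : PT (fun p : α × σ => f p.1 p.2)) {k : α → ℕ} (hk : PB k)
    (hsize : ∀ x s, sz (f x s) ≤ sz s + k x) : PT (fun x => iter (l x) (f x) (s x)) :=
  PT.foldl hl hs (PT.comp (f := fun p : α × σ => f p.1 p.2)
    (g := fun p : α × (σ × β) => (p.1, p.2.1)) hf (by fun_prop)) ⟨k, hk, fun x s _ _ => hsize x s⟩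

end Control

/-! ### Searching, elimination and the collection of obstructions -/

/-- `b` is the root `r` or the tail of an arc in `s`. -/
def found (r : ℕ) (s : List (ℕ × ℕ)) (b : ℕ) : Bool :=
  decide (b = r) || s.any fun e => decide (e.1 = b)

/-- Extend a tree of arcs directed towards `r`. -/
def searchStep (A : List (ℕ × ℕ)) (r : ℕ) (s : List (ℕ × ℕ)) : List (ℕ × ℕ) :=
  headCase (A.filter fun e => found r s e.2 && !found r s e.1) s fun e => e :: s

/-- A tree of arcs from `A` directed towards `r`, the latest arc first, that cannot be extended. -/
def search (A : List (ℕ × ℕ)) (r : ℕ) : List (ℕ × ℕ) := iter A (searchStep A r) []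

/-- The vertices that can be reached from `v` through vertices in `Q`. -/
def comp (E : List (ℕ × ℕ)) (Q : List ℕ) (v : ℕ) : List ℕ :=
  v :: (search (E.filter fun e => decide (e.1 ∈ Q)) v).map Prod.fst

/-- The vertices in `U` outside `Q` that can be reached from `v` through vertices in `Q`. -/
def bdry (E : List (ℕ × ℕ)) (U Q : List ℕ) (v : ℕ) : List ℕ :=
  U.filter fun a => (!decide (a ∈ Q) && !decide (a = v)) &&
    (comp E Q v).any fun u => decide ((u, a) ∈ E)

/-- Eliminate a vertex in `D`, if possible. -/
def elimStep (E : List (ℕ × ℕ)) (U D Q : List ℕ) : List ℕ :=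
  headCase (D.filter fun v => !decide (v ∈ Q) && decide ((bdry E U Q v).length ≤ 2)) Q
    fun v => v :: Q

/-- Eliminate as many vertices in `D` as possible. -/
def elimAll (E : List (ℕ × ℕ)) (U D : List ℕ) : List ℕ := iter D (elimStep E U D) []

/-- The test whether all vertices of `D` can be eliminated in the graph on `D` and `x`. -/
def good (E : List (ℕ × ℕ)) (D : List ℕ) (x : ℕ) : Bool :=
  D.all fun v => decide (v ∈ elimAll E (x :: D) D)

/-- The state of the search for obstructions: the remaining vertices, the eliminated ones among
them, the deleted vertices, and the obstructions that were found. -/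
abbrev GState : Type := List ℕ × List ℕ × List ℕ × List (List ℕ)

/-- Eliminate one vertex, or record an obstruction. -/
def greedyStep (V : List ℕ) (E : List (ℕ × ℕ)) (X : List ℕ) (s : GState) : GState :=
  headCase (V.filter fun v => (decide (v ∈ s.1) && !decide (v ∈ s.2.1)) &&
      decide ((bdry E s.1 s.2.1 v).length ≤ 2)) s fun v =>
    bif X.any fun x => !good E (comp E s.2.1 v) x then
      (s.1.filter fun a => !decide (a ∈ comp E s.2.1 v) && !decide (a ∈ bdry E s.1 s.2.1 v),
        s.2.1.filter fun a => !decide (a ∈ comp E s.2.1 v),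
        -- Filtering `V` keeps this list no longer than `V`, whatever the state, which the additive
        -- growth bound needs.
        V.filter fun a => (decide (a ∈ s.2.2.1) || decide (a = v)) ||
          decide (a ∈ bdry E s.1 s.2.1 v),
        comp E s.2.1 v :: s.2.2.2)
    else (s.1, v :: s.2.1, s.2.2.1, s.2.2.2)

def greedy (V : List ℕ) (E : List (ℕ × ℕ)) (X : List ℕ) : GState :=
  iter V (greedyStep V E X) (V.filter fun a => !decide (a ∈ X), [], [], [])

/-! ### Maximum flows and linking -/

/-- Reverse the arc `a`. -/
def flip (O : List (ℕ × ℕ)) (a : ℕ × ℕ) : List (ℕ × ℕ) :=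
  O.map fun e => bif decide (e.1 = a.1) && decide (e.2 = a.2) then (e.2, e.1) else e

/-- Reverse the arcs on the path in the tree `tr` that starts in `s`. -/
def flipPath (tr : List (ℕ × ℕ)) (s : ℕ) (O : List (ℕ × ℕ)) : ℕ × List (ℕ × ℕ) :=
  tr.foldl (fun p a => bif decide (a.1 = p.1) then (a.2, flip p.2 a) else p) (s, O)

/-- Augment the flow from `s` to `r` by one unit, if possible. -/
def augment (s r : ℕ) (p : List (ℕ × ℕ) × ℕ) : List (ℕ × ℕ) × ℕ :=
  bif found r (search p.1 r) s then ((flipPath (search p.1 r) s p.1).2, p.2 + 1) else p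

/-- The arcs of the graph in which the vertex `v` is split into `2 * v` and `2 * v + 1`. -/
def splitArcs (V : List ℕ) (E : List (ℕ × ℕ)) : List (ℕ × ℕ) :=
  V.map (fun v => (v + v, v + v + 1)) ++ E.map fun e => (e.1 + e.1 + 1, e.2 + e.2)

/-- The maximum flow from `x` to `y` with unit vertex capacities. -/
def flow (V : List ℕ) (E : List (ℕ × ℕ)) (x y : ℕ) : ℕ :=
  (iter (splitArcs V E) (augment (x + x + 1) (y + y)) (splitArcs V E, 0)).2

/-- The pairs of elements of a list. -/
def pairs (X : List ℕ) : List (ℕ × ℕ) := X.flatMap fun a => X.map fun b => (a, b)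

/-- Join two vertices in `X` with a large flow between them. -/
def linkStep (V X : List ℕ) (t : ℕ) (E : List (ℕ × ℕ)) : List (ℕ × ℕ) :=
  headCase ((pairs X).filter fun e => (!decide (e.1 = e.2) && !decide (e ∈ E)) &&
    -- Testing both directions makes it unnecessary to know that the flow value is symmetric.
    (decide (t + 3 ≤ flow V E e.1 e.2) && decide (t + 3 ≤ flow V E e.2 e.1))) E fun e => (e.1, e.2) :: (e.2, e.1) :: E

def linkAll (V X : List ℕ) (t : ℕ) (E : List (ℕ × ℕ)) : List (ℕ × ℕ) :=
  iter (pairs X) (linkStep V X t) E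

/-! ### Assembling the reduction -/

/-- The number of obstructions that `x` takes part in. -/
def badCount (E : List (ℕ × ℕ)) (Ds : List (List ℕ)) (x : ℕ) : ℕ :=
  (Ds.filter fun D => !good E D x).length

/-- The adjacency matrix. -/
def matrix (V : List ℕ) (E : List (ℕ × ℕ)) : List (List Bool) :=
  V.map fun i => V.map fun j => decide ((i, j) ∈ E)

/-- The entries of the adjacency matrix of the complete graph on four vertices. -/
def fourClique : List (List Bool) := matrix (List.range 4) ((pairs (List.range 4)).filter
  fun e => decide (e.1 ≠ e.2))

/-- The main algorithm, on a graph with vertices `V` and arcs `E` and an approximate modulator `Y`,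
where `R` bounds the approximation ratio. -/
def reduce (R : ℕ) (V : List ℕ) (E : List (ℕ × ℕ)) (Y : List ℕ) (t : ℕ) : Data :=
  bif decide (R * t < Y.length) then enc (0, (fourClique, 0)) else
  headCase (Y.filter fun x => decide (t < badCount E (greedy V E Y).2.2.2 x))
    -- A product by repeated addition. For `V` the numbers below `n` it is `min n t * t`. Capping at
    -- `n` keeps the number of additions polynomial even for huge `t`, and loses nothing since a
    -- modulator inside `V` has at most `n` elements.
    (bif decide ((V.filter fun v => decide (v < t)).foldl (fun s _ => s + t) 0 <
        (greedy V E Y).2.2.2.length) then enc (0, (fourClique, 0)) else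
      enc (1, (matrix V (linkAll V (V.filter fun a => decide (a ∈ Y) ||
          decide (a ∈ (greedy V E Y).2.2.1)) t E), t),
        V.map fun v => (decide (v ∈ Y) || decide (v ∈ (greedy V E Y).2.2.1))))
    fun x => enc (0, (matrix (V.filter fun v => !decide (v = x)) E, t - 1))

/-- The indices of the true entries of a list. -/
def trueIndices (l : List Bool) : List ℕ := (l.zipIdx.filter fun p => p.1).map Prod.snd

/-- The arcs of a graph, given by its adjacency matrix. -/
def arcs (rows : List (List Bool)) : List (ℕ × ℕ) :=
  rows.zipIdx.flatMap fun p => (trueIndices p.1).map fun j => (p.2, j)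

def mainFun (R : ℕ) (p : List Bool × (List (List Bool) × ℕ)) : Data :=
  reduce R (p.2.1.zipIdx.map Prod.snd) (arcs p.2.1) (trueIndices p.1) p.2.2

/-! ### Running times -/

section PT

variable {α : Type} [Enc α]

theorem sz_headCase_le {β γ : Type} [Enc γ] {l : List β} {d : γ} {f : β → γ} {k : ℕ}
    (hd : sz d ≤ k) (hf : ∀ b ∈ l, sz (f b) ≤ k) : sz (headCase l d f) ≤ k := by
  cases l with
  | nil => exact hd
  | cons b t => exact hf b (by simp)

theorem sz_filter_le {β : Type} [Enc β] (p : β → Bool) (l : List β) : sz (l.filter p) ≤ sz l := by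
  induction l with
  | nil => simp
  | cons a t ih => cases h : p a <;> simp [h] <;> omega

@[simp] theorem sz_arc (e : ℕ × ℕ) : sz e = 3 := rfl

@[fun_prop]
theorem PT.found {r b : α → ℕ} {s : α → List (ℕ × ℕ)} (hr : PT r) (hs : PT s) (hb : PT b) :
    PT (fun x => found (r x) (s x) (b x)) := by
  unfold TW2D.found; fun_prop

@[fun_prop]
theorem PT.searchStep {A s : α → List (ℕ × ℕ)} {r : α → ℕ} (hA : PT A) (hr : PT r) (hs : PT s) :
    PT (fun x => searchStep (A x) (r x) (s x)) := by
  unfold TW2D.searchStep; fun_prop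

@[fun_prop]
theorem PT.search {A : α → List (ℕ × ℕ)} {r : α → ℕ} (hA : PT A) (hr : PT r) :
    PT (fun x => search (A x) (r x)) := by
  refine PT.iter (f := fun x s => TW2D.searchStep (A x) (r x) s) (k := fun _ => 4) hA (by fun_prop) (by fun_prop)
    (PB.const 4) fun x s => sz_headCase_le (by omega) fun b _ => ?_
  simp; try omega

@[fun_prop]
theorem PT.comp_list {E : α → List (ℕ × ℕ)} {Q : α → List ℕ} {v : α → ℕ} (hE : PT E) (hQ : PT Q)
    (hv : PT v) : PT (fun x => TW2D.comp (E x) (Q x) (v x)) := by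
  unfold TW2D.comp; fun_prop

@[fun_prop]
theorem PT.bdry {E : α → List (ℕ × ℕ)} {U Q : α → List ℕ} {v : α → ℕ} (hE : PT E) (hU : PT U)
    (hQ : PT Q) (hv : PT v) : PT (fun x => bdry (E x) (U x) (Q x) (v x)) := by
  unfold TW2D.bdry; fun_prop

@[fun_prop]
theorem PT.elimAll {E : α → List (ℕ × ℕ)} {U D : α → List ℕ} (hE : PT E) (hU : PT U)
    (hD : PT D) : PT (fun x => elimAll (E x) (U x) (D x)) := by
  unfold TW2D.elimAll
  refine PT.iter (f := fun x s => elimStep (E x) (U x) (D x) s) (k := fun _ => 2) hD (by fun_prop)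
    (by unfold elimStep; fun_prop) (PB.const 2) fun x s => sz_headCase_le (by omega) fun b _ => ?_
  simp; try omega

@[fun_prop]
theorem PT.good {E : α → List (ℕ × ℕ)} {D : α → List ℕ} {v : α → ℕ} (hE : PT E)
    (hD : PT D) (hv : PT v) : PT (fun x => good (E x) (D x) (v x)) := by
  unfold TW2D.good; fun_prop

theorem sz_iter_le {β σ : Type} [Enc β] [Enc σ] (l : List β) (f : σ → σ) (s : σ) {k : ℕ}
    (h : ∀ s, sz (f s) ≤ sz s + k) : sz (iter l f s) ≤ sz s + l.length * k := by
  unfold iter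
  induction l generalizing s with
  | nil => simp
  | cons a t ih =>
    have h1 := ih (f s)
    have h2 := h s
    simp only [List.foldl_cons, List.length_cons, add_mul, one_mul]
    omega

theorem sz_search_le (A : List (ℕ × ℕ)) (r : ℕ) : sz (search A r) ≤ 1 + A.length * 4 :=
  sz_iter_le A (searchStep A r) [] fun s => sz_headCase_le (by omega) fun b _ => by simp; omega

theorem sz_nat_list (l : List ℕ) : sz l = 2 * l.length + 1 := by
  induction l with
  | nil => rfl
  | cons a t ih => simp [ih]; omega

theorem sz_arc_list (l : List (ℕ × ℕ)) : sz l = 4 * l.length + 1 := by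
  induction l with
  | nil => rfl
  | cons a t ih => simp [ih]; omega

/-- The bound is independent of `Q`, so recording an obstruction enlarges the state of `greedy` by
an amount that depends on the input only. -/
theorem sz_comp_le (E : List (ℕ × ℕ)) (Q : List ℕ) (v : ℕ) : sz (comp E Q v) ≤ 3 + 2 * sz E := by
  have h1 := sz_search_le (E.filter fun e => decide (e.1 ∈ Q)) v
  have h2 := E.length_filter_le fun e => decide (e.1 ∈ Q)
  rw [sz_arc_list] at h1
  rw [sz_nat_list, sz_arc_list, comp, List.length_cons, List.length_map]
  omega

@[fun_prop]
theorem PT.greedy {V X : α → List ℕ} {E : α → List (ℕ × ℕ)} (hV : PT V) (hE : PT E)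
    (hX : PT X) : PT (fun x => greedy (V x) (E x) (X x)) := by
  refine PT.iter (f := fun x s => greedyStep (V x) (E x) (X x) s)
    (k := fun x => 4 + 2 * sz (E x) + sz (V x)) hV (by fun_prop)
    (by unfold greedyStep; fun_prop)
    (PB.add (PB.add (PB.const 4) (PB.mul (PB.const 2) hE.sz_le)) hV.sz_le)
    fun x s => sz_headCase_le (by omega) fun v _ => ?_
  have h1 := sz_comp_le (E x) s.2.1 v
  rcases s with ⟨U, Q, T, Ds⟩
  dsimp only
  cases (X x).any fun x_1 => !TW2D.good (E x) (TW2D.comp (E x) Q v) x_1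
  · simp; omega
  · have h2 := sz_filter_le (fun a => !decide (a ∈ TW2D.comp (E x) Q v) &&
      !decide (a ∈ TW2D.bdry (E x) U Q v)) U
    have h3 := sz_filter_le (fun a => !decide (a ∈ TW2D.comp (E x) Q v)) Q
    have h4 := sz_filter_le (fun a => (decide (a ∈ T) || decide (a = v)) ||
          decide (a ∈ TW2D.bdry (E x) U Q v)) (V x)
    simp only [cond_true, sz_pair, sz_cons] at *
    omega

theorem sz_flip (O : List (ℕ × ℕ)) (a : ℕ × ℕ) : sz (flip O a) = sz O := by
  simp [sz_arc_list, flip]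

@[fun_prop]
theorem PT.flip {O : α → List (ℕ × ℕ)} {a : α → ℕ × ℕ} (hO : PT O) (ha : PT a) :
    PT (fun x => flip (O x) (a x)) := by
  unfold TW2D.flip; fun_prop

@[fun_prop]
theorem PT.flipPath {tr O : α → List (ℕ × ℕ)} {s : α → ℕ} (ht : PT tr) (hs : PT s) (hO : PT O) :
    PT (fun x => flipPath (tr x) (s x) (O x)) := by
  refine PT.foldl_of_sz (k := fun _ => 0) (i := fun x => (s x, O x))
    (f := fun _ p a => bif decide (a.1 = p.1) then (a.2, TW2D.flip p.2 a) else p)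
    ht (by fun_prop) (by fun_prop) (PB.const 0) fun x s b => ?_
  cases decide (b.1 = s.1) <;> rcases s with ⟨s, O⟩ <;> simp [sz_flip]

theorem sz_flipPath (tr : List (ℕ × ℕ)) (s : ℕ) (O : List (ℕ × ℕ)) :
    sz (flipPath tr s O).2 = sz O := by
  unfold flipPath
  induction tr generalizing s O with
  | nil => rfl
  | cons a t ih =>
    rw [List.foldl_cons]
    cases decide (a.1 = s)
    · exact ih s O
    · exact (ih _ _).trans (sz_flip O a)

@[fun_prop]
theorem PT.flow {V : α → List ℕ} {E : α → List (ℕ × ℕ)} {a b : α → ℕ} (hV : PT V) (hE : PT E)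
    (ha : PT a) (hb : PT b) : PT (fun x => flow (V x) (E x) (a x) (b x)) := by
  unfold TW2D.flow splitArcs
  refine PT.snd (PT.iter (f := fun x s => augment (a x + a x + 1) (b x + b x) s) (k := fun _ => 0)
    (by fun_prop) (by fun_prop) (by unfold augment; fun_prop) (PB.const 0) fun x s => ?_)
  unfold augment
  cases TW2D.found (b x + b x) (TW2D.search s.1 (b x + b x)) (a x + a x + 1)
  · simp
  · rcases s with ⟨O, r⟩
    simp [sz_flipPath]

@[fun_prop]
theorem PT.pairs {X : α → List ℕ} (hX : PT X) : PT (fun x => pairs (X x)) := by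
  unfold TW2D.pairs; fun_prop

@[fun_prop]
theorem PT.linkAll {V X : α → List ℕ} {t : α → ℕ} {E : α → List (ℕ × ℕ)} (hV : PT V) (hX : PT X)
    (ht : PT t) (hE : PT E) : PT (fun x => linkAll (V x) (X x) (t x) (E x)) := by
  refine PT.iter (f := fun x s => linkStep (V x) (X x) (t x) s) (k := fun _ => 8) (by fun_prop)
    (by fun_prop) (by unfold linkStep; fun_prop) (PB.const 8)
    fun x s => sz_headCase_le (by omega) fun e _ => ?_
  simp; omega

@[fun_prop]
theorem PT.badCount {E : α → List (ℕ × ℕ)} {Ds : α → List (List ℕ)} {v : α → ℕ} (hE : PT E)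
    (hD : PT Ds) (hv : PT v) : PT (fun x => badCount (E x) (Ds x) (v x)) := by
  unfold TW2D.badCount; fun_prop

@[fun_prop]
theorem PT.matrix {V : α → List ℕ} {E : α → List (ℕ × ℕ)} (hV : PT V) (hE : PT E) :
    PT (fun x => matrix (V x) (E x)) := by
  unfold TW2D.matrix; fun_prop

@[fun_prop]
theorem PT.toEnc {β : Type} [Enc β] {f : α → β} (hf : PT f) : PT (fun x => enc (f x)) := hf

theorem PT.reduce (R : ℕ) {V Y : α → List ℕ} {E : α → List (ℕ × ℕ)} {t : α → ℕ} (hV : PT V)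
    (hE : PT E) (hY : PT Y) (ht : PT t) : PT (fun x => reduce R (V x) (E x) (Y x) (t x)) := by
  have h1 := PT.const_mul R ht
  have h2 : PT (fun x => ((V x).filter fun v => decide (v < t x)).foldl (fun s _ => s + t x) 0) :=
    PT.foldl_of_sz (k := fun _ => 0) (f := fun x s _ => s + t x) (by fun_prop) (by fun_prop)
      (by fun_prop) (PB.const 0) fun x s b => by simp
  unfold TW2D.reduce
  fun_prop

theorem PT.trueIndices {l : α → List Bool} (hl : PT l) : PT (fun x => trueIndices (l x)) := by
  have := PT.zipIdx hl
  unfold TW2D.trueIndices; fun_prop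

theorem PT.arcs {l : α → List (List Bool)} (hl : PT l) : PT (fun x => arcs (l x)) := by
  have h1 := PT.zipIdx hl
  have h2 : PT (fun p : α × (List Bool × ℕ) => TW2D.trueIndices p.2.1) :=
    PT.trueIndices (by fun_prop)
  unfold TW2D.arcs; fun_prop

theorem PT.mainFun (R : ℕ) : PT (mainFun R) := by
  have h1 : PT (fun p : List Bool × (List (List Bool) × ℕ) => p.2.1.zipIdx) :=
    PT.zipIdx (by fun_prop)
  exact PT.reduce R (by fun_prop) (PT.arcs (by fun_prop)) (PT.trueIndices (by fun_prop))
    (by fun_prop)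

end PT

/-! ### Elimination orderings of width two -/

section Elimination

variable {V W : Type*}

/-- `u` can be reached from `v` through elements of `Q`. -/
def Reach (r : V → V → Prop) (Q : Set V) : V → V → Prop :=
  Relation.ReflTransGen fun a b => r a b ∧ b ∈ Q

/-- `a` is adjacent to something that can be reached from `v` through elements of `Q`. -/
def Touch (r : V → V → Prop) (Q : Set V) (v a : V) : Prop := ∃ u, Reach r Q v u ∧ r u a

/-- The neighbours in `U` of `v` after the elimination of `Q`. -/
def bd (r : V → V → Prop) (U Q : Set V) (v : V) : Set V :=
  {a | a ∈ U ∧ a ∉ Q ∧ a ≠ v ∧ Touch r Q v a}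

/-- After the elimination of `Q`, the vertices of `U` outside `K` can be eliminated one by one
such that each of them has at most two neighbours when it is eliminated. -/
inductive Elim (r : V → V → Prop) (U K : Set V) : Set V → Prop
  | done {Q : Set V} : U ⊆ Q ∪ K → Elim r U K Q
  | step {Q : Set V} (v : V) : v ∈ U → v ∉ Q → v ∉ K → (bd r U Q v).encard ≤ 2 →
      Elim r U K (insert v Q) → Elim r U K Q

variable {r : V → V → Prop} {U K Q : Set V}

theorem Reach.mono {r' : V → V → Prop} {Q' : Set V} {u v : V} (h : Reach r Q u v)
    (hr : ∀ a b, r a b → r' a b) (hQ : Q ⊆ Q') : Reach r' Q' u v := by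
  induction h with
  | refl => exact .refl
  | tail _ h ih => exact ih.tail ⟨hr _ _ h.1, hQ h.2⟩

theorem Reach.eq_or_mem {u v : V} (h : Reach r Q v u) : u = v ∨ u ∈ Q := by
  induction h with
  | refl => exact .inl rfl
  | tail _ h => exact .inr h.2

theorem Touch.mono {r' : V → V → Prop} {Q' : Set V} {u v : V} (h : Touch r Q u v)
    (hr : ∀ a b, r a b → r' a b) (hQ : Q ⊆ Q') : Touch r' Q' u v := by
  obtain ⟨w, hw, h⟩ := h
  exact ⟨w, hw.mono hr hQ, hr _ _ h⟩

theorem Touch.symm (hr : ∀ ⦃a b⦄, r a b → r b a) {v a : V} (h : Touch r Q v a) : Touch r Q a v := by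
  obtain ⟨w, hw, h⟩ := h
  induction hw generalizing a with
  | refl => exact ⟨a, .refl, hr h⟩
  | tail _ hbc ih =>
    obtain ⟨w', hw', h'⟩ := ih hbc.1
    exact ⟨w', Relation.ReflTransGen.head ⟨hr h, hbc.2⟩ hw', h'⟩

/-- Cut a walk that visits `u` at its first and at its last visit. -/
theorem Reach.of_insert {u v w : V} (h : Reach r (insert u Q) v w) :
    Reach r Q v w ∨ (Touch r Q v u ∧ Reach r Q u w) := by
  induction h with
  | refl => exact .inl .refl
  | @tail b c _ hbc ih =>
    obtain ⟨hbc, rfl | hc⟩ := hbc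
    · rcases ih with ih | ih
      · exact .inr ⟨⟨b, ih, hbc⟩, .refl⟩
      · exact .inr ⟨ih.1, .refl⟩
    · rcases ih with ih | ih
      · exact .inl (ih.tail ⟨hbc, hc⟩)
      · exact .inr ⟨ih.1, ih.2.tail ⟨hbc, hc⟩⟩

/-- If `u` is a neighbour of `v`, then eliminating `u` replaces it by the other neighbours of `u`,
of which there is at most one. Otherwise the neighbourhood of `v` gains nothing. This is where width
two is special. -/
theorem encard_bd_insert_le (hr : ∀ ⦃a b⦄, r a b → r b a) {u v : V} (hu : u ∈ U) (hv : v ∈ U) (huQ : u ∉ Q)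
    (hvQ : v ∉ Q) (huv : u ≠ v) (h1 : (bd r U Q u).encard ≤ 2) (h2 : (bd r U Q v).encard ≤ 2) :
    (bd r U (insert u Q) v).encard ≤ 2 := by
  by_cases h : Touch r Q v u
  · have hsub : bd r U (insert u Q) v ⊆ (bd r U Q v \ {u}) ∪ (bd r U Q u \ {v}) := by
      rintro a ⟨haU, haQ, hav, w, hw, hwa⟩
      simp only [Set.mem_insert_iff, not_or] at haQ
      rcases hw.of_insert with hw | hw
      · exact .inl ⟨⟨haU, haQ.2, hav, w, hw, hwa⟩, haQ.1⟩
      · exact .inr ⟨⟨haU, haQ.2, haQ.1, w, hw.2, hwa⟩, hav⟩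
    have e1 := Set.encard_sdiff_singleton_add_one (show u ∈ bd r U Q v from ⟨hu, huQ, huv, h⟩)
    have e2 := Set.encard_sdiff_singleton_add_one
      (show v ∈ bd r U Q u from ⟨hv, hvQ, huv.symm, h.symm hr⟩)
    have f1 : (bd r U Q v \ {u}).encard ≤ 1 := by
      rw [← e1] at h2
      exact (ENat.add_le_add_iff_right (by simp)).1 (h2.trans_eq one_add_one_eq_two.symm)
    have f2 : (bd r U Q u \ {v}).encard ≤ 1 := by
      rw [← e2] at h1
      exact (ENat.add_le_add_iff_right (by simp)).1 (h1.trans_eq one_add_one_eq_two.symm)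
    calc _ ≤ _ := Set.encard_le_encard hsub
      _ ≤ _ := Set.encard_union_le _ _
      _ ≤ 1 + 1 := add_le_add f1 f2
      _ = 2 := one_add_one_eq_two
  · refine (Set.encard_le_encard ?_).trans h2
    rintro a ⟨haU, haQ, hav, w, hw, hwa⟩
    simp only [Set.mem_insert_iff, not_or] at haQ
    rcases hw.of_insert with hw | hw
    · exact ⟨haU, haQ.2, hav, w, hw, hwa⟩
    · exact absurd hw.1 h

/-- Any vertex with at most two neighbours can be eliminated first. -/
theorem Elim.insert_of_encard_le (hr : ∀ ⦃a b⦄, r a b → r b a) (h : Elim r U K Q) {v : V} (hv : v ∈ U) (hvQ : v ∉ Q)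
    (hvK : v ∉ K) (hbd : (bd r U Q v).encard ≤ 2) : Elim r U K (insert v Q) := by
  induction h with
  | done h => exact absurd (h hv) (by simp [hvQ, hvK])
  | @step Q u hu huQ huK hbu h ih =>
    -- The given ordering starts with some `u`. Unless `u = v`, the eliminations of `u` and `v`
    -- commute, both keeping at most two neighbours.
    by_cases huv : u = v
    · exact huv ▸ h
    · have := ih (by simp [Ne.symm huv, hvQ])
        (encard_bd_insert_le hr hu hv huQ hvQ huv hbu hbd)
      rw [Set.insert_comm] at this
      exact .step u hu (by simp [huv, huQ]) huK
        (encard_bd_insert_le hr hv hu hvQ huQ (Ne.symm huv) hbd hbu) this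

/-- Follow the given ordering and skip the vertices outside the image of `U'`. Walks in the smaller
graph map to walks in the larger one, so `φ` embeds each boundary in the original one. -/
theorem Elim.comap {r' : W → W → Prop} {U' K' : Set W} {φ : W → V} (hφ : Set.InjOn φ U')
    (hU : Set.MapsTo φ U' U) (hr : ∀ a ∈ U', ∀ b ∈ U', r' a b → r (φ a) (φ b))
    (hK : ∀ a ∈ U', φ a ∈ K ↔ a ∈ K') (h : Elim r U K Q) :
    Elim r' U' (K' ∩ U') {a | a ∈ U' ∧ φ a ∈ Q} := by
  have key : ∀ (Q : Set V) (v w : W), v ∈ U' → Reach r' {a | a ∈ U' ∧ φ a ∈ Q} v w →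
      w ∈ U' ∧ Reach r Q (φ v) (φ w) := by
    intro Q v w hv hw
    induction hw with
    | refl => exact ⟨hv, .refl⟩
    | tail _ h ih => exact ⟨h.2.1, ih.2.tail ⟨hr _ ih.1 _ h.2.1 h.1, h.2.2⟩⟩
  induction h with
  | done h =>
    refine .done fun a ha => ?_
    rcases h (hU ha) with h | h
    · exact .inl ⟨ha, h⟩
    · exact .inr ⟨(hK a ha).1 h, ha⟩
  | @step Q v hv hvQ hvK hbd h ih =>
    by_cases hw : ∃ w ∈ U', φ w = v
    · obtain ⟨w, hw, rfl⟩ := hw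
      have e : {a | a ∈ U' ∧ φ a ∈ Set.insert (φ w) Q} = insert w {a | a ∈ U' ∧ φ a ∈ Q} := by
        ext a
        constructor
        · rintro ⟨ha, h | h⟩
          · exact .inl (hφ ha hw h)
          · exact .inr ⟨ha, h⟩
        · rintro (rfl | h)
          · exact ⟨hw, .inl rfl⟩
          · exact ⟨h.1, .inr h.2⟩
      refine .step w hw (fun h => hvQ h.2) (fun h => hvK ((hK w hw).2 h.1)) ?_ (e ▸ ih)
      have himg : φ '' bd r' U' {a | a ∈ U' ∧ φ a ∈ Q} w ⊆ bd r U Q (φ w) := by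
        rintro _ ⟨a, ⟨haU, haQ, haw, u, hu, hua⟩, rfl⟩
        obtain ⟨h1, h2⟩ := key _ _ _ hw hu
        exact ⟨hU haU, fun h => haQ ⟨haU, h⟩, fun h => haw (hφ haU hw h), φ u, h2,
          hr _ h1 _ haU hua⟩
      rw [← (hφ.mono fun a ha => ha.1).encard_image]
      exact (Set.encard_le_encard himg).trans hbd
    · convert ih using 1
      ext a
      constructor
      · exact fun h => ⟨h.1, .inr h.2⟩
      · rintro ⟨ha, h | h⟩
        · exact absurd ⟨a, ha, h⟩ hw
        · exact ⟨ha, h⟩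

theorem Elim.mono {r' : V → V → Prop} {U' : Set V} (hU : U' ⊆ U)
    (hr : ∀ a ∈ U', ∀ b ∈ U', r' a b → r a b) (h : Elim r U K Q) :
    Elim r' U' (K ∩ U') (Q ∩ U') := by
  have := h.comap (φ := id) (K' := K) (Set.injOn_id _) hU hr (fun _ _ => Iff.rfl)
  rwa [show {a | a ∈ U' ∧ id a ∈ Q} = Q ∩ U' by ext; simp [and_comm]] at this

theorem Elim.mono_empty {r' : V → V → Prop} {U' : Set V} (hU : U' ⊆ U)
    (hr : ∀ a ∈ U', ∀ b ∈ U', r' a b → r a b) (h : Elim r U ∅ ∅) : Elim r' U' ∅ ∅ := by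
  simpa using h.mono hU hr

/-- If there are no edges between `D` and `C`, then the elimination of `D` may precede that
of `C`. -/
theorem Elim.union_aux {D C P : Set V} (hDC : ∀ a ∈ D, ∀ b ∈ C, ¬ r a b) (hd : Disjoint D C)
    (hP : P ⊆ C) (hU : U = K ∪ D ∪ C) (h : Elim r (K ∪ D) K Q) (hQ : Q ⊆ D)
    (hfin : ∀ Q', Q' ⊆ D → D ⊆ Q' ∪ K → Elim r U K (Q' ∪ P)) : Elim r U K (Q ∪ P) := by
  induction h with
  | done h => exact hfin _ hQ fun a ha => h (.inr ha)
  | @step Q v hv hvQ hvK hbd h ih =>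
    have hvD : v ∈ D := hv.resolve_left hvK
    have ih' := ih (Set.insert_subset hvD hQ)
    rw [Set.insert_union] at ih'
    have hvC := Set.disjoint_left.1 hd hvD
    refine .step v (hU ▸ .inl hv) (fun h => h.elim hvQ fun h => hvC (hP h)) hvK ?_ ih'
    refine (Set.encard_le_encard ?_).trans hbd
    -- A walk through eliminated vertices that starts in `D` cannot enter `C`, so what was
    -- eliminated there is invisible from `v`.
    have key : ∀ w, Reach r (Q ∪ P) v w → w ∈ D ∧ Reach r Q v w := by
      intro w hw
      induction hw with
      | refl => exact ⟨hvD, .refl⟩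
      | tail _ h ih =>
        have := h.2.resolve_right fun hc => hDC _ ih.1 _ (hP hc) h.1
        exact ⟨hQ this, ih.2.tail ⟨h.1, this⟩⟩
    rintro a ⟨haU, haQ, hav, w, hw, hwa⟩
    rw [hU] at haU
    exact ⟨haU.resolve_right fun h => hDC _ (key w hw).1 _ h hwa, fun h => haQ (.inl h), hav, w,
      (key w hw).2, hwa⟩

theorem Elim.union {D C : Set V} (hDC : ∀ a ∈ D, ∀ b ∈ C, ¬ r a b)
    (hCD : ∀ a ∈ C, ∀ b ∈ D, ¬ r a b) (hd : Disjoint D C)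
    (h1 : Elim r (K ∪ D) K ∅) (h2 : Elim r (K ∪ C) K ∅) : Elim r (K ∪ D ∪ C) K ∅ := by
  -- All of `D` is eliminated, then all of `C`; the inner call has the roles exchanged and the
  -- eliminated part of `D` as `P`.
  have := Elim.union_aux (Q := ∅) (P := ∅) hDC hd (Set.empty_subset _) rfl h1 (Set.empty_subset _)
    fun Q hQ hDQ => by
      have := Elim.union_aux (Q := ∅) (P := Q) (U := K ∪ D ∪ C) hCD hd.symm hQ
        (Set.union_right_comm _ _ _) h2 (Set.empty_subset _) fun Q' hQ' hCQ => by
          refine .done fun a ha => ?_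
          rcases ha with (ha | ha) | ha
          · exact .inr ha
          · exact (hDQ ha).imp .inr id
          · exact (hCQ ha).imp .inl id
      rwa [Set.empty_union, ← Set.union_empty Q] at this
  simpa using this

/-- Once `x` and `y` are joined through `Q`, every use of a new edge between them can be replaced by
a detour through `Q`. -/
theorem bd_subset_of_touch {r' : V → V → Prop} {x y : V}
    (hr : ∀ a b, r' a b → r a b ∨ (a = x ∧ b = y) ∨ (a = y ∧ b = x))
    (hxy : Touch r Q x y) (hyx : Touch r Q y x) (v : V) : bd r' U Q v ⊆ bd r U Q v := by
  have h1 : ∀ a b, Reach r Q v a → r' a b → Touch r Q v b := by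
    intro a b ha hab
    rcases hr a b hab with h | ⟨rfl, rfl⟩ | ⟨rfl, rfl⟩
    · exact ⟨a, ha, h⟩
    · obtain ⟨w, hw, h⟩ := hxy
      exact ⟨w, ha.trans hw, h⟩
    · obtain ⟨w, hw, h⟩ := hyx
      exact ⟨w, ha.trans hw, h⟩
  have h2 : ∀ a, Reach r' Q v a → Reach r Q v a := by
    intro a ha
    induction ha with
    | refl => exact .refl
    | tail _ h ih =>
      obtain ⟨w, hw, hwa⟩ := h1 _ _ ih h.1
      exact hw.tail ⟨hwa, h.2⟩
  rintro a ⟨haU, haQ, hav, w, hw, hwa⟩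
  exact ⟨haU, haQ, hav, h1 _ _ (h2 _ hw) hwa⟩

/-- Two vertices can be joined, if neither can be separated from the other by two vertices. -/
theorem Elim.add_edge (hsymm : ∀ ⦃a b⦄, r a b → r b a) {r' : V → V → Prop} {x y : V}
    (hr : ∀ a b, r' a b → r a b ∨ (a = x ∧ b = y) ∨ (a = y ∧ b = x)) (hxU : x ∈ U)
    (hx : ∀ Q ⊆ U, x ∉ Q → y ∉ Q → (bd r U Q x).encard ≤ 2 → Touch r Q x y)
    (hy : ∀ Q ⊆ U, x ∉ Q → y ∉ Q → (bd r U Q y).encard ≤ 2 → Touch r Q y x)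
    (h : Elim r U ∅ Q) (hQU : Q ⊆ U) (hQ : Touch r Q x y ∨ (x ∉ Q ∧ y ∉ Q)) :
    Elim r' U ∅ Q := by
  induction h with
  | done h => exact .done h
  | @step Q v hv hvQ hvK hbd h ih =>
    have hins : Set.insert v Q ⊆ U := Set.insert_subset hv hQU
    -- As soon as the elimination has joined `x` and `y`, the new edge makes no difference, now and
    -- later.
    have main : Touch r Q x y → Elim r' U ∅ Q := fun ht =>
      .step v hv hvQ hvK ((Set.encard_le_encard (bd_subset_of_touch hr ht (ht.symm hsymm) v)).trans
        hbd) (ih hins (.inl (ht.mono (fun _ _ h => h) (Set.subset_insert _ _))))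
    rcases hQ with ht | ⟨hxQ, hyQ⟩
    · exact main ht
    -- If one of the two ends is next, it has at most two neighbours, and the separation hypothesis
    -- says that the other end is one of them.
    by_cases hvx : v = x
    · exact main (hx Q hQU hxQ hyQ (hvx ▸ hbd))
    by_cases hvy : v = y
    · exact main ((hy Q hQU hxQ hyQ (hvy ▸ hbd)).symm hsymm)
    refine .step v hv hvQ hvK ((Set.encard_le_encard ?_).trans hbd) (ih hins (.inr ⟨?_, ?_⟩))
    · have h1 : ∀ a b, Reach r Q v a → r' a b → r a b := by
        intro a b ha hab
        rcases hr a b hab with h | ⟨rfl, rfl⟩ | ⟨rfl, rfl⟩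
        · exact h
        · rcases ha.eq_or_mem with h | h
          · exact absurd h.symm hvx
          · exact absurd h hxQ
        · rcases ha.eq_or_mem with h | h
          · exact absurd h.symm hvy
          · exact absurd h hyQ
      have h2 : ∀ a, Reach r' Q v a → Reach r Q v a := by
        intro a ha
        induction ha with
        | refl => exact .refl
        | tail _ h ih => exact ih.tail ⟨h1 _ _ ih h.1, h.2⟩
      rintro a ⟨haU, haQ, hav, w, hw, hwa⟩
      exact ⟨haU, haQ, hav, w, h2 _ hw, h1 _ _ (h2 _ hw) hwa⟩
    · rintro (h | h)
      · exact hvx h.symm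
      · exact hxQ h
    · rintro (h | h)
      · exact hvy h.symm
      · exact hyQ h

end Elimination

/-! ### Treewidth at most two and elimination orderings -/

section Treewidth

variable {W ι : Type}

/-- In a tree, every walk from `root` into a connected set passes through its top. -/
theorem mem_support_of_top {T : SimpleGraph ι} (hT : T.IsTree) {root i j : ι} {C : Set ι}
    (hC : (T.induce C).Connected) (hi : i ∈ C) (hmin : ∀ j ∈ C, T.dist root i ≤ T.dist root j)
    (hj : j ∈ C) (p : T.Walk root j) : i ∈ p.support := by
  classical
  obtain ⟨q, hq, hql⟩ := hT.connected.exists_path_of_dist root i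
  obtain ⟨c', hc'⟩ := (hC.preconnected ⟨i, hi⟩ ⟨j, hj⟩).exists_isPath
  let f : T.induce C ↪g T := SimpleGraph.Embedding.induce C
  let c : T.Walk i j := c'.map f.toHom
  have hcp : c.IsPath := hc'.map f.injective
  have hcC : ∀ u ∈ c.support, u ∈ C := by
    intro u hu
    obtain ⟨w, _, rfl⟩ := List.mem_map.1 (SimpleGraph.Walk.support_map f.toHom c' ▸ hu)
    exact w.2
  -- A shortest path to the vertex of `C` nearest to the root meets `C` only at its end.
  have hqC : ∀ u ∈ q.support, u ∈ C → u = i := by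
    intro u hu huC
    by_contra hne
    have h1 := hmin u huC
    have h2 := T.dist_le (q.takeUntil u hu)
    have h3 := q.length_takeUntil_lt_length hu hne
    omega
  have hpath : (q.append c).IsPath := by
    rw [SimpleGraph.Walk.isPath_def, SimpleGraph.Walk.support_append]
    refine List.Nodup.append hq.support_nodup
      (hcp.support_nodup.sublist (List.tail_sublist _)) ?_
    intro u hu hu'
    have : u = i := hqC u hu (hcC u (List.mem_of_mem_tail hu'))
    subst this
    have := hcp.support_nodup
    rw [← SimpleGraph.Walk.cons_tail_support] at this
    exact (List.nodup_cons.1 this).1 hu'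
  have := hT.isAcyclic.subsingleton_path root j
  -- Paths in a tree are unique, so `p` shortened to a path is the path through `i`.
  have heq : q.append c = p.bypass := congrArg Subtype.val
    (Subsingleton.elim (⟨q.append c, hpath⟩ : T.Path root j) ⟨p.bypass, p.bypass_isPath⟩)
  apply p.support_bypass_subset_support
  rw [← heq]
  exact (SimpleGraph.Walk.mem_support_append_iff _ _).2 (.inl q.end_mem_support)

theorem walk_avoiding {T : SimpleGraph ι} {i j j' : ι} {C : Set ι}
    (hC : (T.induce C).Connected) (hi : i ∉ C) (hj : j ∈ C) (hj' : j' ∈ C) :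
    ∃ c : T.Walk j j', i ∉ c.support := by
  obtain ⟨c'⟩ := hC.preconnected ⟨j, hj⟩ ⟨j', hj'⟩
  let f : T.induce C ↪g T := SimpleGraph.Embedding.induce C
  refine ⟨c'.map f.toHom, fun h => hi ?_⟩
  obtain ⟨w, _, rfl⟩ := List.mem_map.1 (SimpleGraph.Walk.support_map f.toHom c' ▸ h)
  exact w.2

/-- A tree decomposition of width two gives an elimination ordering of width two, which may avoid
some vertices in the bag of the root. -/
theorem elim_of_treeDecomposition [Finite W] {H : SimpleGraph W} (D : TreeDecomposition H ι)
    (hD : ∀ i, (D.bag i).card ≤ 3) (root : ι) {K : Set W} (hK : ∀ x ∈ K, x ∈ D.bag root) :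
    Elim H.Adj Set.univ K ∅ := by
  classical
  have htop : ∀ v, ∃ i, v ∈ D.bag i ∧
      ∀ j, v ∈ D.bag j → D.tree.dist root i ≤ D.tree.dist root j := by
    intro v
    obtain ⟨i, hi, hmin⟩ := exists_minimalFor_of_wellFoundedLT (fun i => v ∈ D.bag i)
      (fun i => D.tree.dist root i) (D.vertex_mem v)
    refine ⟨i, hi, fun j hj => ?_⟩
    by_contra h
    exact h (hmin hj (le_of_not_ge h))
  choose top htop hmin using htop
  let d : W → ℕ := fun v => D.tree.dist root (top v)
  have hd : ∀ v j, v ∈ D.bag j → d v ≤ D.tree.dist root j := fun v j h => hmin v j h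
  have key : ∀ v (Q : Set W), (∀ a ∉ Q, d a ≤ d v) → (∀ q ∈ Q, d v ≤ d q) →
      bd H.Adj Set.univ Q v ⊆ ((D.bag (top v)).erase v : Finset W) := by
    intro v Q hQ hQ'
    -- If one bag of `w` lies below `top v`, all do: either `top v` is the topmost bag of `w`, or
    -- the bags of `w` are connected without meeting `top v`.
    have hbelow : ∀ w, d v ≤ d w ∨ top v ∉ {i | w ∈ D.bag i} →
        (∃ j, w ∈ D.bag j ∧ ∀ p : D.tree.Walk root j, top v ∈ p.support) →
        ∀ j, w ∈ D.bag j → ∀ p : D.tree.Walk root j, top v ∈ p.support := by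
      rintro w hw ⟨j0, hj0, hb⟩ j hj p
      by_cases hin : top v ∈ {i | w ∈ D.bag i}
      · exact mem_support_of_top D.isTree (D.connected w) hin
          (fun j hj => (hw.resolve_right (fun h => h hin)).trans (hd w j hj)) hj p
      · obtain ⟨c, hc⟩ := walk_avoiding (D.connected w) hin hj hj0
        have := hb (p.append c)
        rw [SimpleGraph.Walk.mem_support_append_iff] at this
        exact this.resolve_right hc
    have hv : ∀ j, v ∈ D.bag j → ∀ p : D.tree.Walk root j, top v ∈ p.support := by
      intro j hj p
      exact mem_support_of_top D.isTree (D.connected v) (htop v) (fun j hj => hd v j hj) hj p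
    have hreach : ∀ w, Reach H.Adj Q v w →
        ∀ j, w ∈ D.bag j → ∀ p : D.tree.Walk root j, top v ∈ p.support := by
      intro w hw
      induction hw with
      | refl => exact hv
      | @tail b c _ h ih =>
        obtain ⟨j, hb, hc⟩ := D.edge_mem b c h.1
        exact hbelow c (.inl (hQ' c h.2)) ⟨j, hc, ih j hb⟩
    rintro a ⟨-, haQ, hav, w, hw, hwa⟩
    obtain ⟨j, hj, hja⟩ := D.edge_mem w a hwa
    have ha := hQ a haQ
    simp only [Finset.coe_erase, Set.mem_sdiff, SetLike.mem_coe, Set.mem_singleton_iff]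
    -- A neighbour `a` missing from this bag would have its topmost bag strictly below `top v`,
    -- although it is not yet eliminated.
    refine ⟨by_contra fun hn => ?_, hav⟩
    have hall := hbelow a (.inr hn) ⟨j, hja, hreach w hw j hj⟩ (top a) (htop a)
    obtain ⟨q, hq, hql⟩ := D.isTree.connected.exists_path_of_dist root (top a)
    have hmem := hall q
    have hne : top v ≠ top a := fun h => hn (h ▸ htop a)
    have h2 := D.tree.dist_le (q.takeUntil _ hmem)
    have h3 := q.length_takeUntil_lt_length hmem hne
    have h4 : d a = q.length := hql.symm
    have h5 : d v ≤ (q.takeUntil _ hmem).length := h2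
    omega
  have hdK : ∀ x ∈ K, d x = 0 := fun x hx => by
    have := hd x root (hK x hx)
    simpa using this
  suffices h : ∀ n (Q : Set W), (Q ∪ K)ᶜ.ncard = n → (∀ a ∉ Q, ∀ q ∈ Q, d a ≤ d q) →
      Elim H.Adj Set.univ K Q from h _ ∅ rfl (by simp)
  intro n
  induction n with
  | zero =>
    intro Q hn _
    rw [Set.ncard_eq_zero] at hn
    exact .done fun a _ => by_contra fun h => by
      have : a ∈ (Q ∪ K)ᶜ := h
      simp [hn] at this
  | succ n ih =>
    intro Q hn hQ
    have hne : (Q ∪ K)ᶜ.Nonempty := by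
      rw [← Set.ncard_pos]; omega
    obtain ⟨v, hv, hmax⟩ := Set.exists_max_image _ d (Set.toFinite _) hne
    have hvQ : v ∉ Q := fun h => hv (.inl h)
    have hvK : v ∉ K := fun h => hv (.inr h)
    have hall : ∀ a ∉ Q, d a ≤ d v := by
      intro a ha
      by_cases haK : a ∈ K
      · rw [hdK a haK]; exact Nat.zero_le _
      · exact hmax a fun h => h.elim ha haK
    refine .step v trivial hvQ hvK ?_ (ih _ ?_ ?_)
    · refine (Set.encard_le_encard (key v Q hall fun q hq => hQ v hvQ q hq)).trans ?_
      rw [Set.encard_coe_eq_coe_finsetCard, Finset.card_erase_of_mem (htop v)]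
      have := hD (top v)
      exact_mod_cast (by omega : (D.bag (top v)).card - 1 ≤ 2)
    · have : (insert v Q ∪ K)ᶜ = (Q ∪ K)ᶜ \ {v} := by
        ext a; simp [not_or]; tauto
      rw [this, Set.ncard_sdiff_singleton_of_mem hv, hn]; rfl
    · rintro a ha q (rfl | hq)
      · exact hall a fun h => ha (.inr h)
      · exact hQ a (fun h => ha (.inr h)) q hq

/-! ### From elimination orderings to tree decompositions -/

/-- Some tree decomposition of width two of the graph on `U` with the adjacency relation `s`. -/
def HasDecomposition (s : W → W → Prop) (U : Set W) : Prop :=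
  ∃ (ι : Type) (_ : Finite ι) (T : SimpleGraph ι) (bag : ι → Finset W), T.IsTree ∧
    (∀ i, (bag i).card ≤ 3) ∧ (∀ i, ∀ v ∈ bag i, v ∈ U) ∧ (∀ v ∈ U, ∃ i, v ∈ bag i) ∧
    (∀ u ∈ U, ∀ v ∈ U, u ≠ v → s u v → ∃ i, u ∈ bag i ∧ v ∈ bag i) ∧
    ∀ v ∈ U, (T.induce {i | v ∈ bag i}).Connected

/-- A new leaf `none` is attached at `i`. The graph stays connected and gains one edge with one
vertex. -/
theorem isTree_option [Finite ι] {T : SimpleGraph ι} (hT : T.IsTree) (i : ι) :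
    (T.map Function.Embedding.some ⊔ SimpleGraph.edge none (some i)).IsTree := by
  have hr : ∀ j, (T.map Function.Embedding.some ⊔ SimpleGraph.edge none (some i)).Reachable
      (some i) (some j) := by
    intro j
    have := (hT.connected.preconnected i j).map
      (SimpleGraph.Embedding.map Function.Embedding.some T).toHom
    exact this.mono le_sup_left
  refine SimpleGraph.isTree_iff_connected_and_card.2
    ⟨(SimpleGraph.connected_iff_exists_forall_reachable _).2 ⟨some i, ?_⟩, ?_⟩
  · rintro (_ | j)
    · exact SimpleGraph.Adj.reachable (.inr (by simp [SimpleGraph.edge_adj]))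
    · exact hr j
  · have hc := (SimpleGraph.isTree_iff_connected_and_card.1 hT).2
    rw [SimpleGraph.edgeSet_sup, SimpleGraph.edgeSet_edge_of_ne (Option.some_ne_none i).symm, SimpleGraph.edgeSet_map,
      Nat.card_coe_set_eq, Set.union_singleton, Set.ncard_insert_of_notMem,
      Set.ncard_image_of_injective, Finite.card_option, ← hc, Nat.card_coe_set_eq]
    · exact Function.Embedding.some.sym2Map.injective
    · rintro ⟨e, _, he⟩
      induction e with | _ a b
      simp at he

/-- With at most two elements, a clique lies in one bag because it is empty, a vertex or an edge.
The pair may be degenerate, `a = b`. -/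
theorem exists_subset_pair {S : Set W} (h : S.encard ≤ 2) : ∃ F : Finset W, (F : Set W) = S ∧
    F.card ≤ 2 ∧ (S = ∅ ∨ ∃ a ∈ S, ∃ b ∈ S, S = {a, b}) := by
  have hfin : S.Finite := Set.finite_of_encard_le_coe (k := 2) h
  refine ⟨hfin.toFinset, by simp, ?_, ?_⟩
  · rw [hfin.encard_eq_coe_toFinset_card] at h
    exact_mod_cast h
  · rcases S.eq_empty_or_nonempty with h0 | ⟨a, ha⟩
    · exact .inl h0
    refine .inr ⟨a, ha, ?_⟩
    by_cases hb : ∃ b ∈ S, b ≠ a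
    · obtain ⟨b, hb, hne⟩ := hb
      refine ⟨b, hb, (Set.Finite.eq_of_subset_of_encard_le (Set.toFinite _) ?_ ?_).symm⟩
      · rintro c (rfl | rfl) <;> assumption
      · rwa [Set.encard_pair hne.symm]
    · push Not at hb
      exact ⟨a, ha, by ext c; exact ⟨fun h => by simp [hb c h], fun h => by simp at h; rwa [h]⟩⟩

/-- Undo the eliminations: the neighbours of `v` form a clique after its elimination, so they share
a bag, and a leaf with bag `v` and its neighbours is attached there. At most one vertex of `K` is
left for the initial bag. -/
theorem hasDecomposition_of_elim [Finite W] {r : W → W → Prop} (hr : ∀ ⦃a b⦄, r a b → r b a)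
    {U K Q : Set W} (hK : K.Subsingleton) (h : Elim r U K Q) :
    HasDecomposition (Touch r Q) (U \ Q) := by
  classical
  induction h with
  | @done Q h =>
    have hs : (U \ Q).Subsingleton := hK.anti fun a ha => (h ha.1).resolve_left ha.2
    refine ⟨Unit, inferInstance, ⊥, fun _ => (Set.toFinite (U \ Q)).toFinset,
      SimpleGraph.IsTree.of_subsingleton, fun i => ?_, fun i v hv => by simpa using hv,
      fun v hv => ⟨(), by simpa using hv⟩,
      fun u hu v hv hne _ => absurd (hs hu hv) hne, fun v hv => ?_⟩
    · refine le_trans (Finset.card_le_one.2 fun a ha b hb => hs ?_ ?_) (by omega)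
      · simpa using ha
      · simpa using hb
    · have : Nonempty {i : Unit | v ∈ (Set.toFinite (U \ Q)).toFinset} :=
        ⟨⟨(), by simpa using hv⟩⟩
      exact (SimpleGraph.IsTree.of_subsingleton (G := SimpleGraph.induce _ ⊥)).connected
  | @step Q v hv hvQ hvK hbd h ih =>
    obtain ⟨ι, hι, T, bag, hT, hcard, hsub, hmem, hedge, hconn⟩ := ih
    obtain ⟨F, hF, hF2, hpair⟩ := exists_subset_pair hbd
    have hFmem : ∀ a, a ∈ F ↔ a ∈ bd r U Q v := fun a => by rw [← hF]; rfl
    have hvF : v ∉ F := fun h => ((hFmem v).1 h).2.2.1 rfl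
    have hUins : ∀ a ∈ U \ Q, a ≠ v → a ∈ U \ insert v Q := fun a ha hne =>
      ⟨ha.1, fun h => h.elim hne ha.2⟩
    have hbdU : ∀ a ∈ bd r U Q v, a ∈ U \ insert v Q := fun a ha =>
      hUins a ⟨ha.1, ha.2.1⟩ ha.2.2.1
    -- Any two neighbours of `v` are joined through `v` once it is eliminated.
    have htouch : ∀ a ∈ bd r U Q v, ∀ b ∈ bd r U Q v, Touch r (insert v Q) a b := by
      intro a ha b hb
      obtain ⟨w, hw, hwv⟩ := ha.2.2.2.symm hr
      obtain ⟨w', hw', hwb⟩ := hb.2.2.2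
      have hs := Set.subset_insert v Q
      exact ⟨w', ((hw.mono (fun _ _ h => h) hs).tail ⟨hwv, .inl rfl⟩).trans
        (hw'.mono (fun _ _ h => h) hs), hwb⟩
    have hi : ∃ i, F ⊆ bag i := by
      rcases hpair with h0 | ⟨a, ha, b, hb, hab⟩
      · obtain ⟨i⟩ := hT.connected.nonempty
        refine ⟨i, fun a ha => ?_⟩
        rw [hFmem, h0] at ha
        exact ha.elim
      · have : ∃ i, a ∈ bag i ∧ b ∈ bag i := by
          by_cases hne : a = b
          · obtain ⟨i, hi⟩ := hmem a (hbdU a ha)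
            exact ⟨i, hi, hne ▸ hi⟩
          · exact hedge a (hbdU a ha) b (hbdU b hb) hne (htouch a ha b hb)
        obtain ⟨i, hia, hib⟩ := this
        refine ⟨i, fun c hc => ?_⟩
        rw [hFmem, hab] at hc
        rcases hc with rfl | rfl <;> assumption
    obtain ⟨i, hi⟩ := hi
    have hvbag : ∀ j, v ∉ bag j := fun j hj => (hsub j v hj).2 (.inl rfl)
    refine ⟨Option ι, inferInstance, _, fun o => o.elim (insert v F) bag,
      isTree_option hT i, ?_, ?_, ?_, ?_, ?_⟩
    · rintro (_ | j)
      · exact (Finset.card_insert_le _ _).trans (by omega)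
      · exact hcard j
    · rintro (_ | j) a ha
      · rcases Finset.mem_insert.1 ha with rfl | ha
        · exact ⟨hv, hvQ⟩
        · exact ⟨((hFmem a).1 ha).1, ((hFmem a).1 ha).2.1⟩
      · have := hsub j a ha
        exact ⟨this.1, fun h => this.2 (.inr h)⟩
    · intro a ha
      by_cases hav : a = v
      · exact ⟨none, by simp [hav]⟩
      · obtain ⟨j, hj⟩ := hmem a (hUins a ha hav)
        exact ⟨some j, hj⟩
    · intro a ha b hb hne hab
      by_cases hav : a = v
      · subst hav
        exact ⟨none, by simp, by simp [(hFmem b).2 ⟨hb.1, hb.2, hne.symm, hab⟩]⟩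
      by_cases hbv : b = v
      · subst hbv
        exact ⟨none, by simp [(hFmem a).2 ⟨ha.1, ha.2, hne, hab.symm hr⟩], by simp⟩
      · obtain ⟨j, hj⟩ := hedge a (hUins a ha hav) b (hUins b hb hbv) hne
          (hab.mono (fun _ _ h => h) (Set.subset_insert _ _))
        exact ⟨some j, hj⟩
    · intro a ha
      by_cases hav : a = v
      · subst hav
        have : {o : Option ι | a ∈ o.elim (insert a F) bag} = {none} := by
          ext o
          rcases o with _ | j
          · simp
          · simpa using hvbag j
        rw [this]
        exact (SimpleGraph.IsTree.of_subsingleton (G := SimpleGraph.induce _ _)).connected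
      · obtain ⟨j, hj⟩ := hmem a (hUins a ha hav)
        have hreach : ∀ j' (hj' : a ∈ bag j'),
            ((T.map Function.Embedding.some ⊔ SimpleGraph.edge none (some i)).induce
              {o : Option ι | a ∈ o.elim (insert v F) bag}).Reachable ⟨some j, hj⟩
              ⟨some j', hj'⟩ := by
          intro j' hj'
          have h1 := (hconn a (hUins a ha hav)).preconnected ⟨j, hj⟩ ⟨j', hj'⟩
          let f : T.induce {i | a ∈ bag i} →g
              (T.map Function.Embedding.some ⊔ SimpleGraph.edge none (some i)).induce
              {o : Option ι | a ∈ o.elim (insert v F) bag} :=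
            { toFun := fun x => ⟨some x.1, x.2⟩
              map_rel' := fun {x y} h => .inl
                ⟨fun he => h.ne (Subtype.ext (Option.some_injective _ he)), _, _, h, rfl, rfl⟩ }
          exact h1.map f
        refine (SimpleGraph.connected_iff_exists_forall_reachable _).2 ⟨⟨some j, hj⟩, ?_⟩
        rintro ⟨_ | j', hj'⟩
        · have haF : a ∈ F := (Finset.mem_insert.1 hj').resolve_left hav
          refine (hreach i (hi haF)).trans (SimpleGraph.Adj.reachable (.inr ?_))
          simp [SimpleGraph.edge_adj]
        · exact hreach j' hj'

/-! ### Treewidth at most two in terms of elimination -/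

theorem treewidth_le_two_iff [Finite W] (H : SimpleGraph W) :
    treewidth H ≤ 2 ↔ ∃ (m : ℕ) (D : TreeDecomposition H (Fin m)), ∀ i, (D.bag i).card ≤ 3 := by
  -- The infimum of the empty set would be 0; the decomposition with a single bag ensures that the
  -- infimum is attained.
  have hne : {w | ∃ (m : ℕ) (D : TreeDecomposition H (Fin m)),
      ∀ i, (D.bag i).card ≤ w + 1}.Nonempty := by
    have := Fintype.ofFinite W
    refine ⟨Fintype.card W, 1, ⟨⊥, SimpleGraph.IsTree.of_subsingleton, fun _ => Finset.univ,
      fun v => ⟨0, by simp⟩, fun u v _ => ⟨0, by simp⟩, fun v => ?_⟩, fun i => ?_⟩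
    · have : Nonempty {i : Fin 1 | v ∈ (Finset.univ : Finset W)} := ⟨⟨0, by simp⟩⟩
      exact (SimpleGraph.IsTree.of_subsingleton (G := SimpleGraph.induce _ ⊥)).connected
    · simp [Finset.card_univ]
  constructor
  · intro h
    obtain ⟨m, D, hD⟩ := Nat.sInf_mem hne
    exact ⟨m, D, fun i => (hD i).trans (Nat.add_le_add_right h 1)⟩
  · rintro ⟨m, D, hD⟩
    exact Nat.sInf_le ⟨m, D, hD⟩

theorem treewidth_le_two_of_hasDecomposition [Finite W] {H : SimpleGraph W} {s : W → W → Prop}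
    (hs : ∀ a b, H.Adj a b → s a b) (h : HasDecomposition s Set.univ) : treewidth H ≤ 2 := by
  rw [treewidth_le_two_iff]
  obtain ⟨ι, hι, T, bag, hT, hcard, hsub, hmem, hedge, hconn⟩ := h
  obtain ⟨m, ⟨e⟩⟩ := Finite.exists_equiv_fin ι
  let f : T.comap e.symm ≃g T := SimpleGraph.Iso.comap e.symm T
  refine ⟨m, ⟨T.comap e.symm, f.isTree_iff.2 hT, fun i => bag (e.symm i), fun v => ?_,
    fun u v huv => ?_, fun v => ?_⟩, fun i => hcard _⟩
  · obtain ⟨i, hi⟩ := hmem v trivial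
    exact ⟨e i, by simpa using hi⟩
  · obtain ⟨i, hi⟩ := hedge u trivial v trivial huv.ne (hs _ _ huv)
    exact ⟨e i, by simpa using hi⟩
  · have g : (T.comap e.symm).induce {i | v ∈ bag (e.symm i)} ≃g T.induce {i | v ∈ bag i} :=
      { toFun := fun x => ⟨e.symm x.1, x.2⟩
        invFun := fun x => ⟨e x.1, by
          rw [Set.mem_ofPred_eq, Equiv.symm_apply_apply]; exact x.2⟩
        left_inv := fun x => by simp
        right_inv := fun x => by simp
        map_rel_iff' := by simp }
    exact g.connected_iff.2 (hconn v trivial)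

/-- For the purposes of treewidth two, one vertex may be kept. -/
theorem treewidth_le_two_iff_elim [Finite W] (H : SimpleGraph W) {K : Set W}
    (hK : K.Subsingleton) : treewidth H ≤ 2 ↔ Elim H.Adj Set.univ K ∅ := by
  constructor
  · intro h
    obtain ⟨m, D, hD⟩ := (treewidth_le_two_iff H).1 h
    -- Any node can serve as the root, in particular one whose bag contains the only vertex of `K`.
    have : ∃ i, ∀ x ∈ K, x ∈ D.bag i := by
      rcases hK.eq_empty_or_singleton with rfl | ⟨x, rfl⟩
      · obtain ⟨i⟩ := D.isTree.connected.nonempty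
        exact ⟨i, by simp⟩
      · simpa using D.vertex_mem x
    obtain ⟨i, hi⟩ := this
    exact elim_of_treeDecomposition D hD i hi
  · intro h
    have := hasDecomposition_of_elim (fun _ _ h => h.symm) hK h
    rw [Set.sdiff_empty] at this
    exact treewidth_le_two_of_hasDecomposition (fun a b hab => ⟨a, .refl, hab⟩) this

/-- Moves the criterion to a relation on an ambient type, as the algorithm works with vertex numbers
and subsets of them. -/
theorem treewidth_le_two_iff_elim_image {V : Type*} [Finite W] (H : SimpleGraph W)
    {r : V → V → Prop} {φ : W → V} (hφ : Function.Injective φ)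
    (hr : ∀ a b, r (φ a) (φ b) ↔ H.Adj a b) {K : Set V} (hK : K.Subsingleton)
    (hKφ : K ⊆ Set.range φ) : treewidth H ≤ 2 ↔ Elim r (Set.range φ) K ∅ := by
  rw [treewidth_le_two_iff_elim H (K := φ ⁻¹' K) (fun a ha b hb => hφ (hK ha hb))]
  constructor
  · intro h
    rcases isEmpty_or_nonempty W with hW | hW
    · exact .done (by simp [Set.range_eq_empty])
    have hinv := Function.leftInverse_invFun hφ
    have := h.comap (φ := Function.invFun φ) (U := Set.univ) (U' := Set.range φ) (r' := r) (K' := K)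
      (by rintro _ ⟨a, rfl⟩ _ ⟨b, rfl⟩ h; rw [hinv, hinv] at h; rw [h]) (fun _ _ => trivial)
      (by rintro _ ⟨a, rfl⟩ _ ⟨b, rfl⟩ h; rw [hinv, hinv]; exact (hr a b).1 h)
      (by rintro _ ⟨a, rfl⟩; rw [hinv]; rfl)
    simpa [Set.inter_eq_left.2 hKφ] using this
  · intro h
    have := h.comap (φ := φ) (U := Set.range φ) (U' := Set.univ) (r' := H.Adj) (K' := φ ⁻¹' K) hφ.injOn
      (fun a _ => ⟨a, rfl⟩) (fun a _ b _ h => (hr a b).2 h) (fun _ _ => Iff.rfl)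
    simpa using this

end Treewidth

/-! ### Correctness of the elementary routines -/

section Iterate

variable {α β σ : Type}

theorem headCase_cases (l : List α) (d : β) (f : α → β) :
    (l = [] ∧ headCase l d f = d) ∨ ∃ a ∈ l, headCase l d f = f a := by
  cases l with
  | nil => exact .inl ⟨rfl, rfl⟩
  | cons a t => exact .inr ⟨a, by simp, rfl⟩

/-- An iteration that decreases `μ` unless it is stationary reaches a stationary state. -/
theorem iter_stationary {l : List α} {f : σ → σ} {s : σ} (μ : σ → ℕ) (inv : σ → Prop)
    (h : ∀ s, inv s → inv (f s) ∧ (f s = s ∨ μ (f s) < μ s)) (hs : inv s) (hl : μ s ≤ l.length) :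
    inv (iter l f s) ∧ f (iter l f s) = iter l f s := by
  have key : ∀ n s, inv s → μ s ≤ n → inv (f^[n] s) ∧ f (f^[n] s) = f^[n] s := by
    intro n
    induction n with
    | zero =>
      intro s hs hn
      exact ⟨hs, (h s hs).2.resolve_right (by omega)⟩
    | succ n ih =>
      intro s hs hn
      obtain ⟨h1, h2⟩ := h s hs
      rcases h2 with h2 | h2
      · have : ∀ m, f^[m] s = s := fun m => Function.iterate_fixed h2 m
        rw [this]
        exact ⟨hs, h2⟩
      · rw [Function.iterate_succ_apply]
        exact ih _ h1 (by omega)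
  have : iter l f s = f^[l.length] s := List.foldl_const f s l
  rw [this]
  exact key _ _ hs hl

theorem length_filter_lt {l : List α} {p q : α → Bool} (hpq : ∀ a ∈ l, p a → q a) {a : α}
    (ha : a ∈ l) (hq : q a) (hp : ¬ p a) : (l.filter p).length < (l.filter q).length := by
  have h1 : (l.filter p).Sublist (l.filter q) := by
    rw [show l.filter p = (l.filter q).filter p by
      rw [List.filter_filter]
      exact List.filter_congr fun a ha => by rw [Bool.eq_iff_iff]; simpa using hpq a ha]
    exact List.filter_sublist
  refine lt_of_le_of_ne h1.length_le fun h => hp ?_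
  have := h1.eq_of_length h
  have : a ∈ l.filter p := this ▸ List.mem_filter.2 ⟨ha, hq⟩
  exact (List.mem_filter.1 this).2

end Iterate

/-! ### Arc lists, searching and the elimination test -/

/-- The adjacency relation of a list of arcs. -/
def adj (E : List (ℕ × ℕ)) (a b : ℕ) : Prop := (a, b) ∈ E

/-- The set of the entries of a list. -/
def lset (l : List ℕ) : Set ℕ := {a | a ∈ l}

@[simp] theorem mem_lset {a : ℕ} {l : List ℕ} : a ∈ lset l ↔ a ∈ l := Iff.rfl
@[simp] theorem lset_nil : lset [] = ∅ := by ext; simp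
@[simp] theorem lset_cons (a : ℕ) (l : List ℕ) : lset (a :: l) = insert a (lset l) := by ext; simp

theorem finite_lset (l : List ℕ) : (lset l).Finite := l.finite_toSet

theorem encard_lset {l : List ℕ} (h : l.Nodup) : (lset l).encard = l.length := by
  have : lset l = (l.toFinset : Set ℕ) := by ext; simp
  rw [this, Set.encard_coe_eq_coe_finsetCard, List.toFinset_card_of_nodup h]

/-- `s` is a tree of arcs from `A` directed towards `r`, the latest arc first. -/
def IsArcTree (A : List (ℕ × ℕ)) (r : ℕ) : List (ℕ × ℕ) → Prop
  | [] => True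
  | e :: s => e ∈ A ∧ found r s e.2 ∧ ¬ found r s e.1 ∧ IsArcTree A r s

theorem found_iff {r b : ℕ} {s : List (ℕ × ℕ)} : found r s b ↔ b = r ∨ ∃ e ∈ s, e.1 = b := by
  simp [found]

theorem found_cons {r b : ℕ} {e : ℕ × ℕ} {s : List (ℕ × ℕ)} :
    found r (e :: s) b ↔ e.1 = b ∨ found r s b := by
  simp only [found_iff, List.mem_cons, exists_eq_or_imp]
  tauto

/-- The arcs whose tail has not been found decrease with every extension, so as many rounds as there
are arcs suffice. -/
theorem search_spec (A : List (ℕ × ℕ)) (r : ℕ) : IsArcTree A r (search A r) ∧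
    ∀ e ∈ A, found r (search A r) e.2 → found r (search A r) e.1 := by
  obtain ⟨h1, h2⟩ := iter_stationary (l := A) (f := searchStep A r) (s := [])
    (fun s => (A.filter fun e => !found r s e.1).length) (IsArcTree A r) (fun s hs => by
      rcases headCase_cases (A.filter fun e => found r s e.2 && !found r s e.1) s
        (fun e => e :: s) with ⟨_, h⟩ | ⟨e, he, h⟩
      · rw [← searchStep] at h
        exact ⟨h.symm ▸ hs, .inl h⟩
      · rw [← searchStep] at h
        rw [h]
        simp only [List.mem_filter, Bool.and_eq_true, Bool.not_eq_true'] at he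
        refine ⟨⟨he.1, he.2.1, by simp [he.2.2], hs⟩, .inr ?_⟩
        refine length_filter_lt (fun a _ ha => ?_) he.1 (by simp [he.2.2])
          (by simp [found_cons])
        by_contra hn
        simp only [Bool.not_eq_true', Bool.not_eq_false] at hn ha
        have := (found_cons (e := e)).2 (.inr hn)
        simp [ha] at this) trivial (List.length_filter_le _ _)
  refine ⟨h1, fun e he hf => ?_⟩
  by_contra hn
  change searchStep A r (search A r) = search A r at h2
  rcases headCase_cases (A.filter fun e => found r (search A r) e.2 &&
    !found r (search A r) e.1) (search A r) (fun e => e :: search A r) with ⟨h, _⟩ | ⟨e, he, h⟩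
  · rw [List.filter_eq_nil_iff] at h
    exact h e he (by simp [hf, hn])
  · rw [← searchStep, h2] at h
    exact absurd h.symm (List.cons_ne_self _ _)

theorem IsArcTree.nodup {A : List (ℕ × ℕ)} {r : ℕ} {s : List (ℕ × ℕ)} (h : IsArcTree A r s) :
    (r :: s.map Prod.fst).Nodup := by
  induction s with
  | nil => simp
  | cons e s ih =>
    obtain ⟨_, _, h3, h4⟩ := h
    have := ih h4
    rw [found_iff, not_or] at h3
    simp only [List.map_cons, List.nodup_cons, List.mem_cons, not_or] at this ⊢
    refine ⟨⟨fun h => h3.1 h.symm, this.1⟩, ?_, this.2⟩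
    intro h
    obtain ⟨e', he', h'⟩ := List.mem_map.1 h
    exact h3.2 ⟨e', he', h'⟩

theorem comp_nodup (E : List (ℕ × ℕ)) (Q : List ℕ) (v : ℕ) : (comp E Q v).Nodup :=
  (search_spec _ _).1.nodup

/-- The search keeps only arcs with tail in `Q` and directs them towards `v`; symmetry turns such a
path into a walk from `v` through `Q`. -/
theorem mem_comp {E : List (ℕ × ℕ)} (hE : ∀ ⦃a b⦄, adj E a b → adj E b a) {Q : List ℕ} {v u : ℕ} :
    u ∈ comp E Q v ↔ Reach (adj E) (lset Q) v u := by
  set A := E.filter fun e => decide (e.1 ∈ Q) with hA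
  have hfound : u ∈ comp E Q v ↔ found v (search A v) u := by
    rw [found_iff, comp, List.mem_cons, List.mem_map]
  rw [hfound]
  clear hfound
  obtain ⟨h1, h2⟩ := search_spec A v
  constructor
  · have : ∀ s, IsArcTree A v s → ∀ u, found v s u → Reach (adj E) (lset Q) v u := by
      intro s
      induction s with
      | nil =>
        intro _ u hu
        rw [found_iff] at hu
        rcases hu with rfl | ⟨e, he, _⟩
        · exact .refl
        · simp at he
      | cons e s ih =>
        rintro ⟨he, he2, _, hs⟩ u hu
        rw [found_cons] at hu
        rcases hu with rfl | hu
        · rw [hA, List.mem_filter] at he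
          exact (ih hs _ he2).tail ⟨hE he.1, by simpa using he.2⟩
        · exact ih hs u hu
    exact this _ h1 u
  · intro h
    induction h with
    | refl => simp [found_iff]
    | @tail b c _ h ih =>
      exact h2 (c, b) (by rw [hA, List.mem_filter]; exact ⟨hE h.1, by simpa using h.2⟩) ih

theorem mem_bdry {E : List (ℕ × ℕ)} (hE : ∀ ⦃a b⦄, adj E a b → adj E b a) {U Q : List ℕ}
    {v a : ℕ} : a ∈ bdry E U Q v ↔ a ∈ bd (adj E) (lset U) (lset Q) v := by
  simp only [bdry, List.mem_filter, Bool.and_eq_true, Bool.not_eq_true', decide_eq_false_iff_not,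
    List.any_eq_true, decide_eq_true_eq, mem_comp hE]
  constructor
  · rintro ⟨h1, ⟨h2, h3⟩, u, hu, h⟩
    exact ⟨h1, h2, h3, u, hu, h⟩
  · rintro ⟨h1, h2, h3, u, hu, h⟩
    exact ⟨h1, ⟨h2, h3⟩, u, hu, h⟩

theorem length_bdry_le {E : List (ℕ × ℕ)} (hE : ∀ ⦃a b⦄, adj E a b → adj E b a) {U Q : List ℕ}
    (hU : U.Nodup) {v : ℕ} :
    (bdry E U Q v).length ≤ 2 ↔ (bd (adj E) (lset U) (lset Q) v).encard ≤ 2 := by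
  have h1 : lset (bdry E U Q v) = bd (adj E) (lset U) (lset Q) v := by
    ext a; exact mem_bdry hE
  rw [← h1, encard_lset (by exact hU.filter _)]
  exact_mod_cast Iff.rfl

/-- Eliminable vertices may be taken in any order, so each greedy step preserves the existence of an
ordering in both directions. A stuck state therefore decides the question. -/
theorem elimAll_spec {E : List (ℕ × ℕ)} (hE : ∀ ⦃a b⦄, adj E a b → adj E b a) {U D : List ℕ}
    {K : Set ℕ} (hU : U.Nodup) (hUD : ∀ a, a ∈ U ↔ a ∈ K ∨ a ∈ D) (hD : ∀ a ∈ D, a ∉ K) :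
    (∀ v ∈ D, v ∈ elimAll E U D) ↔ Elim (adj E) (lset U) K ∅ := by
  have hstep : ∀ Q, (∃ v, (v ∈ D ∧ v ∉ Q ∧ (bd (adj E) (lset U) (lset Q) v).encard ≤ 2) ∧
      elimStep E U D Q = v :: Q) ∨ ((∀ v ∈ D, v ∉ Q →
        ¬ (bd (adj E) (lset U) (lset Q) v).encard ≤ 2) ∧ elimStep E U D Q = Q) := by
    intro Q
    rcases headCase_cases (D.filter fun v => !decide (v ∈ Q) &&
      decide ((bdry E U Q v).length ≤ 2)) Q (fun v => v :: Q) with ⟨h0, h⟩ | ⟨v, hv, h⟩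
    · refine .inr ⟨fun v hv hvQ hbd => ?_, h⟩
      rw [List.filter_eq_nil_iff] at h0
      exact h0 v hv (by simp [hvQ, length_bdry_le hE hU, hbd])
    · simp only [List.mem_filter, Bool.and_eq_true, Bool.not_eq_true', decide_eq_false_iff_not,
        decide_eq_true_eq, length_bdry_le hE hU] at hv
      exact .inl ⟨v, hv, h⟩
  obtain ⟨h1, h2⟩ := iter_stationary (l := D) (f := elimStep E U D) (s := [])
    (fun Q => (D.filter fun v => !decide (v ∈ Q)).length)
    (fun Q => Elim (adj E) (lset U) K (lset Q) ↔ Elim (adj E) (lset U) K ∅)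
    (fun Q hQ => by
      rcases hstep Q with ⟨v, ⟨hv, hvQ, hbd⟩, h⟩ | ⟨_, h⟩
      · have hvU : v ∈ lset U := (hUD v).2 (.inr hv)
        rw [h]
        refine ⟨?_, .inr (length_filter_lt (fun a _ ha => ?_) hv (by simpa using hvQ) (by simp))⟩
        · rw [lset_cons, ← hQ]
          exact ⟨fun h => .step v hvU hvQ (hD v hv) hbd h,
            fun h => h.insert_of_encard_le hE hvU hvQ (hD v hv) hbd⟩
        · simp at ha ⊢; exact ha.2
      · exact ⟨h.symm ▸ hQ, .inl h⟩) (by simp) (List.length_filter_le _ _)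
  change (Elim (adj E) (lset U) K (lset (elimAll E U D)) ↔ _) at h1
  change elimStep E U D (elimAll E U D) = elimAll E U D at h2
  rw [← h1]
  constructor
  · intro h
    exact .done fun a ha => ((hUD a).1 ha).elim .inr fun ha => .inl (h a ha)
  · intro h v hv
    rcases hstep (elimAll E U D) with ⟨w, _, h'⟩ | ⟨hno, _⟩
    · rw [h2] at h'
      exact absurd h'.symm (List.cons_ne_self _ _)
    · cases h with
      | done h => exact (h ((hUD v).2 (.inr hv))).resolve_right (hD v hv)
      | step w hw hwQ hwK hbd _ =>
        exact absurd hbd (hno w (((hUD w).1 hw).resolve_left hwK) hwQ)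

/-- The set `D` can be eliminated in the graph on `D` and `x`. -/
def Good (r : ℕ → ℕ → Prop) (D : Set ℕ) (x : ℕ) : Prop := Elim r ({x} ∪ D) {x} ∅

theorem good_iff {E : List (ℕ × ℕ)} (hE : ∀ ⦃a b⦄, adj E a b → adj E b a) {D : List ℕ} {x : ℕ}
    (hD : D.Nodup) (hx : x ∉ D) : good E D x ↔ Good (adj E) (lset D) x := by
  have := elimAll_spec hE (U := x :: D) (D := D) (K := {x}) (by simp [hD, hx]) (by simp)
    (fun a ha h => hx (h ▸ ha))
  rw [lset_cons, Set.insert_eq] at this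
  rw [Good, ← this]
  simp [good]

theorem Good.mono {r : ℕ → ℕ → Prop} {D D' : Set ℕ} {x : ℕ} (h : Good r D x) (hD : D' ⊆ D) :
    Good r D' x := by
  have := Elim.mono (r' := r) (U' := {x} ∪ D') (Set.union_subset_union_right _ hD)
    (fun _ _ _ _ h => h) h
  simpa [Good, Set.inter_union_distrib_left] using this

theorem Good.union {r : ℕ → ℕ → Prop} (hr : ∀ ⦃a b⦄, r a b → r b a) {D C : Set ℕ} {x : ℕ}
    (h1 : Good r D x) (h2 : Good r C x) (hDC : ∀ a ∈ D, ∀ b ∈ C, ¬ r a b) (hd : Disjoint D C) :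
    Good r (D ∪ C) x := by
  have := Elim.union hDC (fun a ha b hb h => hDC b hb a ha (hr h)) hd h1 h2
  rwa [Set.union_assoc] at this

/-- Both sides express treewidth at most two. Keeping `x` is what gluing at `x` needs; eliminating
everything is what comparison with `IsMod` needs. -/
theorem good_iff_elim {r : ℕ → ℕ → Prop} (hr : ∀ ⦃a b⦄, r a b → r b a) (hi : ∀ a, ¬ r a a)
    {D : Set ℕ} (hD : D.Finite) (x : ℕ) : Good r D x ↔ Elim r ({x} ∪ D) ∅ ∅ := by
  have : Finite ({x} ∪ D : Set ℕ) := (Set.finite_singleton x).union hD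
  let H : SimpleGraph ({x} ∪ D : Set ℕ) :=
    { Adj := fun a b => r a b, symm := ⟨fun _ _ h => hr h⟩, loopless := ⟨fun a => hi a⟩ }
  have h1 := treewidth_le_two_iff_elim_image H (r := r) (φ := Subtype.val)
    Subtype.val_injective (fun _ _ => Iff.rfl) (K := {x}) Set.subsingleton_singleton
    (by simp)
  have h2 := treewidth_le_two_iff_elim_image H (r := r) (φ := Subtype.val)
    Subtype.val_injective (fun _ _ => Iff.rfl) (K := ∅) Set.subsingleton_empty (by simp)
  rw [Subtype.range_coe] at h1 h2
  exact h1.symm.trans h2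

/-! ### Flows and linking -/

section Flow

open Classical in
/-- The number of arcs that leave `R`. -/
noncomputable def leave (R : Set ℕ) (O : List (ℕ × ℕ)) : ℕ :=
  O.countP fun e => decide (e.1 ∈ R ∧ e.2 ∉ R)

/-- An orientation of a simple graph. -/
def IsOrientation (O : List (ℕ × ℕ)) : Prop := O.Nodup ∧ ∀ e ∈ O, e.swap ∉ O

/-- The arc `a` occurs once, so only one entry changes; counts over the list then follow from the
permutation. -/
theorem flip_perm {O : List (ℕ × ℕ)} {a : ℕ × ℕ} (hO : O.Nodup) (ha : a ∈ O) :
    (flip O a).Perm (a.swap :: O.erase a) := by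
  have h1 : (flip O a).Perm (flip (a :: O.erase a) a) := (List.perm_cons_erase ha).map _
  have h2 : flip (a :: O.erase a) a = a.swap :: O.erase a := by
    simp only [flip, List.map_cons, decide_true, Bool.and_self, cond_true]
    congr 1
    refine (List.map_congr_left fun e he => ?_).trans (List.map_id _)
    have hne : e ≠ a := (hO.mem_erase_iff.1 he).1
    cases h : decide (e.1 = a.1) && decide (e.2 = a.2) with
    | false => rfl
    | true =>
      simp only [Bool.and_eq_true, decide_eq_true_eq] at h
      exact absurd (Prod.ext h.1 h.2) hne
  rwa [h2] at h1

theorem mem_flip {O : List (ℕ × ℕ)} {a e : ℕ × ℕ} (hO : O.Nodup) (ha : a ∈ O) :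
    e ∈ flip O a ↔ e = a.swap ∨ (e ≠ a ∧ e ∈ O) := by
  rw [(flip_perm hO ha).mem_iff, List.mem_cons, hO.mem_erase_iff]

theorem IsOrientation.flip {O : List (ℕ × ℕ)} {a : ℕ × ℕ} (hO : IsOrientation O) (ha : a ∈ O) :
    IsOrientation (flip O a) := by
  refine ⟨(flip_perm hO.1 ha).nodup_iff.2
    (List.nodup_cons.2 ⟨fun h => hO.2 a ha (List.mem_of_mem_erase h), hO.1.erase a⟩), ?_⟩
  intro e he he'
  rw [mem_flip hO.1 ha] at he he'
  rcases he with rfl | ⟨hne, he⟩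
  · rcases he' with h | h
    · exact hO.2 a ha (by rw [Prod.swap_swap] at h; rwa [← h])
    · exact h.1 (Prod.swap_swap a)
  · rcases he' with h | h
    · exact hne (Prod.swap_injective h)
    · exact hO.2 e he h.2

open Classical in
theorem leave_flip {O : List (ℕ × ℕ)} {a : ℕ × ℕ} (hO : O.Nodup) (ha : a ∈ O) (R : Set ℕ) :
    leave R (flip O a) + (if a.1 ∈ R then 1 else 0) = leave R O + if a.2 ∈ R then 1 else 0 := by
  have h1 : leave R (flip O a) = leave R (a.swap :: O.erase a) := (flip_perm hO ha).countP_eq _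
  have h2 : leave R O = leave R (a :: O.erase a) := (List.perm_cons_erase ha).countP_eq _
  rw [h1, h2]
  simp only [leave, List.countP_cons, Prod.fst_swap, Prod.snd_swap]
  by_cases ha1 : a.1 ∈ R <;> by_cases ha2 : a.2 ∈ R <;> simp [ha1, ha2]

-- The newest arc comes first and each head was found before its tail, so a single pass over `tr`
-- follows the path from `w` to `r`. The contributions of `leave_flip` telescope to those of the two
-- ends.
open Classical in
theorem flipPath_spec {A : List (ℕ × ℕ)} {r : ℕ} (tr : List (ℕ × ℕ)) (O : List (ℕ × ℕ)) (w : ℕ)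
    (htr : IsArcTree A r tr) (hO : IsOrientation O) (hmem : ∀ e ∈ tr, e ∈ O)
    (hw : found r tr w) : IsOrientation (flipPath tr w O).2 ∧
      ∀ R : Set ℕ, leave R (flipPath tr w O).2 + (if w ∈ R then 1 else 0) =
        leave R O + if r ∈ R then 1 else 0 := by
  induction tr generalizing O w with
  | nil =>
    simp only [found_iff, List.not_mem_nil, false_and, exists_false, or_false] at hw
    subst hw
    exact ⟨hO, fun R => rfl⟩
  | cons e tr ih =>
    obtain ⟨_, he2, he1, htr⟩ := htr
    have he : e ∈ O := hmem e (by simp)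
    by_cases h : e.1 = w
    · have hfold : flipPath (e :: tr) w O = flipPath tr e.2 (flip O e) := by
        simp [flipPath, h]
      rw [hfold]
      obtain ⟨h1, h2⟩ := ih (flip O e) e.2 htr (hO.flip he) (fun e' he' => by
        rw [mem_flip hO.1 he]
        refine .inr ⟨?_, hmem e' (by simp [he'])⟩
        rintro rfl
        exact he1 (found_iff.2 (.inr ⟨e', he', rfl⟩))) he2
      refine ⟨h1, fun R => ?_⟩
      have h3 := h2 R
      have h4 := leave_flip hO.1 he R
      rw [h] at h4
      omega
    · have hfold : flipPath (e :: tr) w O = flipPath tr w O := by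
        simp [flipPath, h]
      rw [hfold]
      exact ih O w htr hO (fun e' he' => hmem e' (by simp [he']))
        ((found_cons.1 hw).resolve_left h)

theorem IsArcTree.mem {A : List (ℕ × ℕ)} {r : ℕ} {s : List (ℕ × ℕ)} (h : IsArcTree A r s) :
    ∀ e ∈ s, e ∈ A := by
  induction s with
  | nil => simp
  | cons a s ih =>
    rintro e he
    rcases List.mem_cons.1 he with rfl | he
    · exact h.1
    · exact ih h.2.2.2 e he

/-- The maximum flow equals the minimum size of a cut. -/
theorem iter_augment_spec {O₀ : List (ℕ × ℕ)} (hO₀ : IsOrientation O₀) {s r : ℕ} (hsr : s ≠ r) :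
    (∀ R : Set ℕ, s ∈ R → r ∉ R → (iter O₀ (augment s r) (O₀, 0)).2 ≤ leave R O₀) ∧
      ∃ R : Set ℕ, s ∈ R ∧ r ∉ R ∧ (iter O₀ (augment s r) (O₀, 0)).2 = leave R O₀ := by
  classical
  have hcases : ∀ p, (¬ found r (search p.1 r) s ∧ augment s r p = p) ∨
      (found r (search p.1 r) s ∧
        augment s r p = ((flipPath (search p.1 r) s p.1).2, p.2 + 1)) := by
    intro p
    cases h : found r (search p.1 r) s
    · exact .inl ⟨by simp, by simp [augment, h]⟩
    · exact .inr ⟨rfl, by simp [augment, h]⟩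
  -- Each augmentation lowers the number of arcs leaving any set that separates `s` from `r` by one;
  -- for the set `{s}` this number is the potential.
  obtain ⟨⟨h1, h1'⟩, h2⟩ := iter_stationary (l := O₀) (f := augment s r) (s := (O₀, 0))
    (fun p => leave {s} p.1) (fun p => IsOrientation p.1 ∧
      ∀ R : Set ℕ, s ∈ R → r ∉ R → leave R p.1 + p.2 = leave R O₀) (fun p hp => by
      rcases hcases p with ⟨_, h⟩ | ⟨hf, h⟩
      · exact ⟨h.symm ▸ hp, .inl h⟩
      · rw [h]
        obtain ⟨hs1, _⟩ := search_spec p.1 r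
        obtain ⟨h1, h2⟩ := flipPath_spec _ p.1 s hs1 hp.1 hs1.mem hf
        refine ⟨⟨h1, fun R hs hr => ?_⟩, .inr ?_⟩
        · have h3 := h2 R
          rw [if_pos hs, if_neg hr] at h3
          have := hp.2 R hs hr
          dsimp only
          omega
        · have h3 := h2 {s}
          rw [if_pos (Set.mem_singleton s), if_neg (by simpa using hsr.symm)] at h3
          dsimp only
          omega) ⟨hO₀, fun R _ _ => rfl⟩ List.countP_le_length
  set p := iter O₀ (augment s r) (O₀, 0) with hp
  refine ⟨fun R hs hr => by have := h1' R hs hr; omega, ?_⟩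
  rcases hcases p with ⟨hf, _⟩ | ⟨_, h⟩
  · refine ⟨{b | ¬ found r (search p.1 r) b}, hf, fun h => h (found_iff.2 (.inl rfl)), ?_⟩
    have h3 := h1' {b | ¬ found r (search p.1 r) b} hf fun h => h (found_iff.2 (.inl rfl))
    have h4 : leave {b | ¬ found r (search p.1 r) b} p.1 = 0 := by
      rw [leave, List.countP_eq_zero]
      intro e he h
      simp only [decide_eq_true_eq] at h
      exact h.1 ((search_spec p.1 r).2 e he (not_not.1 h.2))
    omega
  · rw [h2] at h
    have := congrArg Prod.snd h
    simp at this

/-! ### Flows in the graph with split vertices -/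

/-- A list of vertices and arcs that describes a simple graph. -/
structure IsGraph (V : List ℕ) (E : List (ℕ × ℕ)) : Prop where
  nodupV : V.Nodup
  nodupE : E.Nodup
  symm : ∀ ⦃a b⦄, adj E a b → adj E b a
  irrefl : ∀ a, ¬ adj E a a
  mem : ∀ a b, adj E a b → a ∈ V ∧ b ∈ V

variable {V : List ℕ} {E : List (ℕ × ℕ)}

theorem mem_splitArcs {e : ℕ × ℕ} : e ∈ splitArcs V E ↔
    (∃ v ∈ V, e = (v + v, v + v + 1)) ∨ ∃ a b, adj E a b ∧ e = (a + a + 1, b + b) := by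
  simp only [splitArcs, List.mem_append, List.mem_map, Prod.exists, adj]
  constructor
  · rintro (⟨v, hv, rfl⟩ | ⟨a, b, h, rfl⟩)
    · exact .inl ⟨v, hv, rfl⟩
    · exact .inr ⟨a, b, h, rfl⟩
  · rintro (⟨v, hv, rfl⟩ | ⟨a, b, h, rfl⟩)
    · exact .inl ⟨v, hv, rfl⟩
    · exact .inr ⟨a, b, h, rfl⟩

theorem IsGraph.isOrientation (h : IsGraph V E) : IsOrientation (splitArcs V E) := by
  refine ⟨List.Nodup.append (h.nodupV.map fun a b hab => ?_) (h.nodupE.map fun a b hab => ?_) ?_, ?_⟩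
  · simp only [Prod.mk.injEq] at hab; omega
  · simp only [Prod.mk.injEq] at hab
    exact Prod.ext (by omega) (by omega)
  · intro e he he'
    simp only [List.mem_map] at he he'
    obtain ⟨v, _, rfl⟩ := he
    obtain ⟨a, _, h⟩ := he'
    simp only [Prod.mk.injEq] at h; omega
  · intro e he he'
    rw [mem_splitArcs] at he he'
    rcases he with ⟨v, _, rfl⟩ | ⟨a, b, hab, rfl⟩
    · rcases he' with ⟨w, _, hw⟩ | ⟨a, b, hab, hw⟩
      · simp only [Prod.swap_prod_mk, Prod.mk.injEq] at hw; omega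
      · simp only [Prod.swap_prod_mk, Prod.mk.injEq] at hw
        have h1 : a = v := by omega
        have h2 : b = v := by omega
        subst h1 h2
        exact h.irrefl _ hab
    · rcases he' with ⟨w, _, hw⟩ | ⟨a', b', hab', hw⟩
      · simp only [Prod.swap_prod_mk, Prod.mk.injEq] at hw
        have h1 : a = w := by omega
        have h2 : b = w := by omega
        subst h1 h2
        exact h.irrefl _ hab
      · simp only [Prod.swap_prod_mk, Prod.mk.injEq] at hw; omega

theorem flow_spec (h : IsGraph V E) (x y : ℕ) :
    (∀ R : Set ℕ, x + x + 1 ∈ R → y + y ∉ R → flow V E x y ≤ leave R (splitArcs V E)) ∧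
      ∃ R : Set ℕ, x + x + 1 ∈ R ∧ y + y ∉ R ∧ flow V E x y = leave R (splitArcs V E) :=
  iter_augment_spec h.isOrientation (by omega)

/-- A walk that leaves `R` contains an arc that leaves `R`. -/
theorem exists_leaving_arc {n : ℕ} {G : SimpleGraph (Fin n)}
    (hE : ∀ a b : Fin n, G.Adj a b → adj E a b) (hV : ∀ a : Fin n, (a : ℕ) ∈ V) {R : Set ℕ}
    {u y : Fin n} (p : G.Walk u y) (hu : (u : ℕ) + u + 1 ∈ R) (hy : (y : ℕ) + y ∉ R)
    (huy : u ≠ y) :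
    ∃ a ∈ p.support, ∃ b ∈ p.support, ∃ e ∈ splitArcs V E, e.1 ∈ R ∧ e.2 ∉ R ∧
      e.1 / 2 = a ∧ e.2 / 2 = b ∧ (a = b ∧ (a : ℕ) + a ∈ R ∧ (a : ℕ) + a + 1 ∉ R ∨
        a ≠ y ∧ G.Adj a b) := by
  induction p with
  | nil => exact absurd rfl huy
  | @cons u v w huv p ih =>
    by_cases hv : (v : ℕ) + v ∈ R
    · have hvw : v ≠ w := fun h => hy (h ▸ hv)
      by_cases hv' : (v : ℕ) + v + 1 ∈ R
      · obtain ⟨a, ha, b, hb, e, h⟩ := ih hv' hy hvw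
        exact ⟨a, by simp [ha], b, by simp [hb], e, h⟩
      · refine ⟨v, by simp, v, by simp, _, mem_splitArcs.2 (.inl ⟨v, hV v, rfl⟩), hv, hv', ?_, ?_,
          .inl ⟨rfl, hv, hv'⟩⟩
        · show ((v : ℕ) + v) / 2 = v
          omega
        · show ((v : ℕ) + v + 1) / 2 = v
          omega
    · refine ⟨u, by simp, v, by simp, _, mem_splitArcs.2 (.inr ⟨u, v, hE u v huv, rfl⟩), hu, hv,
        ?_, ?_, .inr ⟨huy, huv⟩⟩
      · show ((u : ℕ) + u + 1) / 2 = u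
        omega
      · show ((v : ℕ) + v) / 2 = v
        omega

/-- Each path crosses a minimum cut in some arc. Two paths cannot share it: its ends would lie in
`{x, y}`, which is impossible for a split vertex by the choice of the cut, and for an edge since `x`
and `y` are not adjacent. -/
theorem le_flow_of_hasDisjointPaths {n : ℕ} {G : SimpleGraph (Fin n)} (h : IsGraph V E)
    (hE : ∀ a b : Fin n, G.Adj a b → adj E a b) (hV : ∀ a : Fin n, (a : ℕ) ∈ V) {x y : Fin n}
    (hxy : x ≠ y) (hadj : ¬ G.Adj x y) {k : ℕ} (hP : HasDisjointPaths G k x y) :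
    k ≤ flow V E x y := by
  classical
  obtain ⟨_, R, hx, hy, hR⟩ := flow_spec h (x : ℕ) (y : ℕ)
  obtain ⟨P, hP⟩ := hP
  choose a ha b hb e he he1 he2 hea heb hor using
    fun i => exists_leaving_arc hE hV (P i : G.Walk x y) hx hy hxy
  have hinj : Function.Injective e := by
    intro i j hij
    by_contra hne
    have haa : a i = a j := Fin.ext (by rw [← hea, ← hea, hij])
    have hbb : b i = b j := Fin.ext (by rw [← heb, ← heb, hij])
    have h1 := hP i j hne (a i) (ha i) (haa ▸ ha j)
    have h2 := hP i j hne (b i) (hb i) (hbb ▸ hb j)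
    rcases hor i with ⟨_, h3, h4⟩ | ⟨h3, h4⟩
    · rcases h1 with h1 | h1
      · rw [h1] at h4; exact h4 hx
      · rw [h1] at h3; exact hy h3
    · have h1 := h1.resolve_right h3
      rw [h1] at h4
      rcases h2 with h2 | h2
      · rw [h2] at h4; exact G.irrefl h4
      · rw [h2] at h4; exact hadj h4
  rw [hR, leave, List.countP_eq_length_filter]
  have hsub : (Finset.univ.image e) ⊆
      ((splitArcs V E).filter fun e => decide (e.1 ∈ R ∧ e.2 ∉ R)).toFinset := by
    intro c hc
    obtain ⟨i, _, rfl⟩ := Finset.mem_image.1 hc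
    simp [he i, he1 i, he2 i]
  have := Finset.card_le_card hsub
  rw [Finset.card_image_of_injective _ hinj, Finset.card_univ, Fintype.card_fin] at this
  exact this.trans (List.toFinset_card_le _)

/-- A large flow excludes small separators. -/
theorem touch_of_flow (h : IsGraph V E) {S : Finset ℕ} {t x y : ℕ} (hS : S.card ≤ t)
    (hflow : t + 3 ≤ flow V E x y) (hxS : x ∉ S) (hyS : y ∉ S) (hxy : x ≠ y)
    {Q : Set ℕ} (hyQ : y ∉ Q)
    (hbd : (bd (adj E) (lset V \ S) Q x).encard ≤ 2) : Touch (adj E) Q x y := by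
  classical
  by_contra hno
  obtain ⟨F, hF, hF2, _⟩ := exists_subset_pair hbd
  have hFmem : ∀ a, a ∈ F ↔ a ∈ bd (adj E) (lset V \ S) Q x := fun a => by rw [← hF]; rfl
  -- Both copies of everything reached from `x`, and the entry copies of the boundary and of `S`.
  -- Only the split arcs of `F ∪ S` leave this set, at most `t + 2` in number.
  let R : Set ℕ := {m | Reach (adj E) Q x (m / 2) ∨ (m % 2 = 0 ∧ m / 2 ∈ F ∪ S)}
  have hhalf : ∀ v : ℕ, (v + v) / 2 = v := fun v => by omega
  have hhalf' : ∀ v : ℕ, (v + v + 1) / 2 = v := fun v => by omega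
  have hle := (flow_spec h x y).1 R (.inl (by rw [hhalf']; exact .refl)) (by
    rintro (hy | ⟨_, hy⟩)
    · rw [hhalf] at hy
      rcases hy.eq_or_mem with h | h
      · exact hxy h.symm
      · exact hyQ h
    · rw [hhalf, Finset.mem_union, hFmem] at hy
      exact hy.elim (fun hy => hno hy.2.2.2) hyS)
  have hsub : ∀ e ∈ (splitArcs V E).filter (fun e => decide (e.1 ∈ R ∧ e.2 ∉ R)),
      e ∈ (F ∪ S).toList.map fun v => (v + v, v + v + 1) := by
    intro e he
    simp only [List.mem_filter, mem_splitArcs, decide_eq_true_eq] at he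
    obtain ⟨⟨v, hv, rfl⟩ | ⟨a, b, hab, rfl⟩, h1, h2⟩ := he
    · rw [List.mem_map]
      rcases h1 with h1 | ⟨_, h1⟩
      · rw [hhalf] at h1
        exact absurd (.inl (by rw [hhalf']; exact h1)) h2
      · rw [hhalf] at h1
        exact ⟨v, Finset.mem_toList.2 h1, rfl⟩
    · exfalso
      rcases h1 with h1 | ⟨h1, _⟩
      · rw [hhalf'] at h1
        apply h2
        by_cases hb : Reach (adj E) Q x b
        · exact .inl (by rw [hhalf]; exact hb)
        refine .inr ⟨by omega, ?_⟩
        rw [hhalf, Finset.mem_union]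
        by_cases hbS : b ∈ S
        · exact .inr hbS
        · refine .inl ((hFmem b).2 ⟨⟨(h.mem a b hab).2, hbS⟩, fun hbQ => hb (h1.tail ⟨hab, hbQ⟩),
            ?_, a, h1, hab⟩)
          rintro rfl
          exact hb .refl
      · omega
  have hnd : ((splitArcs V E).filter (fun e => decide (e.1 ∈ R ∧ e.2 ∉ R))).Nodup :=
    h.isOrientation.1.filter _
  have hlen := (List.subperm_of_subset hnd hsub).length_le
  rw [← List.countP_eq_length_filter, List.length_map, Finset.length_toList] at hlen
  have hcard := Finset.card_union_le F S
  have heq : leave R (splitArcs V E) =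
      (splitArcs V E).countP fun e => decide (e.1 ∈ R ∧ e.2 ∉ R) := by
    exact List.countP_congr fun e _ => by simp
  omega

/-! ### Joining vertices without changing small modulators -/

/-- `S` is a modulator of the graph with vertices `V` and arcs `E`. -/
def IsMod (V : List ℕ) (E : List (ℕ × ℕ)) (S : Finset ℕ) : Prop :=
  Elim (adj E) (lset V \ S) ∅ ∅

/-- If `S` contains an end of the new edge, nothing changes outside `S`. Otherwise the flow survives
the loss of `S` with at least three units, too many for a separator of two vertices. -/
theorem isMod_link (h : IsGraph V E) {S : Finset ℕ} {t x y : ℕ} (hS : S.card ≤ t)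
    (hx : x ∈ V) (hy : y ∈ V) (hxy : x ≠ y)
    (h1 : t + 3 ≤ flow V E x y) (h2 : t + 3 ≤ flow V E y x) (hmod : IsMod V E S) :
    IsMod V ((x, y) :: (y, x) :: E) S := by
  have hadj : ∀ a b, adj ((x, y) :: (y, x) :: E) a b →
      adj E a b ∨ (a = x ∧ b = y) ∨ (a = y ∧ b = x) := by
    intro a b hab
    simp only [adj, List.mem_cons, Prod.mk.injEq] at hab ⊢
    tauto
  by_cases hxS : x ∈ S
  · refine hmod.mono_empty le_rfl fun a ha b hb hab => ?_
    rcases hadj a b hab with h | ⟨rfl, rfl⟩ | ⟨rfl, rfl⟩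
    · exact h
    · exact absurd hxS ha.2
    · exact absurd hxS hb.2
  by_cases hyS : y ∈ S
  · refine hmod.mono_empty le_rfl fun a ha b hb hab => ?_
    rcases hadj a b hab with h | ⟨rfl, rfl⟩ | ⟨rfl, rfl⟩
    · exact h
    · exact absurd hyS hb.2
    · exact absurd hyS ha.2
  refine hmod.add_edge h.symm hadj ⟨hx, hxS⟩ (fun Q _ _ hyQ hbd => ?_) (fun Q _ hxQ _ hbd => ?_)
    (Set.empty_subset _) (.inr ⟨Set.notMem_empty _, Set.notMem_empty _⟩)
  · exact touch_of_flow h hS h1 hxS hyS hxy hyQ hbd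
  · exact touch_of_flow h hS h2 hyS hxS hxy.symm hxQ hbd

theorem mem_pairs {X : List ℕ} {e : ℕ × ℕ} : e ∈ pairs X ↔ e.1 ∈ X ∧ e.2 ∈ X := by
  simp only [pairs, List.mem_flatMap, List.mem_map]
  constructor
  · rintro ⟨a, ha, b, hb, rfl⟩
    exact ⟨ha, hb⟩
  · rintro ⟨h1, h2⟩
    exact ⟨e.1, h1, e.2, h2, rfl⟩

/-- Every step turns a non-adjacent pair of `X` into an edge, so the number of pairs bounds the
number of steps. Arcs are added in both directions to keep the list symmetric. -/
theorem linkAll_spec {X : List ℕ} (hX : ∀ a ∈ X, a ∈ V) (t : ℕ) (h : IsGraph V E) :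
    IsGraph V (linkAll V X t E) ∧
    (∀ a b, adj E a b → adj (linkAll V X t E) a b) ∧
    (∀ a b, adj (linkAll V X t E) a b → adj E a b ∨ (a ∈ X ∧ b ∈ X)) ∧
    (∀ S : Finset ℕ, S.card ≤ t → IsMod V E S → IsMod V (linkAll V X t E) S) ∧
    ∀ x ∈ X, ∀ y ∈ X, x ≠ y → ¬ adj (linkAll V X t E) x y →
      flow V (linkAll V X t E) x y ≤ t + 2 ∨ flow V (linkAll V X t E) y x ≤ t + 2 := by
  have hstep : ∀ E, ((∀ x ∈ X, ∀ y ∈ X, x ≠ y → ¬ adj E x y →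
      flow V E x y ≤ t + 2 ∨ flow V E y x ≤ t + 2) ∧ linkStep V X t E = E) ∨
      ∃ x ∈ X, ∃ y ∈ X, x ≠ y ∧ ¬ adj E x y ∧ t + 3 ≤ flow V E x y ∧ t + 3 ≤ flow V E y x ∧
        linkStep V X t E = (x, y) :: (y, x) :: E := by
    intro E
    rcases headCase_cases ((pairs X).filter fun e : ℕ × ℕ => (!decide (e.1 = e.2) && !decide (e ∈ E)) &&
      (decide (t + 3 ≤ flow V E e.1 e.2) && decide (t + 3 ≤ flow V E e.2 e.1))) E
      (fun e => (e.1, e.2) :: (e.2, e.1) :: E) with ⟨h0, h⟩ | ⟨e, he, h⟩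
    · refine .inl ⟨fun x hx y hy hxy hadj => ?_, h⟩
      rw [List.filter_eq_nil_iff] at h0
      have := h0 (x, y) (mem_pairs.2 ⟨hx, hy⟩)
      rw [adj] at hadj
      simp only [hxy, hadj, decide_false, Bool.not_false, Bool.and_self, Bool.true_and,
        Bool.and_eq_true, decide_eq_true_eq, not_and, not_le] at this
      by_cases hf : t + 3 ≤ flow V E x y
      · have := this hf
        exact .inr (by omega)
      · exact .inl (by omega)
    · simp only [List.mem_filter, Bool.and_eq_true, Bool.not_eq_true', decide_eq_false_iff_not,
        decide_eq_true_eq, mem_pairs] at he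
      exact .inr ⟨e.1, he.1.1, e.2, he.1.2, he.2.1.1, he.2.1.2, he.2.2.1, he.2.2.2, h⟩
  obtain ⟨h1, h2⟩ := iter_stationary (l := pairs X) (f := linkStep V X t) (s := E)
    (fun E => ((pairs X).filter fun e => !decide (e ∈ E)).length)
    (fun E' => IsGraph V E' ∧ (∀ a b, adj E a b → adj E' a b) ∧
      (∀ a b, adj E' a b → adj E a b ∨ (a ∈ X ∧ b ∈ X)) ∧
      ∀ S : Finset ℕ, S.card ≤ t → IsMod V E S → IsMod V E' S) (fun E' hE' => by
      rcases hstep E' with ⟨_, h⟩ | ⟨x, hx, y, hy, hxy, hadj, hf1, hf2, h⟩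
      · exact ⟨h.symm ▸ hE', .inl h⟩
      · rw [h]
        obtain ⟨hg, hs1, hs2, hs3⟩ := hE'
        refine ⟨⟨⟨hg.nodupV, ?_, ?_, ?_, ?_⟩, ?_, ?_, ?_⟩, .inr ?_⟩
        · have h3 : (y, x) ∉ E' := fun h => hadj (hg.symm h)
          have h4 : (x, y) ∉ E' := hadj
          simp [h3, h4, hg.nodupE, hxy]
        · intro a b hab
          have := @hg.symm a b
          simp only [adj, List.mem_cons, Prod.mk.injEq] at *
          tauto
        · intro a ha
          have := hg.irrefl a
          simp only [adj, List.mem_cons, Prod.mk.injEq] at *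
          rcases ha with ⟨rfl, hh⟩ | ⟨rfl, hh⟩ | hh
          · exact hxy hh
          · exact hxy hh.symm
          · exact this hh
        · intro a b hab
          have := hg.mem a b
          simp only [adj, List.mem_cons, Prod.mk.injEq] at *
          rcases hab with ⟨rfl, rfl⟩ | ⟨rfl, rfl⟩ | h
          · exact ⟨hX _ hx, hX _ hy⟩
          · exact ⟨hX _ hy, hX _ hx⟩
          · exact this h
        · intro a b hab
          have := hs1 a b hab
          simp only [adj, List.mem_cons] at *
          tauto
        · intro a b hab
          have := hs2 a b
          simp only [adj, List.mem_cons, Prod.mk.injEq] at *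
          rcases hab with ⟨rfl, rfl⟩ | ⟨rfl, rfl⟩ | h
          · exact .inr ⟨hx, hy⟩
          · exact .inr ⟨hy, hx⟩
          · exact this h
        · exact fun S hS hm => isMod_link hg hS (hX x hx) (hX y hy) hxy hf1 hf2 (hs3 S hS hm)
        · refine length_filter_lt (a := (x, y)) (fun a _ ha => ?_) (mem_pairs.2 ⟨hx, hy⟩) ?_ ?_
          · simp only [List.mem_cons, Bool.not_eq_true', decide_eq_false_iff_not, not_or] at *
            exact ha.2.2
          · simpa [adj] using hadj
          · simp) ⟨h, fun _ _ h => h, fun _ _ h => .inl h, fun _ _ h => h⟩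
    (List.length_filter_le _ _)
  change linkStep V X t (linkAll V X t E) = linkAll V X t E at h2
  obtain ⟨hg, hs1, hs2, hs3⟩ := h1
  refine ⟨hg, hs1, hs2, hs3, ?_⟩
  rcases hstep (linkAll V X t E) with ⟨hno, _⟩ | ⟨x, _, y, _, _, _, _, _, h'⟩
  · exact hno
  · rw [h2] at h'
    have := congrArg List.length h'
    simp only [List.length_cons] at this
    omega

end Flow

/-! ### The search for obstructions -/

section Greedy

variable {V X : List ℕ} {E : List (ℕ × ℕ)}

/-- The invariant of the search for obstructions. -/
structure GreedyInv (V : List ℕ) (E : List (ℕ × ℕ)) (X : List ℕ) (s : GState) : Prop where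
  nodupU : s.1.Nodup
  memU : ∀ a ∈ s.1, a ∈ V ∧ a ∉ X
  memQ : ∀ a ∈ s.2.1, a ∈ s.1
  elim : Elim (adj E) (lset s.1) ∅ (lset s.2.1)
  goodQ : ∀ x ∈ X, Good (adj E) (lset s.2.1) x
  nodupT : s.2.2.1.Nodup
  memT : ∀ a ∈ s.2.2.1, a ∈ V ∧ a ∉ X
  lengthT : s.2.2.1.length ≤ 3 * s.2.2.2.length
  goodR : ∀ x ∈ X, Good (adj E) {a | a ∈ V ∧ a ∉ X ∧ a ∉ s.2.2.1 ∧ a ∉ s.1} x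
  noEdge : ∀ a, a ∈ V → a ∉ X → a ∉ s.2.2.1 → a ∉ s.1 → ∀ b ∈ s.1, ¬ adj E a b
  obstruction : ∀ D ∈ s.2.2.2, D.Nodup ∧ (∀ a ∈ D, a ∈ V ∧ a ∉ X ∧ a ∉ s.1) ∧
    ∃ x ∈ X, good E D x = false
  disjoint : s.2.2.2.Pairwise List.Disjoint

theorem greedyStep_cases (hE : ∀ ⦃a b⦄, adj E a b → adj E b a) {s : GState} (hs : GreedyInv V E X s) :
    (greedyStep V E X s = s ∧ ∀ v ∈ s.1, v ∉ s.2.1 →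
      ¬ (bd (adj E) (lset s.1) (lset s.2.1) v).encard ≤ 2) ∨
    ∃ v ∈ s.1, v ∉ s.2.1 ∧ (bd (adj E) (lset s.1) (lset s.2.1) v).encard ≤ 2 ∧
      (((∃ x ∈ X, good E (comp E s.2.1 v) x = false) ∧
        greedyStep V E X s =
          (s.1.filter fun a => !decide (a ∈ comp E s.2.1 v) && !decide (a ∈ bdry E s.1 s.2.1 v),
            s.2.1.filter fun a => !decide (a ∈ comp E s.2.1 v),
            V.filter fun a => (decide (a ∈ s.2.2.1) || decide (a = v)) ||
              decide (a ∈ bdry E s.1 s.2.1 v),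
            comp E s.2.1 v :: s.2.2.2)) ∨
      ((∀ x ∈ X, good E (comp E s.2.1 v) x) ∧
        greedyStep V E X s = (s.1, v :: s.2.1, s.2.2.1, s.2.2.2))) := by
  unfold greedyStep
  rcases headCase_cases (V.filter fun v => (decide (v ∈ s.1) && !decide (v ∈ s.2.1)) &&
      decide ((bdry E s.1 s.2.1 v).length ≤ 2)) s (fun v =>
    bif X.any fun x => !good E (comp E s.2.1 v) x then
      (s.1.filter fun a => !decide (a ∈ comp E s.2.1 v) && !decide (a ∈ bdry E s.1 s.2.1 v),
        s.2.1.filter fun a => !decide (a ∈ comp E s.2.1 v),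
        V.filter fun a => (decide (a ∈ s.2.2.1) || decide (a = v)) ||
          decide (a ∈ bdry E s.1 s.2.1 v),
        comp E s.2.1 v :: s.2.2.2)
    else (s.1, v :: s.2.1, s.2.2.1, s.2.2.2)) with ⟨h0, h⟩ | ⟨v, hv, h⟩
  · refine .inl ⟨h, fun v hv hvQ hbd => ?_⟩
    rw [List.filter_eq_nil_iff] at h0
    exact h0 v (hs.memU v hv).1 (by simp [hv, hvQ, length_bdry_le hE hs.nodupU, hbd])
  · simp only [List.mem_filter, Bool.and_eq_true, Bool.not_eq_true', decide_eq_false_iff_not,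
      decide_eq_true_eq, length_bdry_le hE hs.nodupU] at hv
    refine .inr ⟨v, hv.2.1.1, hv.2.1.2, hv.2.2, ?_⟩
    rw [h]
    cases hX : X.any fun x => !good E (comp E s.2.1 v) x
    · refine .inr ⟨?_, rfl⟩
      simpa using hX
    · refine .inl ⟨?_, rfl⟩
      simpa using hX

/-- Besides the current set `U`, the invariant controls the discarded vertices outside `T`: they
have no edges into `U` and are good for every `x`. This allows the discarded pieces to be glued by
`Good.union`. -/
theorem greedyInv_step (h : IsGraph V E) {s : GState} (hs : GreedyInv V E X s) :
    GreedyInv V E X (greedyStep V E X s) ∧ (greedyStep V E X s = s ∨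
      ((greedyStep V E X s).1.filter fun a => !decide (a ∈ (greedyStep V E X s).2.1)).length <
        (s.1.filter fun a => !decide (a ∈ s.2.1)).length) := by
  have hE := h.symm
  rcases greedyStep_cases hE hs with ⟨h0, _⟩ | ⟨v, hvU, hvQ, hbd, hcase⟩
  · exact ⟨h0.symm ▸ hs, .inl h0⟩
  obtain ⟨U, Q, T, Ds⟩ := s
  dsimp only at *
  have hQU := hs.memQ
  dsimp only at hQU
  have hcomp : ∀ a, a ∈ comp E Q v → a = v ∨ a ∈ Q := fun a ha =>
    ((mem_comp hE).1 ha).eq_or_mem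
  have hvcomp : v ∈ comp E Q v := (mem_comp hE).2 .refl
  have hcompU : ∀ a ∈ comp E Q v, a ∈ U := fun a ha =>
    (hcomp a ha).elim (fun h => h ▸ hvU) (hQU a)
  have hext : ∀ a ∈ comp E Q v, ∀ b ∈ Q, adj E a b → b ∈ comp E Q v := fun a ha b hb hab =>
    (mem_comp hE).2 (((mem_comp hE).1 ha).tail ⟨hab, hb⟩)
  have hext' : ∀ a ∈ comp E Q v, ∀ b ∈ U, b ∉ comp E Q v → b ∉ bdry E U Q v → ¬ adj E a b := by
    intro a ha b hbU hb hb' hab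
    refine hb' ((mem_bdry hE).2 ⟨hbU, fun hbQ => hb (hext a ha b hbQ hab), ?_, a,
      (mem_comp hE).1 ha, hab⟩)
    rintro rfl
    exact hb hvcomp
  have hbdryU : ∀ a ∈ bdry E U Q v, a ∈ U ∧ a ∉ Q := fun a ha =>
    ⟨((mem_bdry hE).1 ha).1, ((mem_bdry hE).1 ha).2.1⟩
  have hcompX : ∀ x ∈ X, x ∉ comp E Q v := fun x hx hc => (hs.memU x (hcompU x hc)).2 hx
  rcases hcase with ⟨hbad, h0⟩ | ⟨hgood, h0⟩
  · rw [h0]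
    dsimp only
    refine ⟨⟨hs.nodupU.filter _, ?_, ?_, ?_, ?_, h.nodupV.filter _, ?_, ?_, ?_, ?_, ?_, ?_⟩,
      .inr ?_⟩
    · exact fun a ha => hs.memU a (List.mem_of_mem_filter ha)
    · intro a ha
      simp only [List.mem_filter, Bool.not_eq_true', decide_eq_false_iff_not,
        Bool.and_eq_true] at ha ⊢
      exact ⟨hQU a ha.1, ha.2, fun hb => (hbdryU a hb).2 ha.1⟩
    · have := hs.elim.mono (r' := adj E) (U' := lset (U.filter fun a =>
        !decide (a ∈ comp E Q v) && !decide (a ∈ bdry E U Q v)))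
        (fun a ha => List.mem_of_mem_filter ha) (fun _ _ _ _ h => h)
      rw [Set.empty_inter] at this
      convert this using 1
      ext a
      simp only [mem_lset, List.mem_filter, Bool.not_eq_true', decide_eq_false_iff_not,
        Bool.and_eq_true, Set.mem_inter_iff]
      exact ⟨fun ha => ⟨ha.1, hQU a ha.1, ha.2, fun hb => (hbdryU a hb).2 ha.1⟩,
        fun ha => ⟨ha.1, ha.2.2.1⟩⟩
    · exact fun x hx => (hs.goodQ x hx).mono fun a ha => List.mem_of_mem_filter ha
    · intro a ha
      simp only [List.mem_filter, Bool.or_eq_true, decide_eq_true_eq] at ha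
      rcases ha with ⟨haV, (haT | rfl) | hab⟩
      · exact hs.memT a haT
      · exact hs.memU a hvU
      · exact hs.memU a (hbdryU a hab).1
    -- The new members of `T` are `v` and at most two boundary vertices, hence the factor 3.
    · have hsub : ∀ a ∈ V.filter (fun a => (decide (a ∈ T) || decide (a = v)) ||
          decide (a ∈ bdry E U Q v)), a ∈ v :: (bdry E U Q v ++ T) := by
        intro a ha
        simp only [List.mem_filter, Bool.or_eq_true, decide_eq_true_eq] at ha
        simp only [List.mem_cons, List.mem_append]
        tauto
      have hlen := (List.subperm_of_subset (h.nodupV.filter _) hsub).length_le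
      have h2 := (length_bdry_le hE hs.nodupU).2 hbd
      have h3 := hs.lengthT
      simp only [List.length_cons, List.length_append] at *
      omega
    -- The component without `v` lies in `Q`, which was good for `x`; only `v` spoils it, and `v` is
    -- moved to `T`.
    · intro x hx
      have h1 := (hs.goodQ x hx).mono (D' := {a | a ∈ comp E Q v ∧ a ≠ v})
        fun a ha => (hcomp a ha.1).resolve_left ha.2
      refine ((hs.goodR x hx).union hE h1 (fun a ha b hb =>
        hs.noEdge a ha.1 ha.2.1 ha.2.2.1 ha.2.2.2 b (hcompU b hb.1))
        (Set.disjoint_left.2 fun a ha hb => ha.2.2.2 (hcompU a hb.1))).mono ?_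
      rintro a ⟨haV, haX, haT, haU⟩
      simp only [List.mem_filter, Bool.or_eq_true, decide_eq_true_eq, not_and, not_or,
        Bool.and_eq_true, Bool.not_eq_true', decide_eq_false_iff_not, not_not] at haT haU
      obtain ⟨⟨h1, h2⟩, h3⟩ := haT haV
      by_cases hac : a ∈ comp E Q v
      · exact .inr ⟨hac, h2⟩
      · exact .inl ⟨haV, haX, h1, fun hU => h3 (haU hU hac)⟩
    · intro a haV haX haT haU b hb
      simp only [List.mem_filter, Bool.or_eq_true, decide_eq_true_eq, not_and, not_or,
        Bool.and_eq_true, Bool.not_eq_true', decide_eq_false_iff_not, not_not] at haT haU hb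
      obtain ⟨⟨h1, h2⟩, h3⟩ := haT haV
      by_cases hac : a ∈ comp E Q v
      · exact hext' a hac b hb.1 hb.2.1 hb.2.2
      · exact hs.noEdge a haV haX h1 (fun hU => h3 (haU hU hac)) b hb.1
    · intro D hD
      rcases List.mem_cons.1 hD with rfl | hD
      · refine ⟨comp_nodup _ _ _, fun a ha => ⟨(hs.memU a (hcompU a ha)).1,
          (hs.memU a (hcompU a ha)).2, ?_⟩, hbad⟩
        simp [ha]
      · obtain ⟨h1, h2, h3⟩ := hs.obstruction D hD
        exact ⟨h1, fun a ha => ⟨(h2 a ha).1, (h2 a ha).2.1, fun h =>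
          (h2 a ha).2.2 (List.mem_of_mem_filter h)⟩, h3⟩
    · refine List.pairwise_cons.2 ⟨fun D hD a ha haD => ?_, hs.disjoint⟩
      exact ((hs.obstruction D hD).2.1 a haD).2.2 (hcompU a ha)
    -- Eliminated vertices leave `Q` only together with `U`, so the uneliminated part of `U` loses
    -- `v` and gains nothing.
    · rw [List.filter_filter]
      refine length_filter_lt (a := v) (fun a _ ha => ?_) hvU (by simpa using hvQ) ?_
      · simp only [Bool.and_eq_true, Bool.not_eq_true', decide_eq_false_iff_not, List.mem_filter,
          not_and, not_not] at ha ⊢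
        exact fun haQ => ha.2.1 (ha.1 haQ)
      · simp [hvcomp]
  · rw [h0]
    dsimp only
    refine ⟨⟨hs.nodupU, hs.memU, ?_, ?_, ?_, hs.nodupT, hs.memT, hs.lengthT, hs.goodR, hs.noEdge,
      hs.obstruction, hs.disjoint⟩, .inr ?_⟩
    · intro a ha
      rcases List.mem_cons.1 ha with rfl | ha
      · exact hvU
      · exact hQU a ha
    · rw [lset_cons]
      exact hs.elim.insert_of_encard_le hE hvU hvQ (Set.notMem_empty _) hbd
    -- The component of `v` passed the test, and it has no edges to the rest of `Q`.
    · intro x hx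
      have h1 := (good_iff hE (comp_nodup E Q v) (hcompX x hx)).1 (hgood x hx)
      have h2 := (hs.goodQ x hx).mono (D' := {a | a ∈ Q ∧ a ∉ comp E Q v}) fun a ha => ha.1
      refine (h1.union hE h2 (fun a ha b hb hab => hb.2 (hext a ha b hb.1 hab))
        (Set.disjoint_left.2 fun a ha hb => hb.2 ha)).mono fun a ha => ?_
      by_cases hac : a ∈ comp E Q v
      · exact .inl hac
      · rcases List.mem_cons.1 ha with rfl | ha
        · exact absurd hvcomp hac
        · exact .inr ⟨ha, hac⟩
    · refine length_filter_lt (a := v) (fun a _ ha => ?_) hvU (by simpa using hvQ) (by simp)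
      simp only [Bool.not_eq_true', decide_eq_false_iff_not, List.mem_cons, not_or] at ha ⊢
      exact ha.2

/-- The outcome of the search for obstructions. -/
theorem greedy_spec (h : IsGraph V E) (hX : Elim (adj E) (lset V \ lset X) ∅ ∅) :
    (greedy V E X).2.2.1.Nodup ∧ (∀ a ∈ (greedy V E X).2.2.1, a ∈ V ∧ a ∉ X) ∧
    (greedy V E X).2.2.1.length ≤ 3 * (greedy V E X).2.2.2.length ∧
    (∀ x ∈ X, Good (adj E) {a | a ∈ V ∧ a ∉ X ∧ a ∉ (greedy V E X).2.2.1} x) ∧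
    (∀ D ∈ (greedy V E X).2.2.2, D.Nodup ∧ (∀ a ∈ D, a ∈ V ∧ a ∉ X) ∧
      ∃ x ∈ X, good E D x = false) ∧
    (greedy V E X).2.2.2.Pairwise List.Disjoint := by
  have hU : lset (V.filter fun a => !decide (a ∈ X)) = lset V \ lset X := by
    ext a; simp
  have hgood0 : ∀ (D : Set ℕ) x, D = ∅ → Good (adj E) D x := by
    rintro D x rfl
    exact .done (by simp)
  obtain ⟨h1, h2⟩ := iter_stationary (l := V) (f := greedyStep V E X)
    (s := (V.filter fun a => !decide (a ∈ X), [], [], []))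
    (fun s => (s.1.filter fun a => !decide (a ∈ s.2.1)).length) (GreedyInv V E X)
    (fun s hs => greedyInv_step h hs)
    ⟨h.nodupV.filter _, by simp, by simp, by rw [hU]; simpa using hX,
      fun x _ => hgood0 _ x (by simp), by simp, by simp, by simp,
      fun x _ => hgood0 _ x (by ext a; simp; tauto),
      fun a haV haX _ haU => absurd (List.mem_filter.2 ⟨haV, by simpa using haX⟩) haU, by simp, by simp⟩
    ((List.length_filter_le _ _).trans (List.length_filter_le _ _))
  change GreedyInv V E X (greedy V E X) at h1
  change greedyStep V E X (greedy V E X) = greedy V E X at h2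
  refine ⟨h1.nodupT, h1.memT, h1.lengthT, fun x hx => ?_, fun D hD => ?_, h1.disjoint⟩
  -- The final state is stuck although an elimination ordering of the rest exists, so everything
  -- left has been eliminated.
  · have hUQ : ∀ a ∈ (greedy V E X).1, a ∈ (greedy V E X).2.1 := by
      rcases greedyStep_cases h.symm h1 with ⟨_, hno⟩ | ⟨v, hvU, hvQ, _, hcase⟩
      · cases h1.elim with
        | done h => simpa [Set.subset_def] using h
        | step v hv hvQ _ hbd _ => exact absurd hbd (hno v hv hvQ)
      · rw [h2] at hcase
        exfalso
        rcases hcase with ⟨_, hc⟩ | ⟨_, hc⟩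
        · have := congrArg (fun s : GState => s.2.2.2.length) hc
          simp only [List.length_cons] at this
          omega
        · have := congrArg (fun s : GState => s.2.1.length) hc
          simp only [List.length_cons] at this
          omega
    refine ((h1.goodR x hx).union h.symm (h1.goodQ x hx) (fun a ha b hb =>
      h1.noEdge a ha.1 ha.2.1 ha.2.2.1 ha.2.2.2 b (h1.memQ b hb))
      (Set.disjoint_left.2 fun a ha hb => ha.2.2.2 (h1.memQ a hb))).mono ?_
    rintro a ⟨haV, haX, haT⟩
    by_cases haU : a ∈ (greedy V E X).1
    · exact .inr (hUQ a haU)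
    · exact .inl ⟨haV, haX, haT, haU⟩
  · obtain ⟨ha, hb, hc⟩ := h1.obstruction D hD
    exact ⟨ha, fun a had => ⟨(hb a had).1, (hb a had).2.1⟩, hc⟩

/-- A modulator that avoids `x` intersects every obstruction for `x`. -/
theorem exists_mem_of_good_eq_false (h : IsGraph V E) {S : Finset ℕ} (hS : IsMod V E S)
    {D : List ℕ} {x : ℕ} (hD : D.Nodup) (hDV : ∀ a ∈ D, a ∈ V) (hxD : x ∉ D) (hxV : x ∈ V)
    (hgood : good E D x = false) (hxS : x ∉ S) : ∃ a ∈ D, a ∈ S := by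
  by_contra! hno
  have h1 : Elim (adj E) ({x} ∪ lset D) ∅ ∅ := by
    refine hS.mono_empty ?_ fun _ _ _ _ h => h
    rintro a (rfl | ha)
    · exact ⟨hxV, hxS⟩
    · exact ⟨hDV a ha, hno a ha⟩
  rw [← good_iff_elim h.symm h.irrefl (finite_lset D), ← good_iff h.symm hD hxD] at h1
  simp [hgood] at h1

theorem length_le_card_of_hits {L : List (List ℕ)} (hL : L.Pairwise List.Disjoint) {S : Finset ℕ}
    (hS : ∀ D ∈ L, ∃ a ∈ D, a ∈ S) : L.length ≤ S.card := by
  induction L generalizing S with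
  | nil => simp
  | cons D L ih =>
    obtain ⟨a, haD, haS⟩ := hS D (by simp)
    obtain ⟨h1, h2⟩ := List.pairwise_cons.1 hL
    have := ih h2 (S := S.erase a) fun D' hD' => by
      obtain ⟨b, hb, hbS⟩ := hS D' (by simp [hD'])
      refine ⟨b, hb, Finset.mem_erase.2 ⟨?_, hbS⟩⟩
      rintro rfl
      exact h1 D' hD' haD hb
    have := Finset.card_erase_add_one haS
    simp only [List.length_cons]
    omega

/-- A union bound: every entry is counted by at least one `x ∈ F`. -/
theorem length_le_sum_filter {α β : Type*} {L : List α} {F : Finset β} {p : β → α → Bool}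
    (h : ∀ D ∈ L, ∃ x ∈ F, p x D) : L.length ≤ ∑ x ∈ F, (L.filter (p x)).length := by
  induction L with
  | nil => simp
  | cons D L ih =>
    have h1 := ih fun D' hD' => h D' (by simp [hD'])
    obtain ⟨x, hx, hp⟩ := h D (by simp)
    have h2 : ∑ x ∈ F, (L.filter (p x)).length < ∑ x ∈ F, ((D :: L).filter (p x)).length := by
      refine Finset.sum_lt_sum (fun y _ => ?_) ⟨x, hx, ?_⟩
      · exact ((List.sublist_cons_self D L).filter _).length_le
      · simp [hp]
    simp only [List.length_cons]
    omega

/-! ### Counting obstructions against a modulator -/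

section Bounds

variable (h : IsGraph V E) (hX : Elim (adj E) (lset V \ lset X) ∅ ∅) (hXV : ∀ x ∈ X, x ∈ V)
  {S : Finset ℕ} (hS : IsMod V E S)

include h hX hXV hS

/-- Otherwise `S` would meet each of more than `S.card` disjoint obstructions. -/
theorem mem_of_card_lt_badCount {x : ℕ} (hx : x ∈ X)
    (hlt : S.card < badCount E (greedy V E X).2.2.2 x) : x ∈ S := by
  by_contra hxS
  obtain ⟨_, _, _, _, hD, hdis⟩ := greedy_spec h hX
  refine absurd (length_le_card_of_hits (hdis.filter fun D => !good E D x) (S := S)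
    fun D hD' => ?_) (not_le.2 hlt)
  obtain ⟨hD', hbad⟩ := List.mem_filter.1 hD'
  obtain ⟨h1, h2, _⟩ := hD D hD'
  exact exists_mem_of_good_eq_false h hS h1 (fun a ha => (h2 a ha).1) (fun hxD => (h2 x hxD).2 hx)
    (hXV x hx) (by simpa using hbad) hxS

/-- Obstructions that meet `S` are at most as many as the elements of `S` outside `X`, by
disjointness. Any other one has its witness `x` in `S ∩ X`, and each such `x` accounts for at most
`t` of them. -/
theorem length_obstructions_le {t : ℕ} (ht : 1 ≤ t)
    (hbad : ∀ x ∈ X, badCount E (greedy V E X).2.2.2 x ≤ t) :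
    (greedy V E X).2.2.2.length ≤ S.card * t := by
  classical
  obtain ⟨_, _, _, _, hD, hdis⟩ := greedy_spec h hX
  set L := (greedy V E X).2.2.2 with hL
  let hit : List ℕ → Bool := fun D => decide (∃ a ∈ D, a ∈ S)
  have h1 : (L.filter hit).length ≤ (S.filter fun a => a ∉ X).card := by
    refine length_le_card_of_hits (hdis.filter _) fun D hD' => ?_
    obtain ⟨hD', hh⟩ := List.mem_filter.1 hD'
    obtain ⟨a, ha, haS⟩ := of_decide_eq_true hh
    exact ⟨a, ha, Finset.mem_filter.2 ⟨haS, ((hD D hD').2.1 a ha).2⟩⟩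
  have h2 : (L.filter fun D => !hit D).length ≤ (S.filter fun a => a ∈ X).card * t := by
    refine (length_le_sum_filter (F := S.filter fun a => a ∈ X) (p := fun x D => !good E D x)
      fun D hD' => ?_).trans ?_
    · obtain ⟨hD', hh⟩ := List.mem_filter.1 hD'
      obtain ⟨hnd, hmem, x, hx, hbadx⟩ := hD D hD'
      refine ⟨x, Finset.mem_filter.2 ⟨by_contra fun hxS => ?_, hx⟩, by simp [hbadx]⟩
      have := exists_mem_of_good_eq_false h hS hnd (fun a ha => (hmem a ha).1)
        (fun hxD => (hmem x hxD).2 hx) (hXV x hx) hbadx hxS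
      simp [hit, this] at hh
    · refine Finset.sum_le_card_nsmul _ _ _ fun x hx => ?_
      refine le_trans ?_ (hbad x (Finset.mem_filter.1 hx).2)
      exact ((List.filter_sublist (p := fun D => !hit D) (l := L)).filter _).length_le
  have h3 : L.length = (L.filter hit).length + (L.filter fun D => !hit D).length := by
    rw [List.length_eq_length_filter_add hit]
  have h4 : (S.filter fun a => a ∈ X).card + (S.filter fun a => a ∉ X).card = S.card :=
    Finset.card_filter_add_card_filter_not _
  rw [h3, ← h4, add_mul]
  -- Elements outside `X` count only once, which is at most `t` since `t` is positive.
  have := Nat.le_mul_of_pos_right (S.filter fun a => a ∉ X).card ht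
  omega

end Bounds

end Greedy

/-! ### Graphs on `Fin n` and their lists of arcs -/

section Representation

open Enc Classical

/-- The graph `H` is the graph with vertices `V` and arcs `E`, up to the numbering `φ`. -/
structure Represents (V : List ℕ) (E : List (ℕ × ℕ)) {m : ℕ} (φ : Fin m → ℕ)
    (H : SimpleGraph (Fin m)) : Prop where
  list : V = List.ofFn φ
  injective : Function.Injective φ
  adj_iff : ∀ a b, adj E (φ a) (φ b) ↔ H.Adj a b

variable {V : List ℕ} {E : List (ℕ × ℕ)} {m : ℕ} {φ : Fin m → ℕ} {H : SimpleGraph (Fin m)}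

theorem Represents.mem_iff (h : Represents V E φ H) {a : ℕ} : a ∈ V ↔ ∃ i, φ i = a := by
  rw [h.list, List.mem_ofFn']
  rfl

theorem Represents.isModulator_iff (h : Represents V E φ H) (X : Set (Fin m)) :
    IsModulator H X ↔ Elim (adj E) (φ '' Xᶜ) ∅ ∅ := by
  have := treewidth_le_two_iff_elim_image (H.induce Xᶜ) (r := adj E) (φ := fun a => φ a)
    (h.injective.comp Subtype.val_injective) (fun a b => h.adj_iff a b) (K := ∅)
    Set.subsingleton_empty (by simp)
  rw [IsModulator, this]
  have e : Set.range (fun a : (Xᶜ : Set (Fin m)) => φ a) = φ '' Xᶜ := by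
    ext a; simp
  rw [e]

theorem Represents.minModulator_le_iff (h : Represents V E φ H) (k : ℕ) :
    minModulator H ≤ k ↔ ∃ S : Finset ℕ, S.card ≤ k ∧ IsMod V E S := by
  constructor
  · intro hk
    have hne : {k | ∃ X : Finset (Fin m), IsModulator H (X : Set (Fin m)) ∧ X.card = k}.Nonempty :=
      ⟨Finset.univ.card, Finset.univ, (h.isModulator_iff _).2 (.done (by simp)), rfl⟩
    obtain ⟨X, hX, hcard⟩ := Nat.sInf_mem hne
    refine ⟨X.image φ, Finset.card_image_le.trans (hcard.trans_le hk), ?_⟩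
    rw [h.isModulator_iff] at hX
    rw [IsMod]
    convert hX using 1
    ext a
    simp only [Set.mem_sdiff, mem_lset, h.mem_iff, Finset.coe_image, Set.mem_image,
      Finset.mem_coe, Set.mem_compl_iff]
    constructor
    · rintro ⟨⟨i, rfl⟩, hi⟩
      exact ⟨i, fun hX => hi ⟨i, hX, rfl⟩, rfl⟩
    · rintro ⟨i, hi, rfl⟩
      exact ⟨⟨i, rfl⟩, fun ⟨j, hj, hij⟩ => hi (h.injective hij ▸ hj)⟩
  · rintro ⟨S, hS, hmod⟩
    have hX : IsModulator H ((Finset.univ.filter fun i => φ i ∈ S : Finset (Fin m)) : Set (Fin m)) := by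
      rw [h.isModulator_iff]
      rw [IsMod] at hmod
      convert hmod using 1
      ext a
      simp only [Set.mem_sdiff, mem_lset, h.mem_iff, Finset.coe_filter, Finset.mem_univ, true_and,
        Set.mem_image, Set.mem_compl_iff, Set.mem_ofPred_eq, Finset.mem_coe]
      constructor
      · rintro ⟨i, hi, rfl⟩
        exact ⟨⟨i, rfl⟩, hi⟩
      · rintro ⟨⟨i, rfl⟩, hi⟩
        exact ⟨i, hi, rfl⟩
    have hle : minModulator H ≤ (Finset.univ.filter fun i => φ i ∈ S : Finset (Fin m)).card :=
      Nat.sInf_le ⟨_, hX, rfl⟩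
    refine hle.trans (le_trans ?_ hS)
    rw [← Finset.card_image_of_injective _ h.injective]
    refine Finset.card_le_card fun a ha => ?_
    obtain ⟨i, hi, rfl⟩ := Finset.mem_image.1 ha
    exact (Finset.mem_filter.1 hi).2

/-! ### Adjacency matrices and arc lists -/

theorem encPred_eq {n : ℕ} (p : Fin n → Prop) :
    encPred p = enc (List.ofFn fun j => decide (p j)) := by
  simp only [encPred, enc, List.map_ofFn]
  congr 2
  funext j
  simp

theorem encGraph_eq {n : ℕ} (G : SimpleGraph (Fin n)) :
    encGraph G = enc (List.ofFn fun i => List.ofFn fun j => decide (G.Adj i j)) := by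
  simp only [encGraph, encPred_eq]
  simp only [enc, List.map_ofFn]
  congr 2
  funext i
  simp [List.map_ofFn]

theorem Represents.enc_matrix (h : Represents V E φ H) : encGraph H = enc (matrix V E) := by
  rw [encGraph_eq, matrix, h.list]
  congr 1
  rw [List.map_ofFn]
  congr 1
  funext i
  rw [Function.comp_apply, List.map_ofFn]
  congr 1
  funext j
  exact decide_eq_decide.2 (h.adj_iff i j).symm

theorem range_eq_ofFn (n : ℕ) : List.range n = List.ofFn (fun i : Fin n => (i : ℕ)) := by
  rw [List.ofFn_eq_map]; simp

theorem mem_trueIndices {l : List Bool} {a : ℕ} : a ∈ trueIndices l ↔ l[a]? = some true := by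
  simp only [trueIndices, List.mem_map, List.mem_filter, List.mem_zipIdx_iff_getElem?,
    Prod.exists]
  constructor
  · rintro ⟨b, i, ⟨h1, h2⟩, rfl⟩
    rw [h1]; exact congrArg some h2
  · intro h
    exact ⟨true, a, ⟨h, rfl⟩, rfl⟩

theorem nodup_zipIdx_snd {α : Type} (l : List α) : (l.zipIdx.map Prod.snd).Nodup := by
  rw [List.zipIdx_map_snd]
  exact List.nodup_range'

theorem nodup_trueIndices (l : List Bool) : (trueIndices l).Nodup :=
  (nodup_zipIdx_snd l).sublist (List.filter_sublist.map _)

theorem adj_arcs {rows : List (List Bool)} {a b : ℕ} :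
    adj (arcs rows) a b ↔ ∃ row, rows[a]? = some row ∧ row[b]? = some true := by
  simp only [adj, arcs, List.mem_flatMap, List.mem_map, Prod.exists,
    List.mem_zipIdx_iff_getElem?, mem_trueIndices, Prod.mk.injEq]
  constructor
  · rintro ⟨row, i, h1, j, h2, rfl, rfl⟩
    exact ⟨row, h1, h2⟩
  · rintro ⟨row, h1, h2⟩
    exact ⟨row, a, h1, b, h2, rfl, rfl⟩

theorem nodup_arcs (rows : List (List Bool)) : (arcs rows).Nodup := by
  rw [arcs, List.nodup_flatMap]
  refine ⟨fun p _ => (nodup_trueIndices _).map fun a b h => (Prod.mk.inj h).2, ?_⟩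
  have := nodup_zipIdx_snd rows
  rw [List.Nodup, List.pairwise_map] at this
  refine this.imp fun {p q} hne e hp hq => hne ?_
  obtain ⟨_, _, rfl⟩ := List.mem_map.1 hp
  obtain ⟨_, _, h⟩ := List.mem_map.1 hq
  exact (congrArg Prod.fst h).symm

theorem adj_arcs_ofFn {n : ℕ} (G : SimpleGraph (Fin n)) {a b : ℕ} :
    adj (arcs (List.ofFn fun i => List.ofFn fun j => decide (G.Adj i j))) a b ↔
      ∃ (ha : a < n) (hb : b < n), G.Adj ⟨a, ha⟩ ⟨b, hb⟩ := by
  rw [adj_arcs]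
  constructor
  · rintro ⟨row, h1, h2⟩
    rw [List.getElem?_ofFn] at h1
    split_ifs at h1 with ha
    obtain rfl := Option.some.inj h1
    rw [List.getElem?_ofFn] at h2
    split_ifs at h2 with hb
    exact ⟨ha, hb, of_decide_eq_true (Option.some.inj h2)⟩
  · rintro ⟨ha, hb, h⟩
    refine ⟨List.ofFn fun j => decide (G.Adj ⟨a, ha⟩ j), ?_, ?_⟩
    · rw [List.getElem?_ofFn, dif_pos ha]
    · rw [List.getElem?_ofFn, dif_pos hb]
      simp [h]

theorem represents_arcs {n : ℕ} (G : SimpleGraph (Fin n)) :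
    Represents (List.range n) (arcs (List.ofFn fun i => List.ofFn fun j => decide (G.Adj i j)))
      (fun i : Fin n => (i : ℕ)) G :=
  ⟨range_eq_ofFn n, Fin.val_injective, fun a b => by
    rw [adj_arcs_ofFn]
    exact ⟨fun ⟨_, _, h⟩ => h, fun h => ⟨a.2, b.2, h⟩⟩⟩

theorem isGraph_arcs {n : ℕ} (G : SimpleGraph (Fin n)) :
    IsGraph (List.range n) (arcs (List.ofFn fun i => List.ofFn fun j => decide (G.Adj i j))) where
  nodupV := List.nodup_range
  nodupE := nodup_arcs _
  symm a b h := by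
    rw [adj_arcs_ofFn] at h ⊢
    obtain ⟨ha, hb, h⟩ := h
    exact ⟨hb, ha, h.symm⟩
  irrefl a h := by
    rw [adj_arcs_ofFn] at h
    obtain ⟨ha, hb, h⟩ := h
    exact G.irrefl h
  mem a b h := by
    rw [adj_arcs_ofFn] at h
    obtain ⟨ha, hb, h⟩ := h
    exact ⟨List.mem_range.2 ha, List.mem_range.2 hb⟩

/-- The graph with vertices `V` and arcs `E`. -/
def toGraph (h : IsGraph V E) (φ : Fin m → ℕ) : SimpleGraph (Fin m) where
  Adj a b := adj E (φ a) (φ b)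
  symm := ⟨fun _ _ hab => h.symm hab⟩
  loopless := ⟨fun _ ha => h.irrefl _ ha⟩

theorem sz_list_of_forall {α : Type} [Enc α] {k : ℕ} (l : List α) (h : ∀ a ∈ l, sz a = k) :
    sz l = l.length * (k + 1) + 1 := by
  induction l with
  | nil => simp
  | cons a t ih =>
    rw [sz_cons, ih fun b hb => h b (by simp [hb]), h a (by simp), List.length_cons]
    ring

end Representation

/-! ### The complete graph on four vertices -/

theorem represents_fourClique : Represents (List.range 4)
    ((pairs (List.range 4)).filter fun e => decide (e.1 ≠ e.2)) (fun i : Fin 4 => (i : ℕ)) ⊤ :=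
  ⟨range_eq_ofFn 4, Fin.val_injective, by
    intro a b
    simp [adj, mem_pairs, Fin.ext_iff]⟩

theorem not_minModulator_fourClique : ¬ minModulator (⊤ : SimpleGraph (Fin 4)) ≤ 0 := by
  rw [represents_fourClique.minModulator_le_iff]
  rintro ⟨S, hS, hmod⟩
  rw [Finset.card_eq_zero.1 (Nat.le_zero.1 hS), IsMod, Finset.coe_empty, Set.sdiff_empty,
    ← elimAll_spec (D := List.range 4) (fun a b h => ?_) List.nodup_range (by simp) (by simp)] at hmod
  -- By `elimAll_spec` the claim is a finite computation: the elimination gets stuck on the four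
  -- vertices.
  · exact absurd hmod (by decide +kernel)
  · simp only [adj, List.mem_filter, mem_pairs, decide_eq_true_eq] at h ⊢
    exact ⟨h.1.symm, h.2.symm⟩

/-! ### The outcome of the main algorithm -/

section Outcome

open Enc

variable {V : List ℕ} {E : List (ℕ × ℕ)} {n : ℕ} {G : SimpleGraph (Fin n)}

theorem HasDisjointPaths.symm {k : ℕ} {x y : Fin n} (h : HasDisjointPaths G k x y) :
    HasDisjointPaths G k y x := by
  obtain ⟨P, hP⟩ := h
  refine ⟨fun i => (P i).reverse, fun i j hij v hi hj => ?_⟩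
  rw [SimpleGraph.Path.reverse_coe, SimpleGraph.Walk.support_reverse, List.mem_reverse] at hi hj
  exact (hP i j hij v hi hj).symm

/-- A vertex forced into all modulators within the budget can be deleted at the price of one unit.
-/
theorem exists_isMod_filter_ne {x t : ℕ} (ht : 1 ≤ t)
    (hS : ∀ S : Finset ℕ, S.card ≤ t → IsMod V E S → x ∈ S) :
    (∃ S : Finset ℕ, S.card ≤ t ∧ IsMod V E S) ↔
      ∃ S : Finset ℕ, S.card ≤ t - 1 ∧ IsMod (V.filter fun v => !decide (v = x)) E S := by
  constructor
  · rintro ⟨S, hcard, hmod⟩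
    have hxS := hS S hcard hmod
    refine ⟨S.erase x, by rw [Finset.card_erase_of_mem hxS]; omega, ?_⟩
    rw [IsMod] at hmod ⊢
    convert hmod using 1
    ext a
    by_cases hax : a = x <;> simp [hax, hxS]
  · rintro ⟨S, hcard, hmod⟩
    refine ⟨insert x S, (Finset.card_insert_le _ _).trans (by omega), ?_⟩
    rw [IsMod] at hmod ⊢
    convert hmod using 1
    ext a
    by_cases hax : a = x <;> simp [hax]

/-- A modulator may be intersected with the vertex set. -/
theorem IsMod.inter {S : Finset ℕ} (h : IsMod V E S) : IsMod V E (S ∩ V.toFinset) := by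
  rw [IsMod] at h ⊢
  convert h using 1
  ext a
  simp
  tauto

theorem card_inter_le {S : Finset ℕ} {t : ℕ} (hS : S.card ≤ t) :
    (S ∩ (List.range n).toFinset).card ≤ ((List.range n).filter fun v => decide (v < t)).length := by
  have h : ((List.range n).filter fun v => decide (v < t)).length = min n t := by
    rw [← List.toFinset_card_of_nodup (List.nodup_range.filter _)]
    have : ((List.range n).filter fun v => decide (v < t)).toFinset = Finset.range (min n t) := by
      ext a; simp
    rw [this, Finset.card_range]
  rw [h, le_min_iff]
  refine ⟨?_, (Finset.card_le_card Finset.inter_subset_left).trans hS⟩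
  refine (Finset.card_le_card Finset.inter_subset_right).trans ?_
  simpa using List.toFinset_card_le (List.range n)

theorem foldl_add_const {α : Type} (l : List α) (t s : ℕ) :
    l.foldl (fun s _ => s + t) s = s + l.length * t := by
  induction l generalizing s with
  | nil => simp
  | cons a l ih => rw [List.foldl_cons, ih, List.length_cons]; ring

theorem enc_fourClique :
    enc (0, (fourClique, 0)) = .pair (.num 0) (encInstance (⊤ : SimpleGraph (Fin 4)) 0) := by
  rw [encInstance, represents_fourClique.enc_matrix]
  rfl

/-- The set of vertices with numbers in a list. -/
def finOf (n : ℕ) (p : ℕ → Bool) : Finset (Fin n) := Finset.univ.filter fun i => p i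

theorem encSet_finOf (p : ℕ → Bool) : encSet (finOf n p) = enc ((List.range n).map p) := by
  rw [encSet, encPred_eq, range_eq_ofFn, List.map_ofFn]
  congr 2
  funext j
  simp [finOf]

variable {Y : List ℕ} {t : ℕ}

/-- The marking step of the algorithm yields a tidy and linked modulator. -/
theorem outcome_modulator (h : IsGraph (List.range n) E) (hmod : Elim (adj E) (lset (List.range n) \ lset Y) ∅ ∅)
    {T : List ℕ} (hT : T = (greedy (List.range n) E Y).2.2.1)
    {X : List ℕ} (hX : X = (List.range n).filter fun a => decide (a ∈ Y) || decide (a ∈ T))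
    (hG : Represents (List.range n) E (fun i : Fin n => (i : ℕ)) G) :
    ∃ G' : SimpleGraph (Fin n),
      enc (matrix (List.range n) (linkAll (List.range n) X t E)) = encGraph G' ∧
      (minModulator G ≤ t ↔ minModulator G' ≤ t) ∧
      IsTidyModulator G' (finOf n fun a => decide (a ∈ Y) || decide (a ∈ T)) ∧
      IsLinked G' t (finOf n fun a => decide (a ∈ Y) || decide (a ∈ T)) := by
  obtain ⟨hTn, hTV, -, hgood, -⟩ := greedy_spec h hmod
  rw [← hT] at hTn hTV hgood
  have hmemX : ∀ a, a ∈ X ↔ a < n ∧ (a ∈ Y ∨ a ∈ T) := by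
    intro a; rw [hX]; simp
  obtain ⟨h', hle, hnew, hsmall, hflow⟩ := linkAll_spec (X := X)
    (fun a ha => List.mem_range.2 ((hmemX a).1 ha).1) t h
  have hR : Represents (List.range n) (linkAll (List.range n) X t E) (fun i : Fin n => (i : ℕ))
      (toGraph h' fun i : Fin n => (i : ℕ)) := ⟨hG.list, hG.injective, fun _ _ => Iff.rfl⟩
  have hmemZ : ∀ i : Fin n, i ∈ ((finOf n fun a => decide (a ∈ Y) || decide (a ∈ T)) : Set (Fin n)) ↔
      (i : ℕ) ∈ Y ∨ (i : ℕ) ∈ T := by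
    intro i; simp [finOf]
  have hZX : ∀ i : Fin n, i ∈ ((finOf n fun a => decide (a ∈ Y) || decide (a ∈ T)) : Set (Fin n)) →
      (i : ℕ) ∈ X := fun i hi => (hmemX i).2 ⟨i.2, (hmemZ i).1 hi⟩
  refine ⟨_, hR.enc_matrix.symm, ?_, ⟨?_, ?_⟩, ?_⟩
  · rw [hG.minModulator_le_iff, hR.minModulator_le_iff]
    constructor
    · rintro ⟨S, hS, hm⟩
      exact ⟨S, hS, hsmall S hS hm⟩
    · rintro ⟨S, hS, hm⟩
      exact ⟨S, hS, hm.mono_empty subset_rfl fun a _ b _ hab => hle a b hab⟩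
  · rw [hR.isModulator_iff]
    refine hmod.mono_empty ?_ ?_
    · rintro _ ⟨i, hi, rfl⟩
      exact ⟨List.mem_range.2 i.2, fun hY => hi ((hmemZ i).2 (.inl hY))⟩
    · rintro _ ⟨i, hi, rfl⟩ b - hab
      exact (hnew _ _ hab).resolve_right fun hx => hi ((hmemZ i).2 ((hmemX i).1 hx.1).2)
  · intro x hx
    rw [hR.isModulator_iff]
    -- New edges have both ends in the modulator, and only its vertex `x` is left in this graph.
    have hedge : ∀ a ∈ (fun i : Fin n => (i : ℕ)) ''
        (((finOf n fun a => decide (a ∈ Y) || decide (a ∈ T)) : Set (Fin n)) \ {x})ᶜ,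
        ∀ b ∈ (fun i : Fin n => (i : ℕ)) ''
        (((finOf n fun a => decide (a ∈ Y) || decide (a ∈ T)) : Set (Fin n)) \ {x})ᶜ,
        adj (linkAll (List.range n) X t E) a b → adj E a b := by
      rintro _ ⟨i, hi, rfl⟩ _ ⟨j, hj, rfl⟩ hab
      refine (hnew _ _ hab).resolve_right fun ⟨h1, h2⟩ => ?_
      have hix : i = x := by
        by_contra hne
        exact hi ⟨(hmemZ i).2 ((hmemX i).1 h1).2, hne⟩
      have hjx : j = x := by
        by_contra hne
        exact hj ⟨(hmemZ j).2 ((hmemX j).1 h2).2, hne⟩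
      rw [hix, hjx] at hab
      exact h'.irrefl _ hab
    -- For `x ∈ Y` the rest is what survives outside `Y ∪ T`, which is good for `x`. For `x ∈ T` the
    -- rest is still a part of `G - Y`.
    rcases (hmemZ x).1 hx with hxY | hxT
    · have hg := (good_iff_elim h.symm h.irrefl ((finite_lset (List.range n)).subset
        fun a ha => ha.1) _).1 (hgood x hxY)
      refine hg.mono_empty ?_ hedge
      rintro _ ⟨i, hi, rfl⟩
      by_cases hix : i = x
      · exact .inl (by rw [hix]; rfl)
      · have : ¬ ((i : ℕ) ∈ Y ∨ (i : ℕ) ∈ T) := fun hc => hi ⟨(hmemZ i).2 hc, hix⟩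
        exact .inr ⟨List.mem_range.2 i.2, fun hc => this (.inl hc), fun hc => this (.inr hc)⟩
    · refine hmod.mono_empty ?_ hedge
      rintro _ ⟨i, hi, rfl⟩
      refine ⟨List.mem_range.2 i.2, fun hiY => hi ⟨(hmemZ i).2 (.inl hiY), ?_⟩⟩
      rintro rfl
      exact (hTV _ hxT).2 hiY
  · intro x hx y hy hxy hadj k hk
    have hV : ∀ a : Fin n, (a : ℕ) ∈ List.range n := fun a => List.mem_range.2 a.2
    -- Paths can be reversed, so a bound on the flow in either direction is enough.
    have h1 := le_flow_of_hasDisjointPaths h' (fun a b hab => hab) hV hxy hadj hk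
    have h2 := le_flow_of_hasDisjointPaths h' (fun a b hab => hab) hV hxy.symm
      (fun hyx => hadj hyx.symm) hk.symm
    rcases hflow x (hZX x hx) y (hZX y hy) (fun he => hxy (Fin.ext he)) hadj with hf | hf
    · exact h1.trans hf
    · exact h2.trans hf

theorem card_finOf_le (T : List ℕ) :
    (finOf n fun a => decide (a ∈ Y) || decide (a ∈ T)).card ≤ Y.length + T.length := by
  rw [← Finset.card_image_of_injective _ Fin.val_injective, ← List.length_append]
  refine (Finset.card_le_card fun a ha => ?_).trans (List.toFinset_card_le _)
  obtain ⟨i, hi, rfl⟩ := Finset.mem_image.1 ha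
  simpa [finOf] using hi

/-- The two possible outcomes of the reduction of an instance. -/
theorem reduce_spec {ε : ℝ} {R : ℕ} (hε : 1 ≤ ε) (hRε : (R : ℝ) ≤ ε + 1) (hn : 4 < n) (ht : 1 ≤ t)
    (h : IsGraph (List.range n) E) (hG : Represents (List.range n) E (fun i : Fin n => (i : ℕ)) G)
    (hY : ∀ a ∈ Y, a ∈ List.range n) (hmod : Elim (adj E) (lset (List.range n) \ lset Y) ∅ ∅)
    (happrox : minModulator G ≤ t → Y.length ≤ R * t) :
    (∃ (m : ℕ) (G' : SimpleGraph (Fin m)) (t' : ℕ),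
      reduce R (List.range n) E Y t = .pair (.num 0) (encInstance G' t') ∧
      (minModulator G ≤ t ↔ minModulator G' ≤ t') ∧ m < n ∧ t' ≤ t) ∨
    ∃ (G' : SimpleGraph (Fin n)) (X : Finset (Fin n)),
      reduce R (List.range n) E Y t = .pair (.num 1) (.pair (encInstance G' t) (encSet X)) ∧
      (minModulator G ≤ t ↔ minModulator G' ≤ t) ∧
      IsTidyModulator G' X ∧ IsLinked G' t X ∧ (X.card : ℝ) ≤ ε * t * (3 * t + 4) := by
  have hno : ¬ minModulator G ≤ t → ∃ (m : ℕ) (G' : SimpleGraph (Fin m)) (t' : ℕ),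
      enc (0, (fourClique, 0)) = .pair (.num 0) (encInstance G' t') ∧
      (minModulator G ≤ t ↔ minModulator G' ≤ t') ∧ m < n ∧ t' ≤ t := fun hno =>
    ⟨4, ⊤, 0, enc_fourClique, iff_of_false hno not_minModulator_fourClique, hn, Nat.zero_le t⟩
  rw [reduce]
  by_cases hlarge : R * t < Y.length
  · rw [decide_eq_true hlarge, cond_true]
    exact .inl (hno fun hle => absurd (happrox hle) (not_le.2 hlarge))
  rw [decide_eq_false hlarge, cond_false]
  rcases headCase_cases (Y.filter fun x => decide (t < badCount E (greedy (List.range n) E Y).2.2.2 x))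
    (bif decide (((List.range n).filter fun v => decide (v < t)).foldl (fun s _ => s + t) 0 <
        (greedy (List.range n) E Y).2.2.2.length) then enc (0, (fourClique, 0)) else
      enc (1, (matrix (List.range n) (linkAll (List.range n) ((List.range n).filter fun a => decide (a ∈ Y) ||
          decide (a ∈ (greedy (List.range n) E Y).2.2.1)) t E), t),
        (List.range n).map fun v => (decide (v ∈ Y) || decide (v ∈ (greedy (List.range n) E Y).2.2.1))))
    (fun x => enc (0, (matrix ((List.range n).filter fun v => !decide (v = x)) E, t - 1)))
    with ⟨h0, heq⟩ | ⟨x, hx, heq⟩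
  · rw [heq]
    have hbad : ∀ x ∈ Y, badCount E (greedy (List.range n) E Y).2.2.2 x ≤ t := by
      intro x hx
      by_contra hlt
      have : x ∈ Y.filter fun x => decide (t < badCount E (greedy (List.range n) E Y).2.2.2 x) :=
        List.mem_filter.2 ⟨hx, by simpa using hlt⟩
      rw [h0] at this
      simp at this
    rw [foldl_add_const, zero_add]
    by_cases hmany : ((List.range n).filter fun v => decide (v < t)).length * t <
        (greedy (List.range n) E Y).2.2.2.length
    · rw [decide_eq_true hmany, cond_true]
      refine .inl (hno fun hle => ?_)
      obtain ⟨S, hS, hSm⟩ := (hG.minModulator_le_iff t).1 hle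
      have := length_obstructions_le h hmod hY hSm.inter ht hbad
      exact absurd (this.trans (Nat.mul_le_mul_right t (card_inter_le hS))) (not_le.2 hmany)
    · rw [decide_eq_false hmany, cond_false]
      obtain ⟨G', hG', hiff, htidy, hlinked⟩ := outcome_modulator (t := t) h hmod rfl rfl hG
      refine .inr ⟨G', _, ?_, hiff, htidy, hlinked, ?_⟩
      · rw [encInstance, ← hG', encSet_finOf]
        rfl
      · have hT := (greedy_spec h hmod).2.2.1
        have hcount : ((List.range n).filter fun v => decide (v < t)).length ≤ t := by
          rw [← List.toFinset_card_of_nodup (List.nodup_range.filter _)]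
          refine (Finset.card_le_card (t := Finset.range t) fun a ha => ?_).trans_eq
            (Finset.card_range t)
          simp at ha ⊢
          exact ha.2
        have hle : (finOf n fun a => decide (a ∈ Y) ||
            decide (a ∈ (greedy (List.range n) E Y).2.2.1)).card ≤ R * t + 3 * (t * t) := by
          have := Nat.mul_le_mul_right t hcount
          have := card_finOf_le (n := n) (Y := Y) (greedy (List.range n) E Y).2.2.1
          omega
        have hle' : ((finOf n fun a => decide (a ∈ Y) ||
            decide (a ∈ (greedy (List.range n) E Y).2.2.1)).card : ℝ) ≤ R * t + 3 * (t * t) := by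
          exact_mod_cast hle
        have ht0 : (0 : ℝ) ≤ t := Nat.cast_nonneg t
        -- As `1 ≤ ε`, rounding up costs at most a factor 2 in the first term, and `2 * ε * t + 3 *
        -- ε * t * t` is below the claimed bound.
        have h1 : (R : ℝ) * t ≤ (ε + 1) * t := mul_le_mul_of_nonneg_right hRε ht0
        have h2 : (1 : ℝ) * t ≤ ε * t := mul_le_mul_of_nonneg_right hε ht0
        have h3 : (1 : ℝ) * (t * t) ≤ ε * (t * t) := mul_le_mul_of_nonneg_right hε (by positivity)
        linarith
  · rw [heq]
    obtain ⟨hxY, hlt⟩ := List.mem_filter.1 hx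
    have hlt := of_decide_eq_true hlt
    have hxV := hY x hxY
    left
    set V' := (List.range n).filter fun v => !decide (v = x) with hV'
    -- The remaining vertex numbers have a gap at `x`; position in the list `V'` renumbers them.
    have hR : Represents V' E V'.get (toGraph h V'.get) :=
      ⟨(List.ofFn_get V').symm, List.nodup_iff_injective_get.1 (List.nodup_range.filter _),
        fun _ _ => Iff.rfl⟩
    refine ⟨V'.length, toGraph h V'.get, t - 1, ?_, ?_, ?_, Nat.sub_le t 1⟩
    · rw [encInstance, hR.enc_matrix]
      rfl
    · rw [hG.minModulator_le_iff, hR.minModulator_le_iff]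
      exact exists_isMod_filter_ne ht fun S hS hm =>
        mem_of_card_lt_badCount h hmod hY hm hxY (hS.trans_lt hlt)
    · have := length_filter_lt (l := List.range n) (p := fun v => !decide (v = x)) (q := fun _ => true)
        (by simp) hxV rfl (by simp)
      simpa using this

end Outcome

open Classical in
theorem trueIndices_ofFn_spec {n : ℕ} (X : Finset (Fin n)) :
    (∀ a, a ∈ trueIndices (List.ofFn fun j => decide (j ∈ X)) ↔ ∃ j ∈ X, (j : ℕ) = a) ∧
    (trueIndices (List.ofFn fun j => decide (j ∈ X))).length = X.card := by
  have hmem : ∀ a, a ∈ trueIndices (List.ofFn fun j => decide (j ∈ X)) ↔ ∃ j ∈ X, (j : ℕ) = a := by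
    intro a
    rw [mem_trueIndices, List.getElem?_ofFn]
    constructor
    · intro h
      split_ifs at h with ha
      exact ⟨⟨a, ha⟩, of_decide_eq_true (Option.some.inj h), rfl⟩
    · rintro ⟨j, hj, rfl⟩
      simp [hj]
  refine ⟨hmem, ?_⟩
  rw [← List.toFinset_card_of_nodup (nodup_trueIndices _),
    ← Finset.card_image_of_injective X Fin.val_injective]
  congr 1
  ext a
  rw [List.mem_toFinset, hmem, Finset.mem_image]

end TW2D

/-! ### The theorem -/

open TW2D Enc in
theorem mainTheorem4 (ε : ℝ) (A : TW2D.Prog) (hA : TW2D.IsPolyApprox ε A) :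
    ∃ (B : TW2D.Prog) (p : Polynomial ℕ),
      ∀ (n : ℕ) (G : SimpleGraph (Fin n)) (t : ℕ), ¬ TW2D.IsTrivial G t →
        ∃ (out : TW2D.Data) (c : ℕ),
          TW2D.Runs B (TW2D.encInstance G t) out c ∧ c ≤ p.eval n ∧
          ((∃ (m : ℕ) (G' : SimpleGraph (Fin m)) (t' : ℕ),
              out = .pair (.num 0) (TW2D.encInstance G' t') ∧
              (TW2D.minModulator G ≤ t ↔ TW2D.minModulator G' ≤ t') ∧
              m < n ∧ t' ≤ t) ∨
            (∃ (G' : SimpleGraph (Fin n)) (X : Finset (Fin n)),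
              out = .pair (.num 1) (.pair (TW2D.encInstance G' t) (TW2D.encSet X)) ∧
              (TW2D.minModulator G ≤ t ↔ TW2D.minModulator G' ≤ t) ∧
              TW2D.IsTidyModulator G' X ∧ TW2D.IsLinked G' t X ∧
              (X.card : ℝ) ≤ ε * t * (3 * t + 4))) := by
  classical
  obtain ⟨hε, pA, hA⟩ := hA
  obtain ⟨P, q, hP⟩ := PT.mainFun ⌈ε⌉₊
  -- Sizes of the encoded matrix and of the encoded bit list. The budget `t` is one node whatever
  -- its value, so the bound depends on `n` only.
  let len : Polynomial ℕ := Polynomial.X * (2 * Polynomial.X + 2) + 1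
  let len' : Polynomial ℕ := 2 * Polynomial.X + 1
  refine ⟨.seq (.pair (.seq (.op .fst) A) (.op .id)) P,
    3 * (len + 2) + pA + q.comp (len' + len + 3), fun n G t hG => ?_⟩
  obtain ⟨X, cA, hrun, hcA, hX, -, hXε⟩ := hA n G
  set rows := List.ofFn fun i => List.ofFn fun j => decide (G.Adj i j) with hrows
  set bits := List.ofFn fun j => decide (j ∈ X) with hbits
  have hszbits : sz bits = 2 * n + 1 := by
    rw [sz_list_of_forall (k := 1) bits fun _ _ => rfl, hbits, List.length_ofFn]
    ring
  have hszrows : sz rows = n * (2 * n + 2) + 1 := by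
    rw [sz_list_of_forall (k := 2 * n + 1) rows, hrows, List.length_ofFn]
    intro a ha
    obtain ⟨i, rfl⟩ := (List.mem_ofFn' _ _).1 ha
    rw [sz_list_of_forall (k := 1) _ fun _ _ => rfl, List.length_ofFn]
    ring
  obtain ⟨c, hc, hcq⟩ := hP (bits, (rows, t))
  have hin : encInstance G t = enc (rows, t) := by
    rw [encInstance, encGraph_eq]; rfl
  have hset : encSet X = enc bits := by
    rw [encSet, encPred_eq, hbits]
    congr!
  have hpair : Runs (.pair (.seq (.op .fst) A) (.op .id)) (encInstance G t)
      (.pair (encSet X) (encInstance G t)) _ :=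
    .pair (.seq (.op .fst (encInstance G t)) hrun) (.op .id (encInstance G t))
  rw [hset, hin] at hpair
  rw [hin]
  refine ⟨mainFun ⌈ε⌉₊ (bits, (rows, t)), _, hpair.seq hc, ?_, ?_⟩
  · have hsz : (enc (rows, t)).size = n * (2 * n + 2) + 3 := by
      change sz (rows, t) = _
      rw [sz_pair, hszrows, sz_nat]
    have hsz' : sz (bits, (rows, t)) = (len' + len + 3).eval n := by
      rw [sz_pair, sz_pair, hszbits, hszrows, sz_nat]
      simp [len, len']
      ring
    rw [hsz'] at hcq
    rw [hsz]
    simp only [Polynomial.eval_add, Polynomial.eval_comp, Polynomial.eval_mul] at hcq ⊢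
    have hlen : len.eval n = n * (2 * n + 2) + 1 := by simp [len]
    simp only [Polynomial.eval_ofNat, hlen] at hcq ⊢
    omega
  · have hV : rows.zipIdx.map Prod.snd = List.range n := by
      rw [List.zipIdx_map_snd, List.range_eq_range', hrows, List.length_ofFn]
    obtain ⟨hmem, hcard⟩ := trueIndices_ofFn_spec X
    rw [← hbits] at hmem hcard
    simp only [IsTrivial, not_or, Nat.card_eq_fintype_card, Fintype.card_fin, not_le] at hG
    rw [mainFun, hV]
    refine reduce_spec hε (Nat.ceil_lt_add_one (by linarith)).le hG.1 (Nat.one_le_iff_ne_zero.2 hG.2.2.1)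
      (isGraph_arcs G) (represents_arcs G) ?_ ?_ ?_
    · intro a ha
      obtain ⟨j, -, rfl⟩ := (hmem a).1 ha
      exact List.mem_range.2 j.2
    · rw [(represents_arcs G).isModulator_iff] at hX
      convert hX using 1
      ext a
      simp only [Set.mem_sdiff, mem_lset, List.mem_range, hmem, Set.mem_image, Set.mem_compl_iff,
        Finset.mem_coe]
      constructor
      · rintro ⟨ha, hna⟩
        exact ⟨⟨a, ha⟩, fun hj => hna ⟨_, hj, rfl⟩, rfl⟩
      · rintro ⟨j, hj, rfl⟩
        refine ⟨j.2, ?_⟩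
        rintro ⟨i, hi, hij⟩
        exact hj (Fin.ext hij ▸ hi)
    -- If the optimum is at most `t`, the approximation guarantee gives at most `ε * t` vertices;
    -- rounding `ε` up keeps the test of the algorithm within natural numbers.
    · intro hle
      rw [hcard]
      have h1 : (X.card : ℝ) ≤ (⌈ε⌉₊ : ℝ) * t := hXε.trans (mul_le_mul (Nat.le_ceil ε)
        (by exact_mod_cast hle) (Nat.cast_nonneg _) (Nat.cast_nonneg _))
      exact_mod_cast h1
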